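/- **Setting.** Let $Q$ be a smooth manifold with a Riemannian metric $\langle\!\langle\cdot,\cdot\rangle\!\rangle$ (the kinetic energy), let $U\in C^\infty(Q)$ be a potential and let $D\subset TQ$ be a smooth distribution of rank $r$ (the constraints). A Lie group $G$ acts smoothly, freely and properly on $Q$, by isometries, leaving $U$ and $D$ invariant, and $T_qQ=D_q\oplus(\mathfrak g\cdot q)$ for all $q\in Q$, where $\mathfrak g\cdot q$ is the tangent space to the $G$-orbit through $q$. This is a *Chaplygin system with $r$ degrees of freedom*; it is *purely kinetic* if $U=0$. Let $S=Q/G$, $\dim S=r$, with projection $\pi:Q\to S$, let $\mathcal P:TQ\to D$ be the orthogonal projector, let $\mathrm{hor}$ be the horizontal lift of vectors (and vector fields) from $S$ to $D$, and let $\tau_S:T^*S\to S$ be the cotangent bundle, with canonical symplectic form $\Omega_{can}$ and Liouville volume form $\nu=\Omega_{can}^r$. *Reduced dynamics.* Let $h_c$ be the restriction to the dual bundle $D^*\cong\mathcal P^*(D^*)\subset T^*Q$ of the Hamiltonian $h(\beta)=\frac12\|\beta\|^2+U$ on $T^*Q$, and let $i_D^*:T^*Q\to D^*$ be the restriction map.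 The nonholonomic vector field $X_{nh}$ on $D^*$ is given by $X_{nh}[\psi]=\{\psi\circ i_D^*,\,h_c\circ i_D^*\}_{T^*Q}\circ\mathcal P^*$ for $\psi\in C^\infty(D^*)$. Under $D^*/G\cong T^*S$, $[\beta]\mapsto\beta\circ\mathrm{hor}_q$ for $\beta\in D_q^*$, the vector field $X_{nh}$ and the function $h_c$ descend to the reduced vector field $\overline X_{nh}$ and the reduced Hamiltonian $H$ on $T^*S$. *Definitions.* The gyroscopic tensor $\mathcal T$ on $S$ is $\mathcal T(Y,Z)(\pi(q))=T_q\pi\big(\mathcal P[\mathrm{hor}\,Y,\mathrm{hor}\,Z](q)\big)-[Y,Z](\pi(q))$. For $\phi\in C^\infty(S)$ the system is *$\phi$-simple* if $\mathcal T(Y,Z)=Z[\phi]\,Y-Y[\phi]\,Z$ for all vector fields $Y,Z$ on $S$. An *invariant measure* is a volume form $\mu=\exp(\overline\sigma)\,\nu$ on $T^*S$, $\overline\sigma\in C^\infty(T^*S)$, with $\mathcal L_{\overline X_{nh}}\mu=0$. The system is *Hamiltonisable with the time reparametrisation $dt=g(s)\,d\tau$*, where $g\in C^\infty(S)$ is positive,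 if there is a symplectic form $\overline\Omega$ on $T^*S$ with $\mathbf i_{(g\circ\tau_S)\overline X_{nh}}\overline\Omega=dH$. **Statement.** (i) A purely kinetic Chaplygin system with two degrees of freedom has an invariant measure if and only if it is $\phi$-simple for some $\phi\in C^\infty(S)$. (ii) (Chaplygin's reducing multiplier theorem.) If a Chaplygin system with two degrees of freedom preserves the measure $\exp(\sigma\circ\tau_S)\,\nu$, $\sigma\in C^\infty(S)$, then it is Hamiltonisable with the time reparametrisation $dt=\exp(-\sigma(s))\,d\tau$. (iii) If a Chaplygin system with any number of degrees of freedom is $\phi$-simple, then for every smooth $G$-invariant function $W$ on $Q$ the system with potential $U+W$ is Hamiltonisable with the time reparametrisation $dt=\exp(-\phi(s))\,d\tau$. In particular the Hamiltonisation in (ii) persists, with the same reparametrisation $dt=\exp(-\sigma(s))\,d\tau$, when an arbitrary smooth $G$-invariant potential is added. -/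

import Mathlib

open scoped Manifold ContDiff Bundle Topology

noncomputable section

namespace Chaplygin

/-! ### Differential forms on manifolds -/

section Forms

variable {E : Type*} [NormedAddCommGroup E] [NormedSpace ℝ E] {H : Type*} [TopologicalSpace H]

instance instFiniteDimensionalTangentSpace [FiniteDimensional ℝ E] (I : ModelWithCorners ℝ E H)
    {M : Type*} [TopologicalSpace M] [ChartedSpace H M] (x : M) :
    FiniteDimensional ℝ (TangentSpace I x) :=
  inferInstanceAs (FiniteDimensional ℝ E)

instance instT2SpaceTangentSpace (I : ModelWithCorners ℝ E H)
    {M : Type*} [TopologicalSpace M] [ChartedSpace H M] (x : M) : T2Space (TangentSpace I x) :=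
  inferInstanceAs (T2Space E)

/-- Differential `k`-forms on `M` (no regularity imposed). -/
abbrev DiffForm (I : ModelWithCorners ℝ E H) (M : Type*) [TopologicalSpace M] [ChartedSpace H M]
    (k : ℕ) : Type _ :=
  (x : M) → TangentSpace I x [⋀^Fin k]→L[ℝ] ℝ

/-- Vector fields on `M` (no regularity imposed). -/
abbrev VField (I : ModelWithCorners ℝ E H) (M : Type*) [TopologicalSpace M] [ChartedSpace H M] :
    Type _ :=
  (x : M) → TangentSpace I x

variable {I : ModelWithCorners ℝ E H} {M : Type*} [TopologicalSpace M] [ChartedSpace H M] {k : ℕ}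

/-- A vector field is smooth if it is a smooth section of the tangent bundle. -/
def IsSmoothVField [IsManifold I 1 M] (X : VField I M) : Prop :=
  ContMDiff I I.tangent ∞ (fun x => (⟨x, X x⟩ : TangentBundle I M))

/-- The expression of a form in the preferred chart at `x₀`, i.e. its pullback under the inverse
of that chart. -/
def inChart (η : DiffForm I M k) (x₀ : M) (y : E) : E [⋀^Fin k]→L[ℝ] ℝ :=
  (η ((extChartAt I x₀).symm y)).compContinuousLinearMap
    (mfderivWithin 𝓘(ℝ, E) I (extChartAt I x₀).symm (Set.range I) y)

/-- A form is smooth if all its chart expressions are. -/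
def IsSmoothForm (η : DiffForm I M k) : Prop :=
  ∀ x₀ : M, ContDiffOn ℝ ∞ (inChart η x₀) (extChartAt I x₀).target

/-- The exterior derivative, computed at `x` in the preferred chart at `x`. -/
def extD (η : DiffForm I M k) : DiffForm I M (k + 1) := fun x =>
  (extDerivWithin (inChart η x) (Set.range I) (extChartAt I x x)).compContinuousLinearMap
    (mfderiv I 𝓘(ℝ, E) (extChartAt I x) x)

/-- The Lie derivative `(L_X η)(v₁, …, v_k)`, computed at `x` in the preferred chart at `x` by
`(L_X η)(v) = (Dη · X)(v) + ∑ i, η(v₁, …, DX · v_i, …, v_k)`. -/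
def lieD (X : VField I M) (η : DiffForm I M k) (x : M) (v : Fin k → TangentSpace I x) : ℝ :=
  let y : E := extChartAt I x x
  let X' : E → E := VectorField.mpullbackWithin 𝓘(ℝ, E) I (extChartAt I x).symm X (Set.range I)
  let v' : Fin k → E := fun i => mfderiv I 𝓘(ℝ, E) (extChartAt I x) x (v i)
  fderivWithin ℝ (inChart η x) (Set.range I) y (X' y) v'
    + ∑ i, inChart η x y (Function.update v' i (fderivWithin ℝ X' (Set.range I) y (v' i)))

/-- A symplectic form: smooth, closed and nondegenerate. -/
structure IsSymplecticForm (Ω : DiffForm I M 2) : Prop where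
  smooth : IsSmoothForm Ω
  closed : ∀ x, extD Ω x = 0
  nondegenerate : ∀ x (U : TangentSpace I x), (∀ V, Ω x ![U, V] = 0) → U = 0

end Forms

section Wedge

variable {V : Type*} [AddCommGroup V] [Module ℝ V] [TopologicalSpace V]

theorem prod_pairs_update (Ω : V [⋀^Fin 2]→L[ℝ] ℝ) {k : ℕ} (v : Fin (k * 2) → V) (i₀ : Fin k)
    (j₀ : Fin 2) (x : V) :
    (∏ i : Fin k, Ω (fun j : Fin 2 =>
        Function.update v (finProdFinEquiv (i₀, j₀)) x (finProdFinEquiv (i, j))))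
      = Ω (Function.update (fun j : Fin 2 => v (finProdFinEquiv (i₀, j))) j₀ x)
        * ∏ i ∈ Finset.univ.erase i₀, Ω (fun j : Fin 2 => v (finProdFinEquiv (i, j))) := by
  rw [← Finset.mul_prod_erase Finset.univ _ (Finset.mem_univ i₀)]
  congr 1
  · congr 1
    funext j
    by_cases h : j = j₀
    · subst h; simp
    · rw [Function.update_of_ne h, Function.update_of_ne]
      simpa using h
  · refine Finset.prod_congr rfl fun i hi => ?_
    congr 1
    funext j
    rw [Function.update_of_ne]
    have := Finset.ne_of_mem_erase hi
    simp [this]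

/-- The multilinear map `v ↦ Ω(v₀, v₁) Ω(v₂, v₃) ⋯ Ω(v_{2k-2}, v_{2k-1})`. -/
def pairProd (Ω : V [⋀^Fin 2]→L[ℝ] ℝ) (k : ℕ) :
    ContinuousMultilinearMap ℝ (fun _ : Fin (k * 2) => V) ℝ where
  toFun v := ∏ i : Fin k, Ω (fun j : Fin 2 => v (finProdFinEquiv (i, j)))
  map_update_add' := by
    intro inst v m x y
    obtain ⟨⟨i₀, j₀⟩, rfl⟩ := finProdFinEquiv.surjective m
    obtain rfl : inst = instDecidableEqFin (k * 2) := Subsingleton.elim _ _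
    simp only [prod_pairs_update, ContinuousAlternatingMap.map_update_add, add_mul]
  map_update_smul' := by
    intro inst v m c x
    obtain ⟨⟨i₀, j₀⟩, rfl⟩ := finProdFinEquiv.surjective m
    obtain rfl : inst = instDecidableEqFin (k * 2) := Subsingleton.elim _ _
    simp only [prod_pairs_update, ContinuousAlternatingMap.map_update_smul, smul_eq_mul, mul_assoc]
  cont := by
    refine continuous_finsetProd _ fun i _ => Ω.cont.comp ?_
    exact continuous_pi fun j => continuous_apply _

/-- The `k`-th exterior power `Ω ∧ ⋯ ∧ Ω`, that is
`(v₁, …, v_{2k}) ↦ 2⁻ᵏ ∑_σ sgn(σ) Ω(v_{σ1}, v_{σ2}) ⋯ Ω(v_{σ(2k-1)}, v_{σ(2k)})`. -/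
def wedgePow (Ω : V [⋀^Fin 2]→L[ℝ] ℝ) (k : ℕ) : V [⋀^Fin (k * 2)]→L[ℝ] ℝ :=
  ((2 : ℝ) ^ k)⁻¹ • ContinuousMultilinearMap.alternatization (pairProd Ω k)

end Wedge

/-! ### Cotangent bundles -/

theorem finrank_continuousDual (V : Type*) [AddCommGroup V] [Module ℝ V] [TopologicalSpace V]
    [IsTopologicalAddGroup V] [ContinuousSMul ℝ V] [T2Space V] [FiniteDimensional ℝ V] :
    Module.finrank ℝ V = Module.finrank ℝ (V →L[ℝ] ℝ) := by
  rw [← Subspace.dual_finrank_eq]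
  exact LinearEquiv.finrank_eq LinearMap.toContinuousLinearMap

section Cotangent

variable {E : Type*} [NormedAddCommGroup E] [NormedSpace ℝ E] {H : Type*} [TopologicalSpace H]

/-- The cotangent bundle `T*M`. -/
abbrev CotangentBundle (I : ModelWithCorners ℝ E H) (M : Type*) [TopologicalSpace M]
    [ChartedSpace H M] : Type _ :=
  Bundle.TotalSpace (E →L[ℝ] ℝ) (fun x : M => TangentSpace I x →L[ℝ] ℝ)

/-- The model with corners of `T*M`. -/
abbrev cotangentModel (I : ModelWithCorners ℝ E H) :
    ModelWithCorners ℝ (E × (E →L[ℝ] ℝ)) (ModelProd H (E →L[ℝ] ℝ)) :=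
  I.prod 𝓘(ℝ, E →L[ℝ] ℝ)

variable (I : ModelWithCorners ℝ E H) (M : Type*) [TopologicalSpace M] [ChartedSpace H M]
  [IsManifold I 1 M]

/-- The Liouville 1-form `λ(α)(U) = α(Tτ U)` on `T*M`. -/
def liouvilleForm : DiffForm (cotangentModel I) (CotangentBundle I M) 1 := fun α =>
  ContinuousAlternatingMap.ofSubsingleton ℝ _ ℝ 0
    (α.2.comp (mfderiv (cotangentModel I) I (fun β : CotangentBundle I M => β.proj) α))

/-- The canonical symplectic form `Ω_can = -dλ` on `T*M`. -/
def canonicalForm : DiffForm (cotangentModel I) (CotangentBundle I M) 2 :=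
  -extD (liouvilleForm I M)

/-- The Liouville volume form `ν = Ω_can ^ k` on `T*M`, where `k = dim M`. -/
def liouvilleVolume (k : ℕ) : DiffForm (cotangentModel I) (CotangentBundle I M) (k * 2) :=
  fun α => wedgePow (canonicalForm I M α) k

end Cotangent

/-! ### Chaplygin systems -/

/-- A `G`-Chaplygin system with `r` degrees of freedom: configuration manifold `Q` of dimension
`n`, kinetic energy metric, potential `U`, constraint distribution `D` of rank `r`, and a Lie group
`G` acting smoothly, freely and properly on `Q`, leaving everything invariant, such that
`T_q Q = D_q ⊕ 𝔤 · q`. The shape space `S = Q / G`, of dimension `r`, is given together with the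
orbit projection `π : Q → S`: a surjective submersion whose fibres are the `G`-orbits (this
determines the manifold `S` up to a unique diffeomorphism). -/
structure ChaplyginSystem (n r m : ℕ) (Q S G : Type*)
    [TopologicalSpace Q] [ChartedSpace (EuclideanSpace ℝ (Fin n)) Q] [IsManifold (𝓡 n) ∞ Q]
    [TopologicalSpace S] [ChartedSpace (EuclideanSpace ℝ (Fin r)) S] [IsManifold (𝓡 r) ∞ S]
    [TopologicalSpace G] [ChartedSpace (EuclideanSpace ℝ (Fin m)) G] [Group G]
    [LieGroup (𝓡 m) ∞ G] [MulAction G Q] where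
  /-- The action is smooth. -/
  smooth_smul : ContMDiffSMul (𝓡 m) (𝓡 n) ∞ G Q
  /-- The action is free. -/
  free : ∀ (g : G) (q : Q), g • q = q → g = 1
  /-- The action is proper. -/
  proper : ProperSMul G Q
  /-- The orbit projection `π : Q → S = Q / G`. -/
  proj : Q → S
  proj_smooth : ContMDiff (𝓡 n) (𝓡 r) ∞ proj
  proj_surjective : Function.Surjective proj
  proj_submersion : ∀ q, Function.Surjective (mfderiv (𝓡 n) (𝓡 r) proj q)
  proj_fibre : ∀ q q', proj q = proj q' ↔ ∃ g : G, g • q = q'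
  /-- The kinetic energy metric. -/
  metric : Bundle.ContMDiffRiemannianMetric (𝓡 n) ∞ (EuclideanSpace ℝ (Fin n))
    (fun q : Q => TangentSpace (𝓡 n) q)
  /-- `G` acts by isometries. -/
  metric_invariant : ∀ (g : G) (q : Q) (u v : TangentSpace (𝓡 n) q),
    metric.inner (g • q) (mfderiv (𝓡 n) (𝓡 n) (fun x : Q => g • x) q u)
      (mfderiv (𝓡 n) (𝓡 n) (fun x : Q => g • x) q v) = metric.inner q u v
  /-- The potential energy. -/
  potential : Q → ℝ
  potential_smooth : ContMDiff (𝓡 n) 𝓘(ℝ, ℝ) ∞ potential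
  potential_invariant : ∀ (g : G) (q : Q), potential (g • q) = potential q
  /-- The constraint distribution. -/
  D : (q : Q) → Submodule ℝ (TangentSpace (𝓡 n) q)
  /-- `D` is a smooth vector subbundle of rank `r`: it has smooth local frames. -/
  D_frame : ∀ q₀ : Q, ∃ O : Set Q, IsOpen O ∧ q₀ ∈ O ∧ ∃ e : Fin r → VField (𝓡 n) Q,
    (∀ i, ContMDiffOn (𝓡 n) (𝓡 n).tangent ∞
      (fun q => (⟨q, e i q⟩ : TangentBundle (𝓡 n) Q)) O) ∧
    ∀ q ∈ O, LinearIndependent ℝ (fun i => e i q) ∧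
      Submodule.span ℝ (Set.range fun i => e i q) = D q
  /-- `D` is `G`-invariant. -/
  D_invariant : ∀ (g : G) (q : Q),
    (D q).map (mfderiv (𝓡 n) (𝓡 n) (fun x : Q => g • x) q).toLinearMap = D (g • q)
  /-- `T_q Q = D_q ⊕ 𝔤 · q`, where `𝔤 · q`, the tangent space to the orbit, is the range of the
  derivative of `g ↦ g • q` at `1` (it is stated at `1 • q`, which is `q`). -/
  splitting : ∀ q : Q, IsCompl (D ((1 : G) • q))
    (mfderiv (𝓡 m) (𝓡 n) (fun g : G => g • q) 1).range

namespace ChaplyginSystem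

variable {n r m : ℕ} {Q S G : Type*}
    [TopologicalSpace Q] [ChartedSpace (EuclideanSpace ℝ (Fin n)) Q] [IsManifold (𝓡 n) ∞ Q]
    [TopologicalSpace S] [ChartedSpace (EuclideanSpace ℝ (Fin r)) S] [IsManifold (𝓡 r) ∞ S]
    [TopologicalSpace G] [ChartedSpace (EuclideanSpace ℝ (Fin m)) G] [Group G]
    [LieGroup (𝓡 m) ∞ G] [MulAction G Q]

variable (sys : ChaplyginSystem n r m Q S G)

/-- The derivative `T_q π`. -/
def dproj (q : Q) : TangentSpace (𝓡 n) q →L[ℝ] TangentSpace (𝓡 r) (sys.proj q) :=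
  mfderiv (𝓡 n) (𝓡 r) sys.proj q

theorem finrank_D (q : Q) : Module.finrank ℝ (sys.D q) = r := by
  obtain ⟨O, -, hq, e, -, he⟩ := sys.D_frame q
  obtain ⟨hli, hsp⟩ := he q hq
  rw [← hsp, finrank_span_eq_card hli, Fintype.card_fin]

theorem range_orbit_le_ker (q : Q) :
    (mfderiv (𝓡 m) (𝓡 n) (fun g : G => g • q) 1).range ≤ (sys.dproj ((1 : G) • q)).ker := by
  rintro _ ⟨ξ, rfl⟩
  have hs := sys.smooth_smul
  have h1 : MDifferentiableAt (𝓡 m) (𝓡 n) (fun g : G => g • q) 1 := by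
    have : ContMDiff (𝓡 m) (𝓡 n) ∞ (fun g : G => g • q) :=
      hs.contMDiff_smul.comp (contMDiff_id.prodMk contMDiff_const)
    exact this.mdifferentiable (by simp) 1
  have h2 : MDifferentiableAt (𝓡 n) (𝓡 r) sys.proj ((1 : G) • q) :=
    sys.proj_smooth.mdifferentiable (by simp) _
  have h3 := mfderiv_comp (1 : G) h2 h1
  have h4 : sys.proj ∘ (fun g : G => g • q) = fun _ => sys.proj q := by
    funext g
    exact ((sys.proj_fibre q (g • q)).2 ⟨g, rfl⟩).symm
  rw [h4, mfderiv_const] at h3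
  exact (DFunLike.congr_fun h3 ξ).symm

theorem dproj_bijective (q : Q) :
    Function.Bijective ((sys.dproj q).toLinearMap.domRestrict (sys.D q)) := by
  have hsurj : Function.Surjective ((sys.dproj q).toLinearMap.domRestrict (sys.D q)) := by
    obtain ⟨q, rfl⟩ : ∃ q', (1 : G) • q' = q := ⟨q, one_smul G q⟩
    intro w
    obtain ⟨v, hv⟩ := sys.proj_submersion _ w
    obtain ⟨a, ha, b, hb, hab⟩ : ∃ a ∈ sys.D ((1 : G) • q),
        ∃ b ∈ (mfderiv (𝓡 m) (𝓡 n) (fun g : G => g • q) 1).range, a + b = v := by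
      rw [← Submodule.mem_sup, (sys.splitting q).sup_eq_top]
      trivial
    refine ⟨⟨a, ha⟩, ?_⟩
    have hb' : sys.dproj ((1 : G) • q) b = 0 := sys.range_orbit_le_ker q hb
    have : sys.dproj ((1 : G) • q) (a + b) = w := by rw [hab]; exact hv
    rw [map_add, hb', add_zero] at this
    exact this
  refine ⟨(LinearMap.injective_iff_surjective_of_finrank_eq_finrank ?_).2 hsurj, hsurj⟩
  rw [sys.finrank_D]
  exact (finrank_euclideanSpace_fin (𝕜 := ℝ) (n := r)).symm

/-- `T_q π` restricts to an isomorphism `D_q ≃ T_{π(q)} S`. -/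
def dprojEquiv (q : Q) : sys.D q ≃ₗ[ℝ] TangentSpace (𝓡 r) (sys.proj q) :=
  LinearEquiv.ofBijective _ (sys.dproj_bijective q)

/-- The horizontal lift `hor_q : T_{π(q)} S → D_q ⊆ T_q Q`. -/
def hor (q : Q) : TangentSpace (𝓡 r) (sys.proj q) →L[ℝ] TangentSpace (𝓡 n) q :=
  ((sys.D q).subtype ∘ₗ (sys.dprojEquiv q).symm.toLinearMap).toContinuousLinearMap

/-- The horizontal lift of a vector field on `S`. -/
def horLift (Y : VField (𝓡 r) S) : VField (𝓡 n) Q := fun q => sys.hor q (Y (sys.proj q))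

/-- The orthogonal complement `D_q^⊥` with respect to the kinetic energy metric. -/
def orthD (q : Q) : Submodule ℝ (TangentSpace (𝓡 n) q) where
  carrier := {v | ∀ u ∈ sys.D q, sys.metric.inner q v u = 0}
  add_mem' := by
    intro v w hv hw u hu
    simp [hv u hu, hw u hu]
  zero_mem' := by
    intro u hu
    simp
  smul_mem' := by
    intro c v hv u hu
    simp [hv u hu]

theorem isCompl_orthD (q : Q) : IsCompl (sys.D q) (sys.orthD q) := by
  have hdisj : Disjoint (sys.D q) (sys.orthD q) := by
    rw [Submodule.disjoint_def]
    intro x hx hx'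
    by_contra h0
    exact (sys.metric.pos q x h0).ne' (hx' x hx)
  refine ⟨hdisj, codisjoint_iff.2 ?_⟩
  let B : TangentSpace (𝓡 n) q →ₗ[ℝ] Module.Dual ℝ (sys.D q) :=
    { toFun := fun v => (sys.metric.inner q v).toLinearMap.domRestrict (sys.D q)
      map_add' := fun v w => by ext u; simp
      map_smul' := fun c v => by ext u; simp }
  have hker : LinearMap.ker B = sys.orthD q := by
    ext v
    constructor
    · intro hv u hu
      exact DFunLike.congr_fun (LinearMap.mem_ker.1 hv) ⟨u, hu⟩
    · intro hv
      refine LinearMap.mem_ker.2 (LinearMap.ext fun u => hv u.1 u.2)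
  refine Submodule.eq_top_of_finrank_eq (le_antisymm (Submodule.finrank_le _) ?_)
  have h1 := Submodule.finrank_sup_add_finrank_inf_eq (sys.D q) (sys.orthD q)
  rw [hdisj.eq_bot, finrank_bot, add_zero] at h1
  have h2 := LinearMap.finrank_range_add_finrank_ker B
  have h3 := Submodule.finrank_le (LinearMap.range B)
  rw [Subspace.dual_finrank_eq] at h3
  rw [hker] at h2
  omega

/-- The orthogonal projector `𝒫 : T_q Q → D_q`, viewed as an endomorphism of `T_q Q`. -/
def projD (q : Q) : TangentSpace (𝓡 n) q →L[ℝ] TangentSpace (𝓡 n) q :=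
  (Submodule.projection (sys.D q) (sys.orthD q) (sys.isCompl_orthD q)).toContinuousLinearMap

/-- The gyroscopic tensor: `𝒯(Y, Z)(π(q)) = T_q π (𝒫 [hor Y, hor Z](q)) - [Y, Z](π(q))`. -/
def gyro (Y Z : VField (𝓡 r) S) (q : Q) : TangentSpace (𝓡 r) (sys.proj q) :=
  sys.dproj q (sys.projD q (VectorField.mlieBracket (𝓡 n) (sys.horLift Y) (sys.horLift Z) q))
    - VectorField.mlieBracket (𝓡 r) Y Z (sys.proj q)

/-- The system is `φ`-simple: `φ` is smooth and `𝒯(Y, Z) = Z[φ] Y - Y[φ] Z` for all vector fields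
`Y, Z` on `S`. -/
def IsPhiSimple (φ : S → ℝ) : Prop :=
  ContMDiff (𝓡 r) 𝓘(ℝ, ℝ) ∞ φ ∧
    ∀ Y Z : VField (𝓡 r) S, IsSmoothVField Y → IsSmoothVField Z → ∀ q : Q,
      sys.gyro Y Z q =
        (mvfderiv (𝓡 r) φ (sys.proj q) (Z (sys.proj q))) • Y (sys.proj q)
          - (mvfderiv (𝓡 r) φ (sys.proj q) (Y (sys.proj q))) • Z (sys.proj q)

/-! #### Reduced dynamics -/

theorem flat_injective (q : Q) : Function.Injective (sys.metric.inner q) := by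
  rw [injective_iff_map_eq_zero]
  intro v hv
  by_contra h0
  have := sys.metric.pos q v h0
  rw [hv] at this
  exact lt_irrefl _ this

/-- The isomorphism `♭ : T_q Q ≃ T_q^* Q` induced by the kinetic energy metric. -/
def flat (q : Q) : TangentSpace (𝓡 n) q ≃ₗ[ℝ] (TangentSpace (𝓡 n) q →L[ℝ] ℝ) :=
  LinearMap.linearEquivOfInjective (sys.metric.inner q).toLinearMap (sys.flat_injective q)
    (finrank_continuousDual _)

/-- The Hamiltonian `h(β) = ½ ‖β‖² + U(q)` on `T*Q`, with `‖β‖² = β(β♯)`. -/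
def hamiltonian (β : CotangentBundle (𝓡 n) Q) : ℝ :=
  (1 / 2 : ℝ) * β.2 ((sys.flat β.proj).symm β.2) + sys.potential β.proj

/-- The projection `T*Q → D* ↪ T*Q`, `β ↦ β ∘ 𝒫` (restriction `i_D^*` to `D` followed by `𝒫^*`). Its
image is the copy of the momentum phase space `D*` inside `T*Q`. -/
def constrain (β : CotangentBundle (𝓡 n) Q) : CotangentBundle (𝓡 n) Q :=
  ⟨β.proj, β.2.comp (sys.projD β.proj)⟩

/-- The map `T*Q → T*S`, `β ↦ β ∘ hor_q`: restriction `i_D^* : T*Q → D*`, followed by the quotient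
map `D* → D* / G` and the identification of `D* / G` with `T*S`. -/
def reduce (β : CotangentBundle (𝓡 n) Q) : CotangentBundle (𝓡 r) S :=
  ⟨sys.proj β.proj, β.2.comp (sys.hor β.proj)⟩

/-- The reduced Hamiltonian: the function `H` on `T*S` induced by the constrained Hamiltonian,
i.e. `H (reduce β) = h (constrain β)`. -/
def reducedHamiltonian : CotangentBundle (𝓡 r) S → ℝ :=
  Function.extend sys.reduce (fun β => sys.hamiltonian (sys.constrain β)) 0

/-- `X` on `T*S` is the reduction of the nonholonomic dynamics. The nonholonomic vector field is
`X_nh[ψ] = {ψ ∘ i_D^*, h_c ∘ i_D^*}_{T*Q} ∘ 𝒫^*`, with `h_c = h ∘ 𝒫^*`. Hence, at a point `β` of the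
copy of `D*` in `T*Q`, the reduced vector field is the image under `T reduce` of the value at `β`
of the Hamiltonian vector field `W` on `T*Q` of the function `h ∘ constrain`. -/
def IsReducedField (X : VField (cotangentModel (𝓡 r)) (CotangentBundle (𝓡 r) S)) : Prop :=
  ∀ β : CotangentBundle (𝓡 n) Q, sys.constrain β = β →
    ∃ W : TangentSpace (cotangentModel (𝓡 n)) β,
      (∀ V, canonicalForm (𝓡 n) Q β ![W, V] =
        mvfderiv (cotangentModel (𝓡 n)) (fun γ => sys.hamiltonian (sys.constrain γ)) β V) ∧
      X (sys.reduce β) =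
        mfderiv (cotangentModel (𝓡 n)) (cotangentModel (𝓡 r)) sys.reduce β W

/-- The vector field on `T*S` describing the reduced dynamics. -/
def reducedField : VField (cotangentModel (𝓡 r)) (CotangentBundle (𝓡 r) S) :=
  Classical.epsilon sys.IsReducedField

/-- The reduced dynamics preserves the volume form `exp(σ) ν` on `T*S`. -/
def PreservesMeasure (σ : CotangentBundle (𝓡 r) S → ℝ) : Prop :=
  ∀ α v, lieD sys.reducedField (fun γ => Real.exp (σ γ) • liouvilleVolume (𝓡 r) S r γ) α v = 0

/-- The reduced dynamics preserves a smooth volume form `exp(σ) ν` on `T*S`. -/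
def HasInvariantMeasure : Prop :=
  ∃ σ : CotangentBundle (𝓡 r) S → ℝ,
    ContMDiff (cotangentModel (𝓡 r)) 𝓘(ℝ, ℝ) ∞ σ ∧ sys.PreservesMeasure σ

/-- The system is Hamiltonisable with the time reparametrisation `dt = g(s) dτ`: `g` is smooth and
positive, and `g X` is the Hamiltonian vector field of the reduced Hamiltonian with respect to some
symplectic form on `T*S`, where `X` is the reduced vector field. -/
def IsHamiltonisableWith (g : S → ℝ) : Prop :=
  ContMDiff (𝓡 r) 𝓘(ℝ, ℝ) ∞ g ∧ (∀ s, 0 < g s) ∧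
    ∃ Ω : DiffForm (cotangentModel (𝓡 r)) (CotangentBundle (𝓡 r) S) 2, IsSymplecticForm Ω ∧
      ∀ α V, Ω α ![g α.proj • sys.reducedField α, V] =
        mvfderiv (cotangentModel (𝓡 r)) sys.reducedHamiltonian α V

/-- The system obtained by adding the `G`-invariant potential `W`. -/
def addPotential (W : Q → ℝ) (hW : ContMDiff (𝓡 n) 𝓘(ℝ, ℝ) ∞ W)
    (hinv : ∀ (g : G) (q : Q), W (g • q) = W q) : ChaplyginSystem n r m Q S G :=
  { sys with
    potential := fun q => sys.potential q + W q
    potential_smooth := sys.potential_smooth.add hW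
    potential_invariant := fun g q => by rw [sys.potential_invariant, hinv] }

end ChaplyginSystem

end Chaplygin

end

/-! In a chart of S, with cometric K(y), the reduced Hamiltonian is H = ½ p(K p) + U, and the
reduced field X is Hamiltonian up to a gyroscopic force: y' = K p, p' = -∂H/∂y - p(T(·, K p)), where
T is the gyroscopic tensor (`chartD_modelD_reduce`, `fieldC_reducedField`). Indeed the Hamiltonian
vector at a constrained covector lies over a horizontal vector, and pushing it forward to T*S leaves
a bracket of horizontal lifts as the only extra term; a constrained momentum vanishes on the
orthogonal complement of D, so this bracket may be projected to D.

The Liouville volume ν is constant in cotangent charts, so the Lie derivative of exp(σ) ν is exp(σ)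
(X[σ] + div X) ν. The Hamiltonian part has no divergence, and div X = -θ(K p) with θ(v) = tr T(·, v)
(`trace_fderiv_modelField`). Invariance thus means X[σ] = θ(K p). If σ comes from S, this says dσ =
θ. If U = 0, then X vanishes on the zero section, and differentiating the identity in p there gives
dφ = θ for the restriction φ of σ to the zero section
(`PreservesMeasure.isPhiSimple_of_potential_eq_zero`). For r = 2 a skew T is recovered from its
trace, T(u, v) = θ(v) u - θ(u) v (`skew_eq_of_two`), so dφ = θ is the same as φ-simplicity. This
gives (i), and reduces (ii) to the Hamiltonisation of φ-simple systems.

For a φ-simple system of any dimension, -d(e^φ λ) = e^φ (Ω_can - dφ ∧ λ) is symplectic, and the term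
dφ ∧ λ cancels the gyroscopic force exactly (`IsPhiSimple.isHamiltonisableWith`). The potential does
not enter φ-simplicity, whence persistence.

Two devices run through the proof. Tangent spaces are retyped as the model space, so that vectors
over different points can be compared. Objects on S are evaluated at points of Q, shown to be
G-invariant, and made functions on a chart of S by smooth local sections of π. -/

noncomputable section

namespace Chaplygin

set_option linter.unusedSectionVars false
set_option maxSynthPendingDepth 3

/-! ### Derivatives of preferred charts, read as endomorphisms of the model space. -/

section Charts

variable {E : Type*} [NormedAddCommGroup E] [NormedSpace ℝ E] {H : Type*} [TopologicalSpace H]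
  (I : ModelWithCorners ℝ E H) {M : Type*} [TopologicalSpace M] [ChartedSpace H M]

/-- The derivative at `x` of the preferred chart at `x₀`, as an endomorphism of the model space. -/
def chartD (x₀ x : M) : E →L[ℝ] E := mfderiv I 𝓘(ℝ, E) (extChartAt I x₀) x

/-- The derivative at `y` of the inverse of the preferred chart at `x₀`, as an endomorphism of the
model space. -/
def chartDsymm (x₀ : M) (y : E) : E →L[ℝ] E :=
  mfderivWithin 𝓘(ℝ, E) I (extChartAt I x₀).symm (Set.range I) y

/-- The derivative of a map between manifolds, as a map between the model spaces. -/
def modelD {E' : Type*} [NormedAddCommGroup E'] [NormedSpace ℝ E'] {H' : Type*}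
    [TopologicalSpace H'] (J : ModelWithCorners ℝ E' H') {N : Type*} [TopologicalSpace N]
    [ChartedSpace H' N] (f : M → N) (x : M) : E →L[ℝ] E' := mfderiv I J f x

/-- The differential of a vector-valued function, as a map between the model spaces. -/
def modelVD {E' : Type*} [NormedAddCommGroup E'] [NormedSpace ℝ E'] (f : M → E') (x : M) :
    E →L[ℝ] E' := mvfderiv I f x

/-- The value of a form at a point, as an alternating map on the model space. -/
def formAt {k : ℕ} (η : DiffForm I M k) (x : M) : E [⋀^Fin k]→L[ℝ] ℝ := η x

variable {I} [IsManifold I 1 M]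

/-- The tangent space at a point is identified with the model space by the preferred chart at that
very point, so formulas read at the centre of a chart carry no Jacobian. -/
theorem chartD_self (x : M) : chartD I x x = ContinuousLinearMap.id ℝ E :=
  mfderiv_extChartAt_self

theorem chartDsymm_self (x : M) : chartDsymm I x (extChartAt I x x) = ContinuousLinearMap.id ℝ E :=
  mfderivWithin_range_extChartAt_symm

theorem chartD_comp_chartDsymm {x₀ : M} {y : E} (hy : y ∈ (extChartAt I x₀).target) :
    (chartD I x₀ ((extChartAt I x₀).symm y)).comp (chartDsymm I x₀ y) =
      ContinuousLinearMap.id ℝ E :=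
  mfderiv_extChartAt_comp_mfderivWithin_extChartAt_symm hy

theorem chartDsymm_comp_chartD {x₀ : M} {y : E} (hy : y ∈ (extChartAt I x₀).target) :
    (chartDsymm I x₀ y).comp (chartD I x₀ ((extChartAt I x₀).symm y)) =
      ContinuousLinearMap.id ℝ E :=
  mfderivWithin_extChartAt_symm_comp_mfderiv_extChartAt hy

theorem chartD_chartDsymm {x₀ : M} {y : E} (hy : y ∈ (extChartAt I x₀).target) (v : E) :
    chartD I x₀ ((extChartAt I x₀).symm y) (chartDsymm I x₀ y v) = v :=
  DFunLike.congr_fun (chartD_comp_chartDsymm hy) v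

theorem chartDsymm_chartD {x₀ : M} {y : E} (hy : y ∈ (extChartAt I x₀).target) (v : E) :
    chartDsymm I x₀ y (chartD I x₀ ((extChartAt I x₀).symm y) v) = v :=
  DFunLike.congr_fun (chartDsymm_comp_chartD hy) v

theorem inverse_chartDsymm {x₀ : M} {y : E} (hy : y ∈ (extChartAt I x₀).target) :
    (chartDsymm I x₀ y).inverse = chartD I x₀ ((extChartAt I x₀).symm y) :=
  ContinuousLinearMap.inverse_eq (chartDsymm_comp_chartD hy) (chartD_comp_chartDsymm hy)

theorem symmL_eq_chartDsymm {x₀ x : M} (hx : x ∈ (chartAt H x₀).source) :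
    (trivializationAt E (TangentSpace I) x₀).symmL ℝ x = chartDsymm I x₀ (extChartAt I x₀ x) :=
  TangentBundle.symmL_trivializationAt hx

theorem continuousLinearMapAt_eq_chartD {x₀ x : M} (hx : x ∈ (chartAt H x₀).source) :
    (trivializationAt E (TangentSpace I) x₀).continuousLinearMapAt ℝ x = chartD I x₀ x :=
  TangentBundle.continuousLinearMapAt_trivializationAt hx

section Maps

variable [I.Boundaryless]
  {E' : Type*} [NormedAddCommGroup E'] [NormedSpace ℝ E'] {H' : Type*} [TopologicalSpace H']
  {J : ModelWithCorners ℝ E' H'} [J.Boundaryless]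
  {N : Type*} [TopologicalSpace N] [ChartedSpace H' N] [IsManifold J 1 N]

/-- The derivative of a map read in two charts. -/
theorem hasFDerivAt_inCharts {f : M → N} {x₀ : M} {z₀ : N} {y : E}
    (hy : y ∈ (extChartAt I x₀).target)
    (hf : MDifferentiableAt I J f ((extChartAt I x₀).symm y))
    (hz : f ((extChartAt I x₀).symm y) ∈ (chartAt H' z₀).source) :
    HasFDerivAt (fun y => extChartAt J z₀ (f ((extChartAt I x₀).symm y)))
      ((chartD J z₀ (f ((extChartAt I x₀).symm y))).comp
        (ContinuousLinearMap.comp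
          (modelD I J f ((extChartAt I x₀).symm y)) (chartDsymm I x₀ y))) y := by
  have h1 := (mdifferentiableWithinAt_extChartAt_symm hy).hasMFDerivWithinAt
  rw [I.range_eq_univ, hasMFDerivWithinAt_univ] at h1
  have hr : chartDsymm I x₀ y =
      mfderivWithin 𝓘(ℝ, E) I (extChartAt I x₀).symm Set.univ y := by
    rw [← I.range_eq_univ]; rfl
  rw [hr]
  have h2 := hf.hasMFDerivAt
  have h3 := (mdifferentiableAt_extChartAt (I := J) hz).hasMFDerivAt
  exact ((h3.comp _ h2).comp y h1).hasFDerivAt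

/-- The derivative of a map into a vector space read in a chart. -/
theorem hasFDerivAt_inChart {f : M → E'} {x₀ : M} {y : E}
    (hy : y ∈ (extChartAt I x₀).target)
    (hf : MDifferentiableAt I 𝓘(ℝ, E') f ((extChartAt I x₀).symm y)) :
    HasFDerivAt (fun y => f ((extChartAt I x₀).symm y))
      ((modelVD I f ((extChartAt I x₀).symm y)).comp (chartDsymm I x₀ y))
      y := by
  have h1 := (mdifferentiableWithinAt_extChartAt_symm hy).hasMFDerivWithinAt
  rw [I.range_eq_univ, hasMFDerivWithinAt_univ] at h1
  have hr : chartDsymm I x₀ y =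
      mfderivWithin 𝓘(ℝ, E) I (extChartAt I x₀).symm Set.univ y := by
    rw [← I.range_eq_univ]; rfl
  rw [hr]
  exact (hf.hasMFDerivAt.comp y h1).hasFDerivAt

theorem hasFDerivAt_transition {x₀ x₁ : M} {y : E} (hy : y ∈ (extChartAt I x₀).target)
    (hz : (extChartAt I x₀).symm y ∈ (chartAt H x₁).source) :
    HasFDerivAt (fun y => extChartAt I x₁ ((extChartAt I x₀).symm y))
      ((chartD I x₁ ((extChartAt I x₀).symm y)).comp (chartDsymm I x₀ y)) y := by
  have h1 := (mdifferentiableWithinAt_extChartAt_symm hy).hasMFDerivWithinAt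
  rw [I.range_eq_univ, hasMFDerivWithinAt_univ] at h1
  have hr : chartDsymm I x₀ y =
      mfderivWithin 𝓘(ℝ, E) I (extChartAt I x₀).symm Set.univ y := by
    rw [← I.range_eq_univ]; rfl
  rw [hr]
  have h3 := (mdifferentiableAt_extChartAt (I := I) hz).hasMFDerivAt
  exact (h3.comp y h1).hasFDerivAt

theorem eventually_mem_target {x₀ : M} {y : E} (hy : y ∈ (extChartAt I x₀).target) :
    ∀ᶠ z in 𝓝 y, z ∈ (extChartAt I x₀).target :=
  (isOpen_extChartAt_target x₀).mem_nhds hy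

theorem eventually_symm_mem {x₀ : M} {y : E} (hy : y ∈ (extChartAt I x₀).target) {O : Set M}
    (hO : IsOpen O) (hyO : (extChartAt I x₀).symm y ∈ O) :
    ∀ᶠ z in 𝓝 y, (extChartAt I x₀).symm z ∈ O :=
  (continuousAt_extChartAt_symm'' hy).preimage_mem_nhds (hO.mem_nhds hyO)

end Maps

end Charts

/-! ### Smoothness in charts, and the exterior derivative under change of chart. -/

section SmoothCharts

variable {E : Type*} [NormedAddCommGroup E] [NormedSpace ℝ E] {H : Type*} [TopologicalSpace H]
  {I : ModelWithCorners ℝ E H} {M : Type*} [TopologicalSpace M] [ChartedSpace H M]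
  [IsManifold I ∞ M] [I.Boundaryless]
  {E' : Type*} [NormedAddCommGroup E'] [NormedSpace ℝ E'] {H' : Type*} [TopologicalSpace H']
  {J : ModelWithCorners ℝ E' H'} [J.Boundaryless]
  {N : Type*} [TopologicalSpace N] [ChartedSpace H' N] [IsManifold J ∞ N]

theorem contMDiffAt_extChartAt_symm {x₀ : M} {y : E} (hy : y ∈ (extChartAt I x₀).target) :
    ContMDiffAt 𝓘(ℝ, E) I ∞ (extChartAt I x₀).symm y :=
  (contMDiffOn_extChartAt_symm x₀).contMDiffAt (eventually_mem_target hy)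

theorem contDiffAt_inCharts {f : M → N} {x₀ : M} {z₀ : N} {y : E}
    (hy : y ∈ (extChartAt I x₀).target)
    (hf : ContMDiffAt I J ∞ f ((extChartAt I x₀).symm y))
    (hz : f ((extChartAt I x₀).symm y) ∈ (chartAt H' z₀).source) :
    ContDiffAt ℝ ∞ (fun y => extChartAt J z₀ (f ((extChartAt I x₀).symm y))) y := by
  have h3 : ContMDiffAt J 𝓘(ℝ, E') ∞ (extChartAt J z₀) (f ((extChartAt I x₀).symm y)) :=
    contMDiffAt_extChartAt' hz
  exact ((h3.comp _ hf).comp y (contMDiffAt_extChartAt_symm hy)).contDiffAt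

theorem contDiffAt_inChart {f : M → E'} {x₀ : M} {y : E}
    (hy : y ∈ (extChartAt I x₀).target)
    (hf : ContMDiffAt I 𝓘(ℝ, E') ∞ f ((extChartAt I x₀).symm y)) :
    ContDiffAt ℝ ∞ (fun y => f ((extChartAt I x₀).symm y)) y :=
  (hf.comp y (contMDiffAt_extChartAt_symm hy)).contDiffAt

theorem contDiffAt_transition {x₀ x₁ : M} {y : E} (hy : y ∈ (extChartAt I x₀).target)
    (hz : (extChartAt I x₀).symm y ∈ (chartAt H x₁).source) :
    ContDiffAt ℝ ∞ (fun y => extChartAt I x₁ ((extChartAt I x₀).symm y)) y :=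
  contDiffAt_inCharts (f := id) hy contMDiffAt_id hz

theorem two_le_infty : (2 : WithTop ℕ∞) ≤ ∞ := ENat.LEInfty.out

/-! ### Forms in charts -/

variable {k : ℕ}

theorem inChart_eq (η : DiffForm I M k) (x₀ : M) (y : E) :
    inChart η x₀ y = ContinuousAlternatingMap.compContinuousLinearMap
      (formAt I η ((extChartAt I x₀).symm y)) (chartDsymm I x₀ y) := rfl

theorem inChart_transition (η : DiffForm I M k) {x₀ x₁ : M} {y : E}
    (hy : y ∈ (extChartAt I x₀).target) (hz : (extChartAt I x₀).symm y ∈ (chartAt H x₁).source) :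
    inChart η x₀ y =
      (inChart η x₁ (extChartAt I x₁ ((extChartAt I x₀).symm y))).compContinuousLinearMap
        (fderiv ℝ (fun y => extChartAt I x₁ ((extChartAt I x₀).symm y)) y) := by
  rw [(hasFDerivAt_transition hy hz).fderiv, inChart_eq, inChart_eq]
  set x := (extChartAt I x₀).symm y with hx
  have hxs : x ∈ (extChartAt I x₁).source := by rwa [extChartAt_source]
  have hl : (extChartAt I x₁).symm (extChartAt I x₁ x) = x := (extChartAt I x₁).left_inv hxs
  have h2 := chartDsymm_chartD ((extChartAt I x₁).map_source hxs)
  rw [hl] at h2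
  rw [hl]
  ext v
  simp only [ContinuousAlternatingMap.compContinuousLinearMap_apply]
  congr 1
  funext i
  exact (h2 (chartDsymm I x₀ y (v i))).symm

theorem extD_eq (η : DiffForm I M k) (x : M) :
    formAt I (extD η) x =
      extDeriv (inChart η x) (extChartAt I x x) := by
  rw [← extDerivWithin_univ, ← I.range_eq_univ]
  ext v
  change extDerivWithin (inChart η x) (Set.range I) (extChartAt I x x)
    (fun i => chartD I x x (v i)) = _
  rw [chartD_self]
  rfl

/-- `extD` uses a different chart at each point. Naturality of the exterior derivative under
transition maps shows that one chart computes it on its whole domain; smoothness of `extD η` and d²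
= 0 rest on this. -/
theorem inChart_extD {η : DiffForm I M k} (hη : IsSmoothForm η) {x₀ : M} {y : E}
    (hy : y ∈ (extChartAt I x₀).target) :
    inChart (extD η) x₀ y = extDeriv (inChart η x₀) y := by
  rw [inChart_eq, extD_eq]
  set x := (extChartAt I x₀).symm y with hx
  have h0 : x ∈ (chartAt H x).source := mem_chart_source H x
  have h1 : inChart η x₀ =ᶠ[𝓝 y] fun z =>
      (inChart η x (extChartAt I x ((extChartAt I x₀).symm z))).compContinuousLinearMap
        (fderiv ℝ (fun y => extChartAt I x ((extChartAt I x₀).symm y)) z) := by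
    filter_upwards [eventually_mem_target hy,
      eventually_symm_mem hy (chartAt H x).open_source h0] with z hz hz'
    exact inChart_transition η hz hz'
  rw [h1.extDeriv_eq, extDeriv_pullback (r := ∞) _ (contDiffAt_transition hy h0)
      (by simpa using two_le_infty),
    (hasFDerivAt_transition hy h0).fderiv]
  · rw [← hx, chartD_self, ContinuousLinearMap.id_comp]
  · exact ((hη x).contDiffAt ((isOpen_extChartAt_target x).mem_nhds (mem_extChartAt_target x))
      ).differentiableAt (by simp)

theorem contDiffOn_extDeriv {η : E → E [⋀^Fin k]→L[ℝ] ℝ} {s : Set E} (hs : IsOpen s)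
    (hη : ContDiffOn ℝ ∞ η s) : ContDiffOn ℝ ∞ (extDeriv η) s := by
  intro y hy
  have h1 : ContDiffAt ℝ ∞ (fderiv ℝ η) y :=
    (hη.contDiffAt (hs.mem_nhds hy)).fderiv_right (by simp)
  exact ((ContinuousAlternatingMap.alternatizeUncurryFinCLM ℝ E ℝ).contDiff.contDiffAt.comp y
    h1).contDiffWithinAt

theorem IsSmoothForm.extD {η : DiffForm I M k} (hη : IsSmoothForm η) :
    IsSmoothForm (extD η) := fun x₀ =>
  (contDiffOn_extDeriv (isOpen_extChartAt_target x₀) (hη x₀)).congr fun _ hy => inChart_extD hη hy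

theorem extD_extD {η : DiffForm I M k} (hη : IsSmoothForm η) (x : M) :
    Chaplygin.extD (Chaplygin.extD η) x = 0 := by
  have h1 := extD_eq (Chaplygin.extD η) x
  have h2 : inChart (Chaplygin.extD η) x =ᶠ[𝓝 (extChartAt I x x)] extDeriv (inChart η x) := by
    filter_upwards [eventually_mem_target (mem_extChartAt_target x)] with z hz
    exact inChart_extD hη hz
  rw [h2.extDeriv_eq, extDeriv_extDeriv_apply (r := ∞) _ (by simpa using two_le_infty)] at h1
  · exact h1
  · exact (hη x).contDiffAt ((isOpen_extChartAt_target x).mem_nhds (mem_extChartAt_target x))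

end SmoothCharts

/-! ### Charts of T*M, the Liouville form, and the symplectic form -d(f λ). -/

section CotangentCharts

variable {E : Type*} [NormedAddCommGroup E] [NormedSpace ℝ E] {H : Type*} [TopologicalSpace H]
  {I : ModelWithCorners ℝ E H} {M : Type*} [TopologicalSpace M] [ChartedSpace H M]
  [IsManifold I ∞ M] [I.Boundaryless]

/-- The point of `T*M` over `x` with momentum `p`, a functional on the model space. -/
def covector (I : ModelWithCorners ℝ E H) [IsManifold I ∞ M] (x : M) (p : E →L[ℝ] ℝ) :
    CotangentBundle I M := ⟨x, p⟩

/-- The momentum of a point of `T*M`, as a functional on the model space. -/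
def momentum (α : CotangentBundle I M) : E →L[ℝ] ℝ := α.2

theorem extChartAt_cotangent_target (α : CotangentBundle I M) :
    (extChartAt (cotangentModel I) α).target = (extChartAt I α.proj).target ×ˢ Set.univ := by
  rw [FiberBundle.extChartAt_target]
  congr 1
  refine Set.inter_eq_left.2 fun y hy => ?_
  simp only [Set.mem_preimage, hom_trivializationAt_baseSet, Set.mem_inter_iff]
  refine ⟨?_, trivial⟩
  rw [TangentBundle.trivializationAt_baseSet, ← extChartAt_source I]
  exact (extChartAt I α.proj).map_target hy

theorem extChartAt_cotangent_apply (α β : CotangentBundle I M)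
    (hβ : β.proj ∈ (chartAt H α.proj).source) :
    extChartAt (cotangentModel I) α β = (extChartAt I α.proj β.proj,
      (momentum β).comp (chartDsymm I α.proj (extChartAt I α.proj β.proj))) := by
  rw [FiberBundle.extChartAt]
  refine Prod.ext rfl ?_
  rw [← symmL_eq_chartDsymm hβ]
  change ContinuousLinearMap.inCoordinates E (TangentSpace I) ℝ (Bundle.Trivial M ℝ) α.proj
    β.proj α.proj β.proj β.2 = _
  ext v
  simp [ContinuousLinearMap.inCoordinates]
  rfl

theorem mem_cotangent_source (α β : CotangentBundle I M) :
    β ∈ (extChartAt (cotangentModel I) α).source ↔ β.proj ∈ (chartAt H α.proj).source := by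
  rw [extChartAt_source, FiberBundle.chartedSpace_chartAt]
  simp
  exact fun h => h

theorem extChartAt_cotangent_symm (α : CotangentBundle I M) {y : E}
    (hy : y ∈ (extChartAt I α.proj).target) (p : E →L[ℝ] ℝ) :
    (extChartAt (cotangentModel I) α).symm (y, p) =
      covector I ((extChartAt I α.proj).symm y)
        (p.comp (chartD I α.proj ((extChartAt I α.proj).symm y))) := by
  set β := covector I ((extChartAt I α.proj).symm y)
        (p.comp (chartD I α.proj ((extChartAt I α.proj).symm y))) with hβ
  have h1 : β.proj ∈ (chartAt H α.proj).source := by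
    rw [← extChartAt_source I]; exact (extChartAt I α.proj).map_target hy
  have h2 : extChartAt (cotangentModel I) α β = (y, p) := by
    rw [extChartAt_cotangent_apply α β h1]
    have h3 : extChartAt I α.proj β.proj = y := (extChartAt I α.proj).right_inv hy
    rw [h3]
    refine Prod.ext rfl ?_
    change (p.comp (chartD I α.proj ((extChartAt I α.proj).symm y))).comp _ = p
    rw [ContinuousLinearMap.comp_assoc, chartD_comp_chartDsymm hy, ContinuousLinearMap.comp_id]
  rw [← h2]
  exact (extChartAt (cotangentModel I) α).left_inv ((mem_cotangent_source α β).2 h1)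

theorem mem_cotangent_target (α : CotangentBundle I M) {w : E × (E →L[ℝ] ℝ)}
    (hy : w.1 ∈ (extChartAt I α.proj).target) : w ∈ (extChartAt (cotangentModel I) α).target := by
  rw [extChartAt_cotangent_target]; exact ⟨hy, trivial⟩

theorem extChartAt_cotangent_self (α : CotangentBundle I M) :
    extChartAt (cotangentModel I) α α = (extChartAt I α.proj α.proj, momentum α) := by
  rw [extChartAt_cotangent_apply α α (mem_chart_source H _), chartDsymm_self,
    ContinuousLinearMap.comp_id]

/-! ### The Liouville form -/

/-- The form `f λ` on `T*M`, where `f` is a function on `M` and `λ` is the Liouville 1-form. -/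
def scaledLiouville (I : ModelWithCorners ℝ E H) [IsManifold I 1 M] (f : M → ℝ) :
    DiffForm (cotangentModel I) (CotangentBundle I M) 1 := fun α =>
  f α.proj • liouvilleForm I M α

/-- The 1-form `(y, p) ↦ (f(y) p) dy` on `E × E*`. -/
def modelLiouville (f : E → ℝ) (w : E × (E →L[ℝ] ℝ)) : (E × (E →L[ℝ] ℝ)) [⋀^Fin 1]→L[ℝ] ℝ :=
  ContinuousAlternatingMap.ofSubsingleton ℝ _ ℝ 0
    (f w.1 • w.2.comp (ContinuousLinearMap.fst ℝ E (E →L[ℝ] ℝ)))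

/-- The cotangent projection reads as `Prod.fst` in charts, and the Jacobian carried by the momentum
cancels against that of the base chart. So λ is p dy in every cotangent chart. -/
theorem inChart_scaledLiouville (f : M → ℝ) (α : CotangentBundle I M) {w : E × (E →L[ℝ] ℝ)}
    (hw : w.1 ∈ (extChartAt I α.proj).target) :
    inChart (scaledLiouville I f) α w =
      modelLiouville (fun y => f ((extChartAt I α.proj).symm y)) w := by
  have hw' := mem_cotangent_target α hw
  have hsymm := extChartAt_cotangent_symm α hw w.2
  have hproj : MDifferentiableAt (cotangentModel I) I (fun β : CotangentBundle I M => β.proj)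
      ((extChartAt (cotangentModel I) α).symm w) :=
    (Bundle.contMDiff_proj (n := 1) (IB := I) (F := E →L[ℝ] ℝ)
      (fun x : M => TangentSpace I x →L[ℝ] ℝ)).mdifferentiable (by simp) _
  have hmem : ((extChartAt (cotangentModel I) α).symm w).proj ∈ (chartAt H α.proj).source := by
    rw [← mem_cotangent_source]; exact (extChartAt (cotangentModel I) α).map_target hw'
  have h1 := hasFDerivAt_inCharts (z₀ := α.proj) hw' hproj hmem
  have h2 : (fun w : E × (E →L[ℝ] ℝ) => extChartAt I α.proj
      ((extChartAt (cotangentModel I) α).symm w).proj) =ᶠ[𝓝 w] Prod.fst := by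
    filter_upwards [eventually_mem_target hw'] with z hz
    rw [extChartAt_cotangent_target] at hz
    have := extChartAt_cotangent_symm α hz.1 z.2
    rw [Prod.mk.eta] at this
    rw [this]
    exact (extChartAt I α.proj).right_inv hz.1
  have h3 := (h1.congr_of_eventuallyEq h2.symm).unique
    (hasFDerivAt_fst (𝕜 := ℝ) (E := E) (F := E →L[ℝ] ℝ) (p := w))
  rw [Prod.mk.eta] at hsymm
  rw [hsymm] at h3
  rw [inChart_eq, hsymm]
  ext v
  change f _ * (w.2.comp (chartD I α.proj ((extChartAt I α.proj).symm w.1)))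
    (modelD (cotangentModel I) I (fun β : CotangentBundle I M => β.proj) _
      (chartDsymm (cotangentModel I) α w (v 0))) = f _ * w.2 (v 0).1
  congr 1
  exact congrArg w.2 (DFunLike.congr_fun h3 (v 0))

theorem contDiffOn_modelLiouville {f : E → ℝ} {s : Set E} (hf : ContDiffOn ℝ ∞ f s) :
    ContDiffOn ℝ ∞ (modelLiouville f) (s ×ˢ Set.univ) := by
  have h1 : ContDiffOn ℝ ∞ (fun w : E × (E →L[ℝ] ℝ) =>
      f w.1 • w.2.comp (ContinuousLinearMap.fst ℝ E (E →L[ℝ] ℝ))) (s ×ˢ Set.univ) := by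
    refine (hf.comp contDiff_fst.contDiffOn fun w hw => hw.1).smul ?_
    exact (contDiff_snd.clm_comp contDiff_const).contDiffOn
  exact (ContinuousAlternatingMap.ofSubsingletonLIE (𝕜 := ℝ) (E := E × (E →L[ℝ] ℝ)) (F := ℝ)
    (0 : Fin 1)).contDiff.comp_contDiffOn h1

theorem isSmoothForm_scaledLiouville {f : M → ℝ} (hf : ContMDiff I 𝓘(ℝ, ℝ) ∞ f) :
    IsSmoothForm (scaledLiouville I f) := by
  intro α
  rw [extChartAt_cotangent_target]
  refine (contDiffOn_modelLiouville (f := fun y => f ((extChartAt I α.proj).symm y))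
    fun y hy => ?_).congr fun w hw => inChart_scaledLiouville f α hw.1
  exact (contDiffAt_inChart hy (hf _)).contDiffWithinAt

theorem extDeriv_modelLiouville {f : E → ℝ} {f' : E →L[ℝ] ℝ} {w : E × (E →L[ℝ] ℝ)}
    (hf : HasFDerivAt f f' w.1) (a b : E × (E →L[ℝ] ℝ)) :
    extDeriv (modelLiouville f) w ![a, b] =
      f' a.1 * w.2 b.1 + f w.1 * a.2 b.1 - (f' b.1 * w.2 a.1 + f w.1 * b.2 a.1) := by
  have h1 : HasFDerivAt (fun w : E × (E →L[ℝ] ℝ) =>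
      f w.1 • w.2.comp (ContinuousLinearMap.fst ℝ E (E →L[ℝ] ℝ))) _ w :=
    (hf.comp w hasFDerivAt_fst).smul (hasFDerivAt_snd.clm_comp (hasFDerivAt_const _ _))
  have h2 : HasFDerivAt (modelLiouville f) _ w :=
    (ContinuousAlternatingMap.ofSubsingletonLIE (𝕜 := ℝ) (E := E × (E →L[ℝ] ℝ)) (F := ℝ)
      (0 : Fin 1)).toContinuousLinearEquiv.hasFDerivAt.comp w h1
  have h3 : ∀ v : Fin 1 → E × (E →L[ℝ] ℝ),
      HasFDerivAt (fun x : E × (E →L[ℝ] ℝ) => modelLiouville f x v) _ w := fun v =>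
    show HasFDerivAt (fun x : E × (E →L[ℝ] ℝ) => f x.1 * x.2 (v 0).1) _ w from
      (hf.comp w hasFDerivAt_fst).mul
      (hasFDerivAt_snd.clm_apply (hasFDerivAt_const (v 0).1 w))
  simp only [extDeriv_apply h2.differentiableAt, (h3 _).fderiv]
  simp [Fin.removeNth]
  ring

/-- The canonical symplectic form `((u, a), (v, b)) ↦ b(u) - a(v)` of `E × E*`. -/
def modelCanonical (E : Type*) [NormedAddCommGroup E] [NormedSpace ℝ E] :
    (E × (E →L[ℝ] ℝ)) [⋀^Fin 2]→L[ℝ] ℝ := -extDeriv (modelLiouville fun _ : E => (1 : ℝ)) 0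

theorem modelCanonical_apply (a b : E × (E →L[ℝ] ℝ)) :
    modelCanonical E ![a, b] = b.2 a.1 - a.2 b.1 := by
  rw [modelCanonical, ContinuousAlternatingMap.neg_apply,
    extDeriv_modelLiouville (hasFDerivAt_const (1 : ℝ) _)]
  simp

theorem scaledLiouville_one : scaledLiouville I (fun _ : M => (1 : ℝ)) = liouvilleForm I M := by
  funext α
  exact one_smul ℝ _

theorem vec_two {α : Type*} (v : Fin 2 → α) : v = ![v 0, v 1] := by
  ext i; fin_cases i <;> rfl

/-- Every cotangent chart is a Darboux chart with the same constant form. Hence the Liouville volume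
is constant in charts, and only a divergence survives in its Lie derivative. -/
theorem inChart_canonicalForm (α : CotangentBundle I M) {w : E × (E →L[ℝ] ℝ)}
    (hw : w.1 ∈ (extChartAt I α.proj).target) :
    inChart (canonicalForm I M) α w = modelCanonical E := by
  have hw' := mem_cotangent_target α hw
  have h0 : inChart (canonicalForm I M) α w = - inChart (extD (liouvilleForm I M)) α w := rfl
  have h1 : inChart (scaledLiouville I (fun _ : M => (1 : ℝ))) α =ᶠ[𝓝 w]
      modelLiouville fun _ : E => (1 : ℝ) := by
    filter_upwards [eventually_mem_target hw'] with z hz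
    rw [extChartAt_cotangent_target] at hz
    exact inChart_scaledLiouville _ α hz.1
  rw [h0, ← scaledLiouville_one, inChart_extD (isSmoothForm_scaledLiouville contMDiff_const) hw',
    h1.extDeriv_eq]
  ext v
  rw [vec_two v, modelCanonical_apply, ContinuousAlternatingMap.neg_apply,
    extDeriv_modelLiouville (hasFDerivAt_const (1 : ℝ) _)]
  simp

theorem canonicalForm_apply (α : CotangentBundle I M) (β : CotangentBundle I M)
    (hβ : β.proj ∈ (chartAt H α.proj).source) (a b : E × (E →L[ℝ] ℝ)) :
    formAt (cotangentModel I) (canonicalForm I M) β ![a, b] =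
      modelCanonical E ![chartD (cotangentModel I) α β a, chartD (cotangentModel I) α β b] := by
  have h1 := (mem_cotangent_source α β).2 hβ
  have h2 := (extChartAt (cotangentModel I) α).map_source h1
  have h4 := (extChartAt (cotangentModel I) α).left_inv h1
  rw [← inChart_canonicalForm α (w := extChartAt (cotangentModel I) α β), inChart_eq, h4,
    ContinuousAlternatingMap.compContinuousLinearMap_apply]
  · have h3 := chartDsymm_chartD h2
    rw [h4] at h3
    congr 1
    rw [vec_two (_ ∘ _)]
    exact congrArg₂ (fun c d => ![c, d]) (h3 a).symm (h3 b).symm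
  · rw [extChartAt_cotangent_target] at h2
    exact h2.1

theorem canonicalForm_apply_self (α : CotangentBundle I M) (a b : E × (E →L[ℝ] ℝ)) :
    formAt (cotangentModel I) (canonicalForm I M) α ![a, b] = b.2 a.1 - a.2 b.1 := by
  rw [canonicalForm_apply α α (mem_chart_source H _), chartD_self, modelCanonical_apply]
  rfl

/-! ### The symplectic form `-d(f λ)` -/

theorem extD_scaledLiouville_apply {f : M → ℝ} (hf : ContMDiff I 𝓘(ℝ, ℝ) ∞ f)
    (α : CotangentBundle I M) (a b : E × (E →L[ℝ] ℝ)) :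
    formAt (cotangentModel I) (extD (scaledLiouville I f)) α ![a, b] =
      modelVD I f α.proj a.1 * momentum α b.1 + f α.proj * a.2 b.1
        - (modelVD I f α.proj b.1 * momentum α a.1 + f α.proj * b.2 a.1) := by
  have hy : extChartAt I α.proj α.proj ∈ (extChartAt I α.proj).target := mem_extChartAt_target _
  have hl : (extChartAt I α.proj).symm (extChartAt I α.proj α.proj) = α.proj :=
    extChartAt_to_inv _
  have hd := hasFDerivAt_inChart (I := I) (f := f) hy (hf.mdifferentiable (by simp) _)
  rw [hl, chartDsymm_self, ContinuousLinearMap.comp_id] at hd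
  have h1 : inChart (scaledLiouville I f) α =ᶠ[𝓝 (extChartAt (cotangentModel I) α α)]
      modelLiouville fun y => f ((extChartAt I α.proj).symm y) := by
    filter_upwards [eventually_mem_target (mem_extChartAt_target α)] with z hz
    rw [extChartAt_cotangent_target] at hz
    exact inChart_scaledLiouville _ α hz.1
  rw [extD_eq, h1.extDeriv_eq, extChartAt_cotangent_self, extDeriv_modelLiouville hd]
  simp only [hl]

/-- Vertical test vectors see only `f` times the base component of `U`; once this is zero, test
vectors with zero fibre component see only `f` times the fibre component. The terms with df drop out
both times. -/
theorem eq_zero_of_extD_scaledLiouville {f : M → ℝ} (hf : ContMDiff I 𝓘(ℝ, ℝ) ∞ f)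
    (hpos : ∀ x, 0 < f x) (α : CotangentBundle I M) (U : E × (E →L[ℝ] ℝ))
    (hU : ∀ b : E × (E →L[ℝ] ℝ),
      formAt (cotangentModel I) (extD (scaledLiouville I f)) α ![U, b] = 0) : U = 0 := by
  have h2 : U.1 = 0 := by
    by_contra h0
    obtain ⟨g, hg⟩ := SeparatingDual.exists_ne_zero (R := ℝ) h0
    have := hU (0, g)
    rw [extD_scaledLiouville_apply hf] at this
    simp [(hpos _).ne'] at this
    exact hg this
  refine Prod.ext h2 ?_
  ext v
  have := hU (v, 0)
  rw [extD_scaledLiouville_apply hf, h2] at this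
  simpa [(hpos _).ne'] using this

theorem isSymplecticForm_neg_extD_scaledLiouville {f : M → ℝ} (hf : ContMDiff I 𝓘(ℝ, ℝ) ∞ f)
    (hpos : ∀ x, 0 < f x) :
    IsSymplecticForm (-extD (scaledLiouville I f)) where
  smooth := by
    intro α
    exact ((isSmoothForm_scaledLiouville hf).extD α).neg
  closed := by
    intro α
    have h1 := extD_extD (isSmoothForm_scaledLiouville hf) α
    have h2 := extD_eq (extD (scaledLiouville I f)) α
    have h3 := extD_eq (-extD (scaledLiouville I f)) α
    have h4 : inChart (-extD (scaledLiouville I f)) α =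
        (-1 : ℝ) • inChart (extD (scaledLiouville I f)) α := by
      funext w
      exact (neg_one_smul ℝ (inChart (extD (scaledLiouville I f)) α w)).symm
    rw [h4, extDeriv_smul, ← h2] at h3
    have h5 : formAt (cotangentModel I) (extD (extD (scaledLiouville I f))) α = 0 := h1
    rw [h5, smul_zero] at h3
    exact h3
  nondegenerate := by
    intro α U hU
    exact eq_zero_of_extD_scaledLiouville hf hpos α U fun b => neg_eq_zero.1 (hU b)

end CotangentCharts

/-! ### Forms of top degree, traces, and powers of the canonical form. -/

section VolumeForms

variable {V : Type*} [NormedAddCommGroup V] [NormedSpace ℝ V]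

/-- If `v` is independent it is a basis, and when `A (v i)` is expanded in it only the diagonal
coefficient survives alternation. If `v` is dependent, so is its image under id + tA for every t;
thus `η` vanishes along this line of tuples, and so does its derivative at t = 0, which is the left
side. -/
theorem sum_update_eq_trace_mul [FiniteDimensional ℝ V] {N : ℕ} (hN : Module.finrank ℝ V = N)
    (η : V [⋀^Fin N]→L[ℝ] ℝ) (A : V →ₗ[ℝ] V) (v : Fin N → V) :
    ∑ i, η (Function.update v i (A (v i))) = LinearMap.trace ℝ V A * η v := by
  by_cases hv : LinearIndependent ℝ v
  · let b := basisOfLinearIndependentOfCardEqFinrank' v hv (by simp [hN])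
    have hb : ∀ i, b i = v i := fun i => by simp [b]
    rw [LinearMap.trace_eq_matrix_trace ℝ b, Matrix.trace, Finset.sum_mul]
    refine Finset.sum_congr rfl fun i _ => ?_
    have h1 : A (v i) = ∑ j, b.repr (A (v i)) j • v j := by
      conv_lhs => rw [← b.sum_repr (A (v i))]
      simp [hb]
    rw [h1]
    change η.toAlternatingMap (Function.update v i _) = _
    rw [AlternatingMap.map_update_sum, Finset.sum_eq_single i]
    · rw [AlternatingMap.map_update_smul, Function.update_eq_self, Matrix.diag_apply,
        LinearMap.toMatrix_apply, hb]
      rfl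
    · intro j _ hj
      rw [AlternatingMap.map_update_smul, AlternatingMap.map_update_self _ _ hj.symm, smul_zero]
    · simp
  · have h0 : η v = 0 := η.toAlternatingMap.map_linearDependent v hv
    rw [h0, mul_zero]
    have h1 : ∀ t : ℝ, η (v + t • fun i => A (v i)) = 0 := by
      intro t
      refine η.toAlternatingMap.map_linearDependent _ fun h => hv ?_
      have : (v + t • fun i => A (v i)) = (LinearMap.id + t • A : V →ₗ[ℝ] V) ∘ v := by
        funext i; simp
      rw [this] at h
      exact LinearIndependent.of_comp (LinearMap.id + t • A) h
    have h2 : HasFDerivAt (fun x => η x) (η.toContinuousMultilinearMap.linearDeriv v)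
        (v + (0 : ℝ) • fun i => A (v i)) := by
      rw [zero_smul, add_zero]
      exact η.toContinuousMultilinearMap.hasFDerivAt v
    have h3 : HasDerivAt (fun t : ℝ => v + t • fun i => A (v i)) (fun i => A (v i)) 0 := by
      simpa using ((hasDerivAt_id (0 : ℝ)).smul_const (fun i => A (v i))).const_add v
    have h4 := h2.comp_hasDerivAt (0 : ℝ) h3
    have h5 : (fun x => η x) ∘ (fun t : ℝ => v + t • fun i => A (v i)) = fun _ => 0 :=
      funext h1
    rw [h5] at h4
    have h6 := h4.unique (hasDerivAt_const _ _)
    rw [ContinuousMultilinearMap.linearDeriv_apply] at h6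
    exact h6

theorem wedgePow_compContinuousLinearMap {W : Type*} [AddCommGroup W] [Module ℝ W]
    [TopologicalSpace W] (Ω : V [⋀^Fin 2]→L[ℝ] ℝ) (k : ℕ) (A : W →L[ℝ] V) :
    (wedgePow Ω k).compContinuousLinearMap A = wedgePow (Ω.compContinuousLinearMap A) k := by
  ext v
  simp [wedgePow, ContinuousMultilinearMap.alternatization_apply_apply, pairProd]
  rfl

end VolumeForms

/-- On the Darboux basis `b` the form has the integer matrix `m`, so the sum over permutations is a
finite integer computation. It gives 8, and the normalisation makes the value 8 / 4 = 2. Without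
this nonvanishing, invariance of the measure would say nothing about the field. -/
theorem wedgePow_two_modelCanonical_ne_zero :
    wedgePow (modelCanonical (EuclideanSpace ℝ (Fin 2))) 2 ≠ 0 := by
  let e : Fin 2 → EuclideanSpace ℝ (Fin 2) := fun i => EuclideanSpace.basisFun (Fin 2) ℝ i
  let f : Fin 2 → EuclideanSpace ℝ (Fin 2) →L[ℝ] ℝ := fun i => EuclideanSpace.proj i
  let b : Fin (2 * 2) → EuclideanSpace ℝ (Fin 2) × (EuclideanSpace ℝ (Fin 2) →L[ℝ] ℝ) :=
    ![(e 0, 0), (0, f 0), (e 1, 0), (0, f 1)]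
  let m : Fin (2 * 2) → Fin (2 * 2) → ℤ :=
    ![![0, 1, 0, 0], ![-1, 0, 0, 0], ![0, 0, 0, 1], ![0, 0, -1, 0]]
  have hm : ∀ i j, modelCanonical (EuclideanSpace ℝ (Fin 2)) ![b i, b j] = m i j := by
    intro i j
    rw [modelCanonical_apply]
    fin_cases i <;> fin_cases j <;> simp [b, m, e, f]
  intro h
  have h1 : wedgePow (modelCanonical (EuclideanSpace ℝ (Fin 2))) 2 b =
      ((2 : ℝ) ^ 2)⁻¹ * ((∑ σ : Equiv.Perm (Fin (2 * 2)), (σ.sign : ℤ) *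
        ∏ i : Fin 2, m (σ (finProdFinEquiv (i, 0))) (σ (finProdFinEquiv (i, 1))) : ℤ) : ℝ) := by
    simp only [wedgePow, ContinuousAlternatingMap.smul_apply,
      ContinuousMultilinearMap.alternatization_apply_apply, smul_eq_mul]
    push_cast
    congr 1
    refine Finset.sum_congr rfl fun σ _ => ?_
    simp only [Units.smul_def, zsmul_eq_mul]
    congr 1
    change ∏ i : Fin 2, modelCanonical (EuclideanSpace ℝ (Fin 2))
      (fun j : Fin 2 => b (σ (finProdFinEquiv (i, j)))) = _
    refine Finset.prod_congr rfl fun i _ => ?_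
    rw [vec_two (fun j : Fin 2 => b (σ (finProdFinEquiv (i, j)))), hm]
  have h2 : (∑ σ : Equiv.Perm (Fin (2 * 2)), (σ.sign : ℤ) *
        ∏ i : Fin 2, m (σ (finProdFinEquiv (i, 0))) (σ (finProdFinEquiv (i, 1))) : ℤ) = 8 := by
    decide +kernel
  rw [h, h2] at h1
  norm_num at h1

/-! ### The model dynamics on F × F* and its derivatives. -/

section Divergence

variable {F : Type*} [NormedAddCommGroup F] [NormedSpace ℝ F]

/-- The vector field `(y, p) ↦ (K p, -½ p(DK(·) p) - DU - p(T(·, K p)))` on `F × F*`. -/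
def modelField (K : F → (F →L[ℝ] ℝ) →L[ℝ] F) (U : F → ℝ) (T : F → F →L[ℝ] F →L[ℝ] F)
    (w : F × (F →L[ℝ] ℝ)) : F × (F →L[ℝ] ℝ) :=
  (K w.1 w.2, -((1 / 2 : ℝ) • w.2.comp ((fderiv ℝ K w.1).flip w.2)) - fderiv ℝ U w.1
    - w.2.comp ((T w.1).flip (K w.1 w.2)))

/-- The Hamiltonian `½ p(K p) + U` on `F × F*`. -/
def modelHamiltonian (K : F → (F →L[ℝ] ℝ) →L[ℝ] F) (U : F → ℝ) (w : F × (F →L[ℝ] ℝ)) : ℝ :=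
  (1 / 2 : ℝ) * w.2 (K w.1 w.2) + U w.1

/-- Symmetry of `K` makes the two momentum derivatives of the quadratic form agree, which absorbs
the factor ½ in the last term. -/
theorem hasFDerivAt_modelHamiltonian {K : F → (F →L[ℝ] ℝ) →L[ℝ] F} {U : F → ℝ}
    {w : F × (F →L[ℝ] ℝ)} (hK : DifferentiableAt ℝ K w.1) (hU : DifferentiableAt ℝ U w.1)
    (hsymm : ∀ p q : F →L[ℝ] ℝ, p (K w.1 q) = q (K w.1 p)) :
    DifferentiableAt ℝ (modelHamiltonian K U) w ∧ ∀ a, fderiv ℝ (modelHamiltonian K U) w a =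
      (1 / 2 : ℝ) * w.2 (fderiv ℝ K w.1 a.1 w.2) + fderiv ℝ U w.1 a.1 + a.2 (K w.1 w.2) := by
  have h1 : HasFDerivAt (fun w : F × (F →L[ℝ] ℝ) => K w.1) _ w :=
    hK.hasFDerivAt.comp w hasFDerivAt_fst
  have h2 : HasFDerivAt (fun w : F × (F →L[ℝ] ℝ) => U w.1) _ w :=
    hU.hasFDerivAt.comp w hasFDerivAt_fst
  have h3 : HasFDerivAt (modelHamiltonian K U) _ w :=
    ((hasFDerivAt_snd.clm_apply (h1.clm_apply hasFDerivAt_snd)).const_mul (1 / 2 : ℝ)).add h2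
  refine ⟨h3.differentiableAt, fun a => ?_⟩
  rw [h3.fderiv]
  have := hsymm w.2 a.2
  simp
  rw [this]
  ring

theorem contDiffAt_modelField {K : F → (F →L[ℝ] ℝ) →L[ℝ] F} {U : F → ℝ}
    {T : F → F →L[ℝ] F →L[ℝ] F} {w : F × (F →L[ℝ] ℝ)} (hK : ContDiffAt ℝ ∞ K w.1)
    (hU : ContDiffAt ℝ ∞ U w.1) (hT : ContDiffAt ℝ ∞ T w.1) :
    ContDiffAt ℝ ∞ (modelField K U T) w := by
  have h1 : ContDiffAt ℝ ∞ (fun w : F × (F →L[ℝ] ℝ) => K w.1) w := hK.comp w contDiffAt_fst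
  have h2 : ContDiffAt ℝ ∞ (fun w : F × (F →L[ℝ] ℝ) => T w.1) w := hT.comp w contDiffAt_fst
  have h3 : ContDiffAt ℝ ∞ (fun w : F × (F →L[ℝ] ℝ) => fderiv ℝ K w.1) w :=
    (hK.fderiv_right (by simp)).comp w contDiffAt_fst
  have h4 : ContDiffAt ℝ ∞ (fun w : F × (F →L[ℝ] ℝ) => fderiv ℝ U w.1) w :=
    (hU.fderiv_right (by simp)).comp w contDiffAt_fst
  have h5 : ContDiffAt ℝ ∞ (fun w : F × (F →L[ℝ] ℝ) => w.2) w := contDiffAt_snd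
  have h6 : ContDiffAt ℝ ∞ (fun w : F × (F →L[ℝ] ℝ) => K w.1 w.2) w := h1.clm_apply h5
  have h7 : ContDiffAt ℝ ∞ (fun w : F × (F →L[ℝ] ℝ) => (fderiv ℝ K w.1).flip w.2) w :=
    ((ContinuousLinearMap.flipₗᵢ ℝ F (F →L[ℝ] ℝ) F).contDiff.contDiffAt.comp w h3).clm_apply h5
  have h8 : ContDiffAt ℝ ∞ (fun w : F × (F →L[ℝ] ℝ) => (T w.1).flip (K w.1 w.2)) w :=
    ((ContinuousLinearMap.flipₗᵢ ℝ F F F).contDiff.contDiffAt.comp w h2).clm_apply h6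
  exact h6.prodMk ((((h5.clm_comp h7).const_smul _).neg.sub h4).sub (h5.clm_comp h8))

theorem fderiv_symm {K : F → (F →L[ℝ] ℝ) →L[ℝ] F} {y : F} (hK : DifferentiableAt ℝ K y)
    (hsymm : ∀ᶠ z in 𝓝 y, ∀ p q : F →L[ℝ] ℝ, p (K z q) = q (K z p)) (u : F)
    (p q : F →L[ℝ] ℝ) : p (fderiv ℝ K y u q) = q (fderiv ℝ K y u p) := by
  have h : ∀ p q : F →L[ℝ] ℝ, HasFDerivAt (fun z => p (K z q))
      (p.comp ((fderiv ℝ K y).flip q)) y := fun p q =>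
    p.hasFDerivAt.comp y ((ContinuousLinearMap.apply ℝ F q).hasFDerivAt.comp y hK.hasFDerivAt)
  have h2 := ((h p q).congr_of_eventuallyEq (hsymm.mono fun z hz => (hz p q).symm)).unique (h q p)
  exact DFunLike.congr_fun h2 u

theorem fderiv_modelField_fst {K : F → (F →L[ℝ] ℝ) →L[ℝ] F} {U : F → ℝ}
    {T : F → F →L[ℝ] F →L[ℝ] F} {w : F × (F →L[ℝ] ℝ)} (hK : DifferentiableAt ℝ K w.1)
    (h : DifferentiableAt ℝ (modelField K U T) w) (a : F × (F →L[ℝ] ℝ)) :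
    (fderiv ℝ (modelField K U T) w a).1 = fderiv ℝ K w.1 a.1 w.2 + K w.1 a.2 := by
  have h1 : HasFDerivAt (fun w : F × (F →L[ℝ] ℝ) => K w.1) _ w :=
    hK.hasFDerivAt.comp w hasFDerivAt_fst
  have h2 : HasFDerivAt (fun w : F × (F →L[ℝ] ℝ) => K w.1 w.2) _ w :=
    h1.clm_apply hasFDerivAt_snd
  have h3 : HasFDerivAt (fun w : F × (F →L[ℝ] ℝ) => (modelField K U T w).1) _ w :=
    (ContinuousLinearMap.fst ℝ F (F →L[ℝ] ℝ)).hasFDerivAt.comp w h.hasFDerivAt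
  have h4 := DFunLike.congr_fun (h3.unique h2) a
  simp at h4
  rw [h4, add_comm]

/-- Momentum directions are enough: both the fibre block of the trace and the linearisation on the
zero section use only these. -/
theorem fderiv_modelField_snd {K : F → (F →L[ℝ] ℝ) →L[ℝ] F} {U : F → ℝ}
    {T : F → F →L[ℝ] F →L[ℝ] F} {w : F × (F →L[ℝ] ℝ)}
    (h : DifferentiableAt ℝ (modelField K U T) w) (ρ : F →L[ℝ] ℝ) (u : F) :
    (fderiv ℝ (modelField K U T) w (0, ρ)).2 u =
      -((1 / 2 : ℝ) * (ρ (fderiv ℝ K w.1 u w.2) + w.2 (fderiv ℝ K w.1 u ρ)))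
        - (ρ (T w.1 u (K w.1 w.2)) + w.2 (T w.1 u (K w.1 ρ))) := by
  have h1 : HasFDerivAt (fun p : F →L[ℝ] ℝ => (w.1, p))
      (ContinuousLinearMap.inr ℝ F (F →L[ℝ] ℝ)) w.2 := hasFDerivAt_prodMk_right w.1 w.2
  have h2 : HasFDerivAt (fun p : F →L[ℝ] ℝ => (modelField K U T (w.1, p)).2 u) _ w.2 :=
    (ContinuousLinearMap.apply ℝ ℝ u).hasFDerivAt.comp w.2
      ((ContinuousLinearMap.snd ℝ F (F →L[ℝ] ℝ)).hasFDerivAt.comp w.2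
        (HasFDerivAt.comp w.2 (f := fun p => (w.1, p)) h.hasFDerivAt h1))
  have h3 : ∀ B : (F →L[ℝ] ℝ) →L[ℝ] F, HasFDerivAt (fun p : F →L[ℝ] ℝ => p (B p)) _ w.2 :=
    fun B => (hasFDerivAt_id w.2).clm_apply B.hasFDerivAt
  have h4 : HasFDerivAt (fun p : F →L[ℝ] ℝ => (modelField K U T (w.1, p)).2 u) _ w.2 :=
    ((((h3 (fderiv ℝ K w.1 u)).const_mul (1 / 2 : ℝ)).neg.sub
      (hasFDerivAt_const (fderiv ℝ U w.1 u) w.2)).sub (h3 ((T w.1 u).comp (K w.1))))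
  have h5 := DFunLike.congr_fun (h2.unique h4) ρ
  simp at h5
  rw [h5]
  ring

end Divergence

/-! ### The divergence of the model field, and skew tensors in dimension two. -/

section EuclideanDivergence

variable {r : ℕ}

theorem trace_phaseSpace (A : (EuclideanSpace ℝ (Fin r) × (EuclideanSpace ℝ (Fin r) →L[ℝ] ℝ)) →ₗ[ℝ]
      EuclideanSpace ℝ (Fin r) × (EuclideanSpace ℝ (Fin r) →L[ℝ] ℝ)) :
    LinearMap.trace ℝ _ A = ∑ i, (A (EuclideanSpace.single i 1, 0)).1 i
      + ∑ i, (A (0, EuclideanSpace.proj i)).2 (EuclideanSpace.single i 1) := by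
  let b := (EuclideanSpace.basisFun (Fin r) ℝ).toBasis
  let b' : Module.Basis (Fin r) ℝ (EuclideanSpace ℝ (Fin r) →L[ℝ] ℝ) :=
    b.dualBasis.map LinearMap.toContinuousLinearMap
  have hb' : ∀ i, b' i = EuclideanSpace.proj i := by
    intro i
    ext v
    simp [b', b]
  have hr : ∀ g i, b'.repr g i = g (EuclideanSpace.single i 1) := by
    intro g i
    simp [b', b]
  rw [LinearMap.trace_eq_matrix_trace ℝ (b.prod b'), Matrix.trace, Fintype.sum_sum_type]
  congr 1
  · refine Finset.sum_congr rfl fun i _ => ?_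
    simp [LinearMap.toMatrix_apply, b]
  · refine Finset.sum_congr rfl fun i _ => ?_
    simp [LinearMap.toMatrix_apply, hr, hb']

theorem eq_zero_of_eq_neg {V : Type*} [AddCommGroup V] [Module ℝ V] {v : V} (h : v = -v) :
    v = 0 := by
  have h2 : (2 : ℝ) • v = 0 := by rw [two_smul]; exact eq_neg_iff_add_eq_zero.1 h
  exact (smul_eq_zero.1 h2).resolve_left two_ne_zero

/-- Exchanging the two summation indices turns the contraction of a skew tensor with a symmetric one
into its own negative. -/
theorem sum_skew_symm_eq_zero {T : EuclideanSpace ℝ (Fin r) →L[ℝ] EuclideanSpace ℝ (Fin r) →L[ℝ]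
      EuclideanSpace ℝ (Fin r)} (hT : ∀ u v, T u v = -T v u)
    {K : (EuclideanSpace ℝ (Fin r) →L[ℝ] ℝ) →L[ℝ] EuclideanSpace ℝ (Fin r)}
    (hK : ∀ p q : EuclideanSpace ℝ (Fin r) →L[ℝ] ℝ, p (K q) = q (K p)) :
    ∑ j, T (EuclideanSpace.single j 1) (K (EuclideanSpace.proj j)) = 0 := by
  have h1 : ∀ v : EuclideanSpace ℝ (Fin r),
      v = ∑ i, EuclideanSpace.proj (𝕜 := ℝ) i v • EuclideanSpace.single i (1 : ℝ) := by
    intro v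
    have := (EuclideanSpace.basisFun (Fin r) ℝ).sum_repr v
    simpa using this.symm
  have h2 : ∑ j, T (EuclideanSpace.single j 1) (K (EuclideanSpace.proj j)) =
      ∑ j, ∑ i, (EuclideanSpace.proj (𝕜 := ℝ) i (K (EuclideanSpace.proj j))) •
        T (EuclideanSpace.single j 1) (EuclideanSpace.single i (1 : ℝ)) := by
    refine Finset.sum_congr rfl fun j _ => ?_
    conv_lhs => rw [h1 (K (EuclideanSpace.proj j))]
    simp only [map_sum, map_smul]
  have h3 : ∑ j, T (EuclideanSpace.single j 1) (K (EuclideanSpace.proj j)) =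
      -∑ j, T (EuclideanSpace.single j 1) (K (EuclideanSpace.proj j)) := by
    conv_lhs => rw [h2, Finset.sum_comm]
    rw [h2, ← Finset.sum_neg_distrib]
    refine Finset.sum_congr rfl fun j _ => ?_
    rw [← Finset.sum_neg_distrib]
    refine Finset.sum_congr rfl fun i _ => ?_
    rw [hT, hK, smul_neg]
  exact eq_zero_of_eq_neg h3

/-- The mixed derivatives of the Hamiltonian cancel between the base and fibre blocks. In the
gyroscopic force p(T(·, K p)), differentiating the inner `K p` contracts the skew `T` with the
symmetric `K` and gives zero; differentiating the outer p leaves a trace of `T`. -/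
theorem trace_fderiv_modelField
    {K : EuclideanSpace ℝ (Fin r) → (EuclideanSpace ℝ (Fin r) →L[ℝ] ℝ) →L[ℝ]
      EuclideanSpace ℝ (Fin r)} {U : EuclideanSpace ℝ (Fin r) → ℝ}
    {T : EuclideanSpace ℝ (Fin r) → EuclideanSpace ℝ (Fin r) →L[ℝ] EuclideanSpace ℝ (Fin r) →L[ℝ]
      EuclideanSpace ℝ (Fin r)}
    {w : EuclideanSpace ℝ (Fin r) × (EuclideanSpace ℝ (Fin r) →L[ℝ] ℝ)}
    (hK : DifferentiableAt ℝ K w.1) (h : DifferentiableAt ℝ (modelField K U T) w)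
    (hsymm : ∀ᶠ z in 𝓝 w.1, ∀ p q : EuclideanSpace ℝ (Fin r) →L[ℝ] ℝ, p (K z q) = q (K z p))
    (hT : ∀ u v, T w.1 u v = -T w.1 v u) :
    LinearMap.trace ℝ _ (fderiv ℝ (modelField K U T) w).toLinearMap =
      -∑ j, (T w.1 (EuclideanSpace.single j 1) (K w.1 w.2)) j := by
  rw [trace_phaseSpace]
  have h0 := congrArg w.2 (sum_skew_symm_eq_zero hT hsymm.self_of_nhds)
  rw [map_sum, map_zero] at h0
  simp only [ContinuousLinearMap.coe_coe, fderiv_modelField_fst hK h, fderiv_modelField_snd h,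
    map_zero, add_zero]
  -- The vanishing contraction `h0` is inserted on the right, so that the identity holds summand by
  -- summand.
  rw [← Finset.sum_add_distrib, ← sub_zero (-_ : ℝ), ← h0, ← Finset.sum_neg_distrib,
    ← Finset.sum_sub_distrib]
  refine Finset.sum_congr rfl fun j _ => ?_
  rw [fderiv_symm hK hsymm (EuclideanSpace.single j 1) w.2 (EuclideanSpace.proj j)]
  change EuclideanSpace.proj (𝕜 := ℝ) j _ + (_ - (EuclideanSpace.proj (𝕜 := ℝ) j _ + _)) =
    -(EuclideanSpace.proj (𝕜 := ℝ) j _) - _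
  ring

/-- In dimension two `T` is fixed by the vector T(e₀, e₁), and the trace form has, up to sign and
order, the same two components. This is what lets an invariant measure force simplicity when r = 2.
-/
theorem skew_eq_of_two {T : EuclideanSpace ℝ (Fin 2) →L[ℝ] EuclideanSpace ℝ (Fin 2) →L[ℝ]
      EuclideanSpace ℝ (Fin 2)} (hT : ∀ u v, T u v = -T v u) (u v : EuclideanSpace ℝ (Fin 2)) :
    T u v = (∑ j, (T (EuclideanSpace.single j 1) v) j) • u
      - (∑ j, (T (EuclideanSpace.single j 1) u) j) • v := by
  have h1 : ∀ v : EuclideanSpace ℝ (Fin 2),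
      v = v 0 • EuclideanSpace.single 0 (1 : ℝ) + v 1 • EuclideanSpace.single 1 (1 : ℝ) := by
    intro v; ext i; fin_cases i <;> simp
  have h0 : ∀ u, T u u = 0 := fun u => eq_zero_of_eq_neg (hT u u)
  have h2 : ∀ u v, T u v = (u 0 * v 1 - u 1 * v 0) •
      T (EuclideanSpace.single 0 (1 : ℝ)) (EuclideanSpace.single 1 (1 : ℝ)) := by
    intro u v
    conv_lhs => rw [h1 u, h1 v]
    simp only [map_add, map_smul, _root_.add_apply, _root_.smul_apply, h0]
    rw [hT (EuclideanSpace.single 1 (1 : ℝ))]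
    module
  rw [h2 u v, Fin.sum_univ_two, Fin.sum_univ_two, h2 _ v, h2 _ v, h2 _ u, h2 _ u]
  ext i
  fin_cases i <;> simp <;> ring

/-- In dimension r the trace would be (r - 1) θ. For r = 2 the factor is 1, so the exponent of the
invariant density is φ itself. -/
theorem sum_trace_of_simple {T : EuclideanSpace ℝ (Fin 2) →L[ℝ] EuclideanSpace ℝ (Fin 2) →L[ℝ]
      EuclideanSpace ℝ (Fin 2)} {θ : EuclideanSpace ℝ (Fin 2) →L[ℝ] ℝ}
    (hT : ∀ u v, T u v = θ v • u - θ u • v) (v : EuclideanSpace ℝ (Fin 2)) :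
    ∑ j, (T (EuclideanSpace.single j 1) v) j = θ v := by
  have h1 : v = v 0 • EuclideanSpace.single 0 (1 : ℝ) + v 1 • EuclideanSpace.single 1 (1 : ℝ) := by
    ext i; fin_cases i <;> simp
  have h2 : θ v = v 0 * θ (EuclideanSpace.single 0 1) + v 1 * θ (EuclideanSpace.single 1 1) := by
    conv_lhs => rw [h1]
    simp
  simp only [hT, Fin.sum_univ_two]
  simp
  rw [h2]
  ring

end EuclideanDivergence

/-! ### The metric, the horizontal lift and the Hamiltonian at a point of Q, and their G-invariance.
-/

namespace ChaplyginSystem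

variable {n r m : ℕ} {Q S G : Type*}
    [TopologicalSpace Q] [ChartedSpace (EuclideanSpace ℝ (Fin n)) Q] [IsManifold (𝓡 n) ∞ Q]
    [TopologicalSpace S] [ChartedSpace (EuclideanSpace ℝ (Fin r)) S] [IsManifold (𝓡 r) ∞ S]
    [TopologicalSpace G] [ChartedSpace (EuclideanSpace ℝ (Fin m)) G] [Group G]
    [LieGroup (𝓡 m) ∞ G] [MulAction G Q]
    (sys : ChaplyginSystem n r m Q S G)

/-! ### Linear algebra at a point -/

/-- The horizontal lift, as a map between the model spaces. -/
def horM (q : Q) : EuclideanSpace ℝ (Fin r) →L[ℝ] EuclideanSpace ℝ (Fin n) := sys.hor q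

/-- The derivative of the orbit projection, as a map between the model spaces. -/
def dprojM (q : Q) : EuclideanSpace ℝ (Fin n) →L[ℝ] EuclideanSpace ℝ (Fin r) := sys.dproj q

/-- The orthogonal projector onto `D`, as an endomorphism of the model space. -/
def projDM (q : Q) : EuclideanSpace ℝ (Fin n) →L[ℝ] EuclideanSpace ℝ (Fin n) := sys.projD q

/-- The metric, as a bilinear form on the model space. -/
def metricM (q : Q) : EuclideanSpace ℝ (Fin n) →L[ℝ] EuclideanSpace ℝ (Fin n) →L[ℝ] ℝ :=
  sys.metric.inner q

/-- The constraint distribution, as a subspace of the model space. -/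
def subD (q : Q) : Submodule ℝ (EuclideanSpace ℝ (Fin n)) := sys.D q

theorem metricM_symm (q : Q) (u v : EuclideanSpace ℝ (Fin n)) :
    sys.metricM q u v = sys.metricM q v u := sys.metric.symm q u v

theorem metricM_pos (q : Q) (u : EuclideanSpace ℝ (Fin n)) (hu : u ≠ 0) :
    0 < sys.metricM q u u := sys.metric.pos q u hu

theorem horM_mem (q : Q) (w : EuclideanSpace ℝ (Fin r)) : sys.horM q w ∈ sys.subD q :=
  ((sys.dprojEquiv q).symm w).2

theorem dprojM_horM (q : Q) (w : EuclideanSpace ℝ (Fin r)) :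
    sys.dprojM q (sys.horM q w) = w :=
  (sys.dprojEquiv q).apply_symm_apply w

theorem horM_dprojM (q : Q) {v : EuclideanSpace ℝ (Fin n)} (hv : v ∈ sys.subD q) :
    sys.horM q (sys.dprojM q v) = v :=
  congrArg Subtype.val ((sys.dprojEquiv q).symm_apply_apply ⟨v, hv⟩)

theorem projDM_mem (q : Q) (v : EuclideanSpace ℝ (Fin n)) : sys.projDM q v ∈ sys.subD q :=
  Submodule.projection_apply_mem (sys.isCompl_orthD q) v

theorem projDM_of_mem (q : Q) {v : EuclideanSpace ℝ (Fin n)} (hv : v ∈ sys.subD q) :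
    sys.projDM q v = v :=
  Submodule.projection_apply_left (sys.isCompl_orthD q) ⟨v, hv⟩

theorem metricM_projDM (q : Q) (v : EuclideanSpace ℝ (Fin n)) {u : EuclideanSpace ℝ (Fin n)}
    (hu : u ∈ sys.subD q) : sys.metricM q (sys.projDM q v) u = sys.metricM q v u := by
  have h1 : v - sys.projDM q v ∈ sys.orthD q :=
    Submodule.sub_projection_mem (sys.isCompl_orthD q) v
  have h2 : sys.metricM q (v - sys.projDM q v) u = 0 := h1 u hu
  rw [map_sub, _root_.sub_apply, sub_eq_zero] at h2
  exact h2.symm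

/-- The metric induced on the shape space by the horizontal lift at `q`. -/
def shapeMetric (q : Q) : EuclideanSpace ℝ (Fin r) →L[ℝ] EuclideanSpace ℝ (Fin r) →L[ℝ] ℝ :=
  (sys.metricM q).bilinearComp (sys.horM q) (sys.horM q)

theorem shapeMetric_apply (q : Q) (w u : EuclideanSpace ℝ (Fin r)) :
    sys.shapeMetric q w u = sys.metricM q (sys.horM q w) (sys.horM q u) := rfl

theorem shapeMetric_bijective (q : Q) : Function.Bijective (sys.shapeMetric q) := by
  have hinj : Function.Injective (sys.shapeMetric q).toLinearMap := by
    rw [injective_iff_map_eq_zero]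
    intro w hw
    by_contra h0
    have h1 : sys.horM q w ≠ 0 := fun h => h0 (by rw [← sys.dprojM_horM q w, h, map_zero])
    have h2 := sys.metricM_pos q _ h1
    rw [← shapeMetric_apply] at h2
    exact h2.ne' (DFunLike.congr_fun hw w)
  exact ⟨hinj, (LinearMap.injective_iff_surjective_of_finrank_eq_finrank
    (finrank_continuousDual _)).1 hinj⟩

/-- The metric of the shape space as an isomorphism onto the dual. -/
def shapeEquiv (q : Q) :
    EuclideanSpace ℝ (Fin r) ≃L[ℝ] (EuclideanSpace ℝ (Fin r) →L[ℝ] ℝ) :=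
  (LinearEquiv.ofBijective (sys.shapeMetric q).toLinearMap
    (sys.shapeMetric_bijective q)).toContinuousLinearEquiv

/-- The inverse of the metric of the shape space. -/
def cometric (q : Q) : (EuclideanSpace ℝ (Fin r) →L[ℝ] ℝ) →L[ℝ] EuclideanSpace ℝ (Fin r) :=
  (sys.shapeEquiv q).symm

theorem shapeMetric_cometric (q : Q) (p : EuclideanSpace ℝ (Fin r) →L[ℝ] ℝ) :
    sys.shapeMetric q (sys.cometric q p) = p :=
  (sys.shapeEquiv q).apply_symm_apply p

theorem cometric_shapeMetric (q : Q) (w : EuclideanSpace ℝ (Fin r)) :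
    sys.cometric q (sys.shapeMetric q w) = w :=
  (sys.shapeEquiv q).symm_apply_apply w

theorem cometric_congr {q q' : Q} (h : sys.shapeMetric q = sys.shapeMetric q') :
    sys.cometric q = sys.cometric q' := by
  ext1 p
  rw [← sys.cometric_shapeMetric q' (sys.cometric q p), ← h, sys.shapeMetric_cometric]

/-- A vector of D is determined by its metric pairings with horizontal lifts, and 𝒫 does not change
these pairings. The right side contains no projector, so its smoothness and invariance follow from
those of the metric and the lift. -/
theorem dprojM_projDM (q : Q) (v : EuclideanSpace ℝ (Fin n)) :
    sys.dprojM q (sys.projDM q v) = sys.cometric q ((sys.metricM q v).comp (sys.horM q)) := by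
  rw [← sys.cometric_shapeMetric q (sys.dprojM q (sys.projDM q v))]
  congr 1
  ext1 u
  rw [shapeMetric_apply, sys.horM_dprojM q (sys.projDM_mem q v),
    sys.metricM_projDM q v (sys.horM_mem q u)]
  rfl

/-- The Hamiltonian on the cotangent space of the shape space, computed at `q`. -/
def fibreHamiltonian (q : Q) (p : EuclideanSpace ℝ (Fin r) →L[ℝ] ℝ) : ℝ :=
  (1 / 2 : ℝ) * p (sys.cometric q p) + sys.potential q

/-- The vector metrically dual to β ∘ 𝒫 is the horizontal lift of the cometric applied to β ∘ hor.
Hence the constrained energy depends on `β` only through its base point and β ∘ hor. -/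
theorem hamiltonian_constrain (β : CotangentBundle (𝓡 n) Q) :
    sys.hamiltonian (sys.constrain β) =
      sys.fibreHamiltonian β.proj ((momentum β).comp (sys.horM β.proj)) := by
  set q := β.proj with hq
  set p := (momentum β).comp (sys.horM q) with hp
  have h1 : sys.flat q (sys.horM q (sys.cometric q p)) = (momentum β).comp (sys.projDM q) := by
    change sys.metricM q (sys.horM q (sys.cometric q p)) = _
    ext v
    rw [metricM_symm, ← sys.metricM_projDM q v (sys.horM_mem q _),
      ← sys.horM_dprojM q (sys.projDM_mem q v), metricM_symm, ← shapeMetric_apply,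
      shapeMetric_cometric]
    change momentum β (sys.horM q (sys.dprojM q (sys.projDM q v))) = momentum β (sys.projDM q v)
    rw [sys.horM_dprojM q (sys.projDM_mem q v)]
  have h2 : (sys.flat q).symm ((momentum β).comp (sys.projDM q)) =
      sys.horM q (sys.cometric q p) := (LinearEquiv.symm_apply_eq _).2 h1.symm
  change (1 / 2 : ℝ) * ((momentum β).comp (sys.projDM q))
    ((sys.flat q).symm ((momentum β).comp (sys.projDM q))) + sys.potential q = _
  rw [h2, fibreHamiltonian, ContinuousLinearMap.comp_apply, sys.projDM_of_mem q (sys.horM_mem q _)]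
  rfl

/-! ### Equivariance -/

/-- The derivative of the action of `g`, as an endomorphism of the model space. -/
def actM (_ : ChaplyginSystem n r m Q S G) (g : G) (q : Q) :
    EuclideanSpace ℝ (Fin n) →L[ℝ] EuclideanSpace ℝ (Fin n) :=
  modelD (𝓡 n) (𝓡 n) (fun x : Q => g • x) q

theorem contMDiff_smul (sys : ChaplyginSystem n r m Q S G) (g : G) :
    ContMDiff (𝓡 n) (𝓡 n) ∞ (fun x : Q => g • x) := by
  have hs := sys.smooth_smul
  exact hs.contMDiff_smul.comp (contMDiff_const.prodMk contMDiff_id)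

theorem proj_smul (g : G) (q : Q) : sys.proj (g • q) = sys.proj q :=
  ((sys.proj_fibre q (g • q)).2 ⟨g, rfl⟩).symm

theorem dprojM_actM (g : G) (q : Q) (v : EuclideanSpace ℝ (Fin n)) :
    sys.dprojM (g • q) (sys.actM g q v) = sys.dprojM q v := by
  have h1 : MDifferentiableAt (𝓡 n) (𝓡 n) (fun x : Q => g • x) q :=
    (sys.contMDiff_smul g).mdifferentiable (by simp) q
  have h2 : MDifferentiableAt (𝓡 n) (𝓡 r) sys.proj (g • q) :=
    sys.proj_smooth.mdifferentiable (by simp) _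
  have h3 := mfderiv_comp q h2 h1
  have h4 : sys.proj ∘ (fun x : Q => g • x) = sys.proj := funext fun x => sys.proj_smul g x
  rw [h4] at h3
  exact (DFunLike.congr_fun h3 v).symm

theorem actM_mem (g : G) (q : Q) {v : EuclideanSpace ℝ (Fin n)} (hv : v ∈ sys.subD q) :
    sys.actM g q v ∈ sys.subD (g • q) := by
  have h := sys.D_invariant g q
  change _ ∈ sys.D (g • q)
  rw [← h]
  exact ⟨v, hv, rfl⟩

/-- Both sides lie in D over `g • q`, because D is invariant, and both project to `w`, because π ∘ g
= π. -/
theorem actM_horM (g : G) (q : Q) (w : EuclideanSpace ℝ (Fin r)) :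
    sys.actM g q (sys.horM q w) = sys.horM (g • q) w := by
  rw [← sys.horM_dprojM (g • q) (sys.actM_mem g q (sys.horM_mem q w)), sys.dprojM_actM,
    sys.dprojM_horM]

theorem metricM_actM (g : G) (q : Q) (u v : EuclideanSpace ℝ (Fin n)) :
    sys.metricM (g • q) (sys.actM g q u) (sys.actM g q v) = sys.metricM q u v :=
  sys.metric_invariant g q u v

theorem shapeMetric_smul (g : G) (q : Q) : sys.shapeMetric (g • q) = sys.shapeMetric q := by
  ext1 w
  ext1 u
  rw [shapeMetric_apply, shapeMetric_apply, ← sys.actM_horM, ← sys.actM_horM, sys.metricM_actM]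

theorem cometric_smul (g : G) (q : Q) : sys.cometric (g • q) = sys.cometric q :=
  sys.cometric_congr (sys.shapeMetric_smul g q)

theorem dprojM_projDM_actM (g : G) (q : Q) (v : EuclideanSpace ℝ (Fin n)) :
    sys.dprojM (g • q) (sys.projDM (g • q) (sys.actM g q v)) =
      sys.dprojM q (sys.projDM q v) := by
  rw [dprojM_projDM, dprojM_projDM, cometric_smul]
  congr 1
  ext1 u
  rw [ContinuousLinearMap.comp_apply, ContinuousLinearMap.comp_apply, ← sys.actM_horM,
    sys.metricM_actM]

theorem fibreHamiltonian_eq {q q' : Q} (h : sys.proj q = sys.proj q') :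
    sys.fibreHamiltonian q = sys.fibreHamiltonian q' := by
  obtain ⟨g, rfl⟩ := (sys.proj_fibre q q').1 h
  funext p
  rw [fibreHamiltonian, fibreHamiltonian, cometric_smul, sys.potential_invariant]

theorem reduce_eq (β : CotangentBundle (𝓡 n) Q) :
    sys.reduce β = covector (𝓡 r) (sys.proj β.proj) ((momentum β).comp (sys.horM β.proj)) := rfl

theorem covector_inj {E : Type*} [NormedAddCommGroup E] [NormedSpace ℝ E] {H : Type*}
    [TopologicalSpace H] {I : ModelWithCorners ℝ E H} {M : Type*} [TopologicalSpace M]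
    [ChartedSpace H M] [IsManifold I ∞ M] {x y : M} {p p' : E →L[ℝ] ℝ}
    (h : covector I x p = covector I y p') : x = y ∧ p = p' := by
  have h1 : x = y := congrArg Bundle.TotalSpace.proj h
  exact ⟨h1, congrArg (fun α : CotangentBundle I M => momentum α) h⟩

/-- `Function.extend` takes the intended value because covectors with equal reductions lie over one
orbit, along which `fibreHamiltonian` is constant. -/
theorem reducedHamiltonian_reduce (β : CotangentBundle (𝓡 n) Q) :
    sys.reducedHamiltonian (sys.reduce β) = sys.hamiltonian (sys.constrain β) := by
  refine Function.FactorsThrough.extend_apply (fun β β' h => ?_) _ _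
  rw [reduce_eq, reduce_eq] at h
  obtain ⟨h1, h2⟩ := covector_inj h
  rw [hamiltonian_constrain, hamiltonian_constrain, h2, sys.fibreHamiltonian_eq h1]

/-- The constrained covector at `q` which reduces to the covector `p` at `proj q`. -/
def lift (q : Q) (p : EuclideanSpace ℝ (Fin r) →L[ℝ] ℝ) : CotangentBundle (𝓡 n) Q :=
  covector (𝓡 n) q ((p.comp (sys.dprojM q)).comp (sys.projDM q))

theorem reduce_lift (q : Q) (p : EuclideanSpace ℝ (Fin r) →L[ℝ] ℝ) :
    sys.reduce (sys.lift q p) = covector (𝓡 r) (sys.proj q) p := by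
  rw [reduce_eq]
  change covector (𝓡 r) (sys.proj q) (((p.comp (sys.dprojM q)).comp (sys.projDM q)).comp
    (sys.horM q)) = _
  congr 1
  ext w
  simp only [ContinuousLinearMap.comp_apply]
  rw [sys.projDM_of_mem q (sys.horM_mem q w), sys.dprojM_horM]

theorem constrain_eq (β : CotangentBundle (𝓡 n) Q) :
    sys.constrain β = covector (𝓡 n) β.proj ((momentum β).comp (sys.projDM β.proj)) := rfl

theorem constrain_lift (q : Q) (p : EuclideanSpace ℝ (Fin r) →L[ℝ] ℝ) :
    sys.constrain (sys.lift q p) = sys.lift q p := by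
  rw [constrain_eq]
  change covector (𝓡 n) q (((p.comp (sys.dprojM q)).comp (sys.projDM q)).comp
    (sys.projDM q)) = covector (𝓡 n) q _
  congr 1
  ext v
  simp only [ContinuousLinearMap.comp_apply]
  rw [sys.projDM_of_mem q (sys.projDM_mem q v)]

theorem momentum_projDM {β : CotangentBundle (𝓡 n) Q} (hβ : sys.constrain β = β)
    (v : EuclideanSpace ℝ (Fin n)) : momentum β (sys.projDM β.proj v) = momentum β v := by
  have h : momentum (sys.constrain β) = momentum β := congrArg momentum hβ
  exact DFunLike.congr_fun h v

theorem reducedHamiltonian_covector (q : Q) (p : EuclideanSpace ℝ (Fin r) →L[ℝ] ℝ) :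
    sys.reducedHamiltonian (covector (𝓡 r) (sys.proj q) p) = sys.fibreHamiltonian q p := by
  rw [← reduce_lift, reducedHamiltonian_reduce, hamiltonian_constrain]
  have h := sys.reduce_lift q p
  rw [reduce_eq] at h
  rw [(covector_inj h).2]
  rfl

end ChaplyginSystem

/-! ### Local sections of submersions, and the push-forward of Hamiltonian vectors. -/

section Calculus

variable {E F : Type*} [NormedAddCommGroup E] [NormedSpace ℝ E] [NormedAddCommGroup F]
  [NormedSpace ℝ F]

/-- Precompose `f` with the affine map z ↦ x₀ + R' z, where R' is a right inverse of the derivative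
at `x₀`. The composite has derivative the identity at 0, so the inverse function theorem applies.
Such sections of π turn functions of a point of Q into smooth functions on a chart of S. -/
theorem exists_local_section [FiniteDimensional ℝ E] [FiniteDimensional ℝ F] {f : E → F} {x₀ : E}
    (hf : ContDiffAt ℝ ∞ f x₀) (hsurj : Function.Surjective (fderiv ℝ f x₀)) :
    ∃ s : F → E, ContDiffAt ℝ ∞ s (f x₀) ∧ s (f x₀) = x₀ ∧ ∀ᶠ y in 𝓝 (f x₀), f (s y) = y := by
  have : CompleteSpace F := FiniteDimensional.complete ℝ F
  obtain ⟨R, hR⟩ := LinearMap.exists_rightInverse_of_surjective (fderiv ℝ f x₀).toLinearMap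
    (LinearMap.range_eq_top.2 hsurj)
  let R' : F →L[ℝ] E := R.toContinuousLinearMap
  let h : F → E := fun z => x₀ + R' z
  have hh0 : h 0 = x₀ := by simp [h]
  have hh : HasFDerivAt h R' 0 := R'.hasFDerivAt.const_add x₀
  have hhs : ContDiffAt ℝ ∞ h 0 := contDiffAt_const.add R'.contDiff.contDiffAt
  have hd : HasFDerivAt (fun z => f (h z))
      ((ContinuousLinearEquiv.refl ℝ F : F ≃L[ℝ] F) : F →L[ℝ] F) 0 := by
    have h1 : HasFDerivAt f (fderiv ℝ f x₀) (h 0) := by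
      rw [hh0]; exact (hf.differentiableAt (by simp)).hasFDerivAt
    have h2 := h1.comp (0 : F) hh
    have h3 : (fderiv ℝ f x₀).comp R' =
        ((ContinuousLinearEquiv.refl ℝ F : F ≃L[ℝ] F) : F →L[ℝ] F) := by
      ext z
      exact LinearMap.congr_fun hR z
    rw [h3] at h2
    exact h2
  have hc : ContDiffAt ℝ ∞ (fun z => f (h z)) 0 := by
    have h1 : ContDiffAt ℝ ∞ f (h 0) := by rwa [hh0]
    exact h1.comp (0 : F) hhs
  have hn : (∞ : WithTop ℕ∞) ≠ 0 := by simp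
  refine ⟨h ∘ hc.localInverse hd hn, ?_, ?_, ?_⟩
  · have h1 := hc.to_localInverse hd hn
    have h2 := hc.localInverse_apply_image hd hn
    rw [hh0] at h1 h2
    refine ContDiffAt.comp _ ?_ h1
    rw [h2]
    exact hhs
  · have h2 := hc.localInverse_apply_image hd hn
    rw [hh0] at h2
    rw [Function.comp_apply, h2, hh0]
  · have h1 := (hc.hasStrictFDerivAt' hd hn).eventually_right_inverse
    rw [hh0] at h1
    exact h1

theorem contDiffAt_clm_of_apply {k : ℕ} {f : E → EuclideanSpace ℝ (Fin k) →L[ℝ] F} {x : E}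
    (h : ∀ v, ContDiffAt ℝ ∞ (fun x => f x v) x) : ContDiffAt ℝ ∞ f x := by
  have h1 : f = fun x => ∑ i, (EuclideanSpace.proj (𝕜 := ℝ) i).smulRight
      (f x (EuclideanSpace.single i 1)) := by
    funext x
    ext v
    conv_lhs => rw [← (EuclideanSpace.basisFun (Fin k) ℝ).sum_repr v]
    simp
  rw [h1]
  exact ContDiffAt.sum fun i _ =>
    ((ContinuousLinearMap.smulRightL ℝ (EuclideanSpace ℝ (Fin k)) F
      (EuclideanSpace.proj i)).contDiff.contDiffAt.comp x (h _))

theorem contDiffAt_inverse [CompleteSpace E] {D : Type*} [NormedAddCommGroup D] [NormedSpace ℝ D]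
    {f : D → E →L[ℝ] F} {x : D} (hf : ContDiffAt ℝ ∞ f x) (hi : (f x).IsInvertible) :
    ContDiffAt ℝ ∞ (fun x => (f x).inverse) x := by
  obtain ⟨e, he⟩ := hi
  have h1 : ContDiffAt ℝ ∞ ContinuousLinearMap.inverse (f x) := by
    rw [← he]; exact contDiffAt_map_inverse e
  exact h1.comp x hf

/-- The map `(x, p) ↦ (f(x), p ∘ h(x))`. -/
def modelReduce (f : E → F) (h : E → F →L[ℝ] E) (w : E × (E →L[ℝ] ℝ)) : F × (F →L[ℝ] ℝ) :=
  (f w.1, w.2.comp (h w.1))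

theorem hasFDerivAt_modelReduce {f : E → F} {h : E → F →L[ℝ] E} {w : E × (E →L[ℝ] ℝ)}
    (hf : DifferentiableAt ℝ f w.1) (hh : DifferentiableAt ℝ h w.1) :
    DifferentiableAt ℝ (modelReduce f h) w ∧ ∀ a, fderiv ℝ (modelReduce f h) w a =
      (fderiv ℝ f w.1 a.1, a.2.comp (h w.1) + w.2.comp (fderiv ℝ h w.1 a.1)) := by
  have h1 : HasFDerivAt (fun w : E × (E →L[ℝ] ℝ) => f w.1) _ w :=
    hf.hasFDerivAt.comp w hasFDerivAt_fst
  have h2 : HasFDerivAt (fun w : E × (E →L[ℝ] ℝ) => h w.1) _ w :=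
    hh.hasFDerivAt.comp w hasFDerivAt_fst
  have h3 : HasFDerivAt (modelReduce f h) _ w := h1.prodMk (hasFDerivAt_snd.clm_comp h2)
  refine ⟨h3.differentiableAt, fun a => ?_⟩
  rw [h3.fderiv]
  refine Prod.ext rfl ?_
  ext u
  simp [add_comm]

/-- Testing the Hamiltonian equation on momentum directions shows that `W` lies over the lift of v =
∂H/∂p. Testing on lifted directions gives its fibre part on the image of `h`. Pushing forward
differentiates `h` along `W.1` as well, and the two derivatives of `h` combine into a bracket of
lifts, the source of the gyroscopic force. -/
theorem fderiv_modelReduce_hamiltonian {f : E → F} {h : E → F →L[ℝ] E} {w : E × (E →L[ℝ] ℝ)}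
    (hf : DifferentiableAt ℝ f w.1) (hh : DifferentiableAt ℝ h w.1)
    (hfh : ∀ u, fderiv ℝ f w.1 (h w.1 u) = u) {H : F × (F →L[ℝ] ℝ) → ℝ}
    (hH : DifferentiableAt ℝ H (modelReduce f h w)) {v : F}
    (hv : ∀ q : F →L[ℝ] ℝ, fderiv ℝ H (modelReduce f h w) (0, q) = q v)
    {W : E × (E →L[ℝ] ℝ)}
    (hW : ∀ b, modelCanonical E ![W, b] = fderiv ℝ (fun w => H (modelReduce f h w)) w b) :
    (fderiv ℝ (modelReduce f h) w W).1 = v ∧ ∀ u, (fderiv ℝ (modelReduce f h) w W).2 u =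
      -fderiv ℝ H (modelReduce f h w) (u, 0)
        - w.2 (fderiv ℝ h w.1 (h w.1 u) v - fderiv ℝ h w.1 (h w.1 v) u) := by
  obtain ⟨hr, hr'⟩ := hasFDerivAt_modelReduce hf hh
  have hc : HasFDerivAt (fun w => H (modelReduce f h w))
      ((fderiv ℝ H (modelReduce f h w)).comp (fderiv ℝ (modelReduce f h) w)) w :=
    hH.hasFDerivAt.comp w hr.hasFDerivAt
  have hsplit : ∀ a : F × (F →L[ℝ] ℝ), fderiv ℝ H (modelReduce f h w) a =
      fderiv ℝ H (modelReduce f h w) (a.1, 0) + a.2 v := by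
    intro a
    rw [← hv a.2, ← map_add]
    simp
  have hW' : ∀ b : E × (E →L[ℝ] ℝ), b.2 W.1 - W.2 b.1 =
      fderiv ℝ H (modelReduce f h w) (fderiv ℝ f w.1 b.1, 0) +
        (b.2 (h w.1 v) + w.2 (fderiv ℝ h w.1 b.1 v)) := by
    intro b
    rw [← modelCanonical_apply, hW, hc.fderiv, ContinuousLinearMap.comp_apply, hr', hsplit]
    rfl
  have hW1 : W.1 = h w.1 v := by
    by_contra hne
    obtain ⟨q, hq⟩ := SeparatingDual.exists_ne_zero (R := ℝ) (sub_ne_zero.2 hne)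
    have := hW' (0, q)
    have h0 : ((0 : F), (0 : F →L[ℝ] ℝ)) = 0 := rfl
    refine hq ?_
    rw [map_sub, sub_eq_zero]
    simpa [h0] using this
  have hW2 : ∀ u, W.2 (h w.1 u) =
      -(fderiv ℝ H (modelReduce f h w) (u, 0) + w.2 (fderiv ℝ h w.1 (h w.1 u) v)) := by
    intro u
    have := hW' (h w.1 u, 0)
    rw [hfh] at this
    simp at this
    linarith
  rw [hr']
  refine ⟨by rw [hW1]; exact hfh v, fun u => ?_⟩
  change W.2 (h w.1 u) + w.2 (fderiv ℝ h w.1 W.1 u) = _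
  rw [hW2, hW1, map_sub]
  ring

end Calculus

/-! ### Vector fields in charts -/

section Fields

variable {E : Type*} [NormedAddCommGroup E] [NormedSpace ℝ E] {H : Type*} [TopologicalSpace H]
  {I : ModelWithCorners ℝ E H} {M : Type*} [TopologicalSpace M] [ChartedSpace H M]
  [IsManifold I ∞ M] [I.Boundaryless]

/-- The value of a vector field, as an element of the model space. -/
def fieldAt (V : VField I M) (x : M) : E := V x

/-- The expression of a vector field in the preferred chart at `x₀`. -/
def fieldC (V : VField I M) (x₀ : M) (y : E) : E :=
  chartD I x₀ ((extChartAt I x₀).symm y) (fieldAt V ((extChartAt I x₀).symm y))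

theorem contMDiffAt_field_iff {V : VField I M} {x₀ x : M} (hx : x ∈ (chartAt H x₀).source) :
    ContMDiffAt I I.tangent ∞ (fun q => (⟨q, V q⟩ : TangentBundle I M)) x ↔
      ContMDiffAt I 𝓘(ℝ, E) ∞ (fun q => chartD I x₀ q (fieldAt V q)) x := by
  have hb : x ∈ (trivializationAt E (TangentSpace I) x₀).baseSet := by
    rwa [TangentBundle.trivializationAt_baseSet]
  refine ((trivializationAt E (TangentSpace I) x₀).contMDiffAt_section_iff hb).trans ?_
  refine Filter.EventuallyEq.contMDiffAt_iff ?_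
  filter_upwards [(chartAt H x₀).open_source.mem_nhds hx] with q hq
  rw [← continuousLinearMapAt_eq_chartD hq]
  have hq' : q ∈ (trivializationAt E (TangentSpace I) x₀).baseSet := by
    rwa [TangentBundle.trivializationAt_baseSet]
  exact ((trivializationAt E (TangentSpace I) x₀).continuousLinearMapAt_apply_of_mem
    (R := ℝ) hq' _).symm

theorem fieldC_self (V : VField I M) (x : M) :
    fieldC V x (extChartAt I x x) = fieldAt V x := by
  rw [fieldC, extChartAt_to_inv, chartD_self]
  rfl

theorem contDiffAt_fieldC {V : VField I M} {x₀ : M} {y : E} (hy : y ∈ (extChartAt I x₀).target)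
    (hV : ContMDiffAt I I.tangent ∞ (fun q => (⟨q, V q⟩ : TangentBundle I M))
      ((extChartAt I x₀).symm y)) : ContDiffAt ℝ ∞ (fieldC V x₀) y := by
  have hx : (extChartAt I x₀).symm y ∈ (chartAt H x₀).source := by
    rw [← extChartAt_source I]; exact (extChartAt I x₀).map_target hy
  exact contDiffAt_inChart hy ((contMDiffAt_field_iff hx).1 hV)

theorem fieldC_eq_mpullbackWithin (V : VField I M) {x₀ : M} {y : E}
    (hy : y ∈ (extChartAt I x₀).target) :
    VectorField.mpullbackWithin 𝓘(ℝ, E) I (extChartAt I x₀).symm V (Set.range I) y =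
      fieldC V x₀ y := by
  change (chartDsymm I x₀ y).inverse _ = _
  rw [inverse_chartDsymm hy]
  rfl

/-- The bracket of vector fields, as a vector of the model space. -/
def bracketAt (V W : VField I M) (x : M) : E := VectorField.mlieBracket I V W x

theorem bracketAt_eq (V W : VField I M) (x : M) :
    bracketAt V W x =
      fderiv ℝ (fieldC W x) (extChartAt I x x) (fieldC V x (extChartAt I x x))
        - fderiv ℝ (fieldC V x) (extChartAt I x x) (fieldC W x (extChartAt I x x)) := by
  let P : VField I M → E → E := fun V =>
    VectorField.mpullbackWithin 𝓘(ℝ, E) I (extChartAt I x).symm V (Set.range I)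
  have hev : ∀ V : VField I M, P V =ᶠ[𝓝 (extChartAt I x x)] fieldC V x := fun V => by
    filter_upwards [eventually_mem_target (mem_extChartAt_target x)] with y hy
    exact fieldC_eq_mpullbackWithin V hy
  have h1 : bracketAt V W x = (chartD I x x).inverse (VectorField.lieBracketWithin ℝ (P V) (P W)
      ((extChartAt I x).symm ⁻¹' Set.univ ∩ Set.range I) (extChartAt I x x)) := rfl
  rw [h1, chartD_self, ContinuousLinearMap.inverse_id, I.range_eq_univ, Set.preimage_univ,
    Set.univ_inter, VectorField.lieBracketWithin_univ,
    (hev V).lieBracket_vectorField_eq (hev W)]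
  rfl

theorem contMDiffAt_constField {x₀ x : M} (hx : x ∈ (chartAt H x₀).source) (v : E) :
    ContMDiffAt I I.tangent ∞
      (fun q => (⟨q, chartDsymm I x₀ (extChartAt I x₀ q) v⟩ : TangentBundle I M)) x := by
  rw [contMDiffAt_field_iff (V := fun q => chartDsymm I x₀ (extChartAt I x₀ q) v) hx]
  refine (contMDiffAt_const (c := v)).congr_of_eventuallyEq ?_
  filter_upwards [(chartAt H x₀).open_source.mem_nhds hx] with q hq
  have hq' : q ∈ (extChartAt I x₀).source := by rwa [extChartAt_source]
  have h := chartD_chartDsymm ((extChartAt I x₀).map_source hq') v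
  rw [(extChartAt I x₀).left_inv hq'] at h
  exact h

/-- Every tangent vector extends to a global smooth vector field. -/
theorem exists_smooth_field [FiniteDimensional ℝ E] [T2Space M] (x : M) (v : E) :
    ∃ V : VField I M, IsSmoothVField V ∧ fieldAt V x = v := by
  let ψ : SmoothBumpFunction I x := Classical.arbitrary _
  let V : VField I M := fun q => (ψ q • chartDsymm I x (extChartAt I x q) v : E)
  refine ⟨V, fun q => ?_, ?_⟩
  · by_cases hq : q ∈ (chartAt H x).source
    · have h1 := (contMDiffAt_field_iff (V := fun q => chartDsymm I x (extChartAt I x q) v) hq).1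
        (contMDiffAt_constField hq v)
      refine (contMDiffAt_field_iff (V := V) hq).2 ?_
      refine (ContMDiffAt.smul (ψ.contMDiff.contMDiffAt (x := q)) h1).congr_of_eventuallyEq ?_
      refine Filter.Eventually.of_forall fun z => ?_
      exact (chartD I x z).map_smul _ _
    -- Off the chart domain the bump function vanishes on a neighbourhood, so there the field is
    -- locally zero.
    · have h0 : q ∉ tsupport ψ := fun h => hq (ψ.tsupport_subset_chartAt_source h)
      have h1 : ∀ᶠ z in 𝓝 q, ψ z = 0 := notMem_tsupport_iff_eventuallyEq.1 h0
      refine (contMDiffAt_field_iff (V := V) (mem_chart_source H q)).2 ?_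
      refine (contMDiffAt_const (c := (0 : E))).congr_of_eventuallyEq ?_
      filter_upwards [h1] with z hz
      change chartD I q z (ψ z • chartDsymm I x (extChartAt I x z) v : E) = 0
      rw [hz, zero_smul, map_zero]
  · change (ψ x • chartDsymm I x (extChartAt I x x) v : E) = v
    rw [ψ.eq_one, one_smul, chartDsymm_self]
    rfl

end Fields

/-- The model space of dimension `k`. -/
abbrev Vec (k : ℕ) : Type := EuclideanSpace ℝ (Fin k)

namespace ChaplyginSystem

variable {n r m : ℕ} {Q S G : Type*}
    [TopologicalSpace Q] [ChartedSpace (EuclideanSpace ℝ (Fin n)) Q] [IsManifold (𝓡 n) ∞ Q]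
    [TopologicalSpace S] [ChartedSpace (EuclideanSpace ℝ (Fin r)) S] [IsManifold (𝓡 r) ∞ S]
    [TopologicalSpace G] [ChartedSpace (EuclideanSpace ℝ (Fin m)) G] [Group G]
    [LieGroup (𝓡 m) ∞ G] [MulAction G Q]
    (sys : ChaplyginSystem n r m Q S G)

/-! ### The system in charts -/

/-- The points of the chart at `q₀` which are projected into the chart at `s₀`. -/
def chartDomain (q₀ : Q) (s₀ : S) : Set (Vec n) :=
  {x | x ∈ (extChartAt (𝓡 n) q₀).target ∧
    sys.proj ((extChartAt (𝓡 n) q₀).symm x) ∈ (chartAt (Vec r) s₀).source}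

/-- The orbit projection in charts. -/
def projC (q₀ : Q) (s₀ : S) (x : Vec n) : Vec r :=
  extChartAt (𝓡 r) s₀ (sys.proj ((extChartAt (𝓡 n) q₀).symm x))

/-- The horizontal lift in charts. -/
def horC (q₀ : Q) (s₀ : S) (x : Vec n) : Vec r →L[ℝ] Vec n :=
  (chartD (𝓡 n) q₀ ((extChartAt (𝓡 n) q₀).symm x)).comp
    ((sys.horM ((extChartAt (𝓡 n) q₀).symm x)).comp (chartDsymm (𝓡 r) s₀ (sys.projC q₀ s₀ x)))

/-- The metric in a chart. -/
def metricC (q₀ : Q) (x : Vec n) : Vec n →L[ℝ] Vec n →L[ℝ] ℝ :=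
  (sys.metricM ((extChartAt (𝓡 n) q₀).symm x)).bilinearComp
    (chartDsymm (𝓡 n) q₀ x) (chartDsymm (𝓡 n) q₀ x)

/-- The inverse of the metric of the shape space in charts. -/
def cometricC (q₀ : Q) (s₀ : S) (x : Vec n) : (Vec r →L[ℝ] ℝ) →L[ℝ] Vec r :=
  (chartD (𝓡 r) s₀ (sys.proj ((extChartAt (𝓡 n) q₀).symm x))).comp
    ((sys.cometric ((extChartAt (𝓡 n) q₀).symm x)).comp
      ((ContinuousLinearMap.compL ℝ (Vec r) (Vec r) ℝ).flip
        (chartD (𝓡 r) s₀ (sys.proj ((extChartAt (𝓡 n) q₀).symm x)))))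

/-- The orthogonal projection to `D`, followed by the derivative of the orbit projection,
in charts. -/
def verticalC (q₀ : Q) (s₀ : S) (x : Vec n) : Vec n →L[ℝ] Vec r :=
  (sys.cometricC q₀ s₀ x).comp
    (((ContinuousLinearMap.compL ℝ (Vec r) (Vec n) ℝ).flip (sys.horC q₀ s₀ x)).comp
      (sys.metricC q₀ x))

/-- The gyroscopic tensor in charts. -/
def gyroC (q₀ : Q) (s₀ : S) (x : Vec n) : Vec r →L[ℝ] Vec r →L[ℝ] Vec r :=
  (ContinuousLinearMap.compL ℝ (Vec r) (Vec n) (Vec r) (sys.verticalC q₀ s₀ x)).comp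
    ((fderiv ℝ (sys.horC q₀ s₀) x).comp (sys.horC q₀ s₀ x)
      - ((fderiv ℝ (sys.horC q₀ s₀) x).comp (sys.horC q₀ s₀ x)).flip)

variable {sys} {q₀ : Q} {s₀ : S} {x : Vec n}

theorem gyroC_apply (u v : Vec r) : sys.gyroC q₀ s₀ x u v = sys.verticalC q₀ s₀ x
    (fderiv ℝ (sys.horC q₀ s₀) x (sys.horC q₀ s₀ x u) v
      - fderiv ℝ (sys.horC q₀ s₀) x (sys.horC q₀ s₀ x v) u) := rfl

theorem gyroC_skew (u v : Vec r) : sys.gyroC q₀ s₀ x u v = -sys.gyroC q₀ s₀ x v u := by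
  rw [gyroC_apply, gyroC_apply, ← map_neg, neg_sub]

theorem cometric_symm (q : Q) (p p' : Vec r →L[ℝ] ℝ) :
    p (sys.cometric q p') = p' (sys.cometric q p) := by
  conv_lhs => rw [← sys.shapeMetric_cometric q p]
  conv_rhs => rw [← sys.shapeMetric_cometric q p']
  rw [shapeMetric_apply, shapeMetric_apply, metricM_symm]

theorem cometricC_symm (p p' : Vec r →L[ℝ] ℝ) :
    p (sys.cometricC q₀ s₀ x p') = p' (sys.cometricC q₀ s₀ x p) :=
  cometric_symm _ (p.comp _) (p'.comp _)

theorem mem_source_of_mem (hx : x ∈ sys.chartDomain q₀ s₀) :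
    sys.proj ((extChartAt (𝓡 n) q₀).symm x) ∈ (extChartAt (𝓡 r) s₀).source := by
  rw [extChartAt_source]; exact hx.2

theorem projC_mem (hx : x ∈ sys.chartDomain q₀ s₀) :
    sys.projC q₀ s₀ x ∈ (extChartAt (𝓡 r) s₀).target :=
  (extChartAt (𝓡 r) s₀).map_source (mem_source_of_mem hx)

theorem symm_projC (hx : x ∈ sys.chartDomain q₀ s₀) :
    (extChartAt (𝓡 r) s₀).symm (sys.projC q₀ s₀ x) =
      sys.proj ((extChartAt (𝓡 n) q₀).symm x) :=
  (extChartAt (𝓡 r) s₀).left_inv (mem_source_of_mem hx)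

theorem chartDomain_eventually (hx : x ∈ sys.chartDomain q₀ s₀) :
    ∀ᶠ z in 𝓝 x, z ∈ sys.chartDomain q₀ s₀ :=
  (eventually_mem_target hx.1).and (eventually_symm_mem hx.1
    ((chartAt (Vec r) s₀).open_source.preimage sys.proj_smooth.continuous) hx.2)

theorem self_mem_chartDomain (q : Q) : extChartAt (𝓡 n) q q ∈ sys.chartDomain q (sys.proj q) := by
  refine ⟨mem_extChartAt_target q, ?_⟩
  rw [extChartAt_to_inv]
  exact mem_chart_source _ _

theorem contDiffAt_projC (hx : x ∈ sys.chartDomain q₀ s₀) :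
    ContDiffAt ℝ ∞ (sys.projC q₀ s₀) x :=
  contDiffAt_inCharts hx.1 sys.proj_smooth.contMDiffAt hx.2

theorem hasFDerivAt_projC (hx : x ∈ sys.chartDomain q₀ s₀) :
    HasFDerivAt (sys.projC q₀ s₀)
      ((chartD (𝓡 r) s₀ (sys.proj ((extChartAt (𝓡 n) q₀).symm x))).comp
        ((sys.dprojM ((extChartAt (𝓡 n) q₀).symm x)).comp (chartDsymm (𝓡 n) q₀ x))) x :=
  hasFDerivAt_inCharts hx.1 (sys.proj_smooth.mdifferentiable (by simp) _) hx.2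

theorem chartDsymm_chartD_proj (hx : x ∈ sys.chartDomain q₀ s₀) (v : Vec r) :
    chartDsymm (𝓡 r) s₀ (sys.projC q₀ s₀ x)
      (chartD (𝓡 r) s₀ (sys.proj ((extChartAt (𝓡 n) q₀).symm x)) v) = v := by
  rw [← symm_projC hx, chartDsymm_chartD (projC_mem hx)]

theorem chartD_chartDsymm_proj (hx : x ∈ sys.chartDomain q₀ s₀) (v : Vec r) :
    chartD (𝓡 r) s₀ (sys.proj ((extChartAt (𝓡 n) q₀).symm x))
      (chartDsymm (𝓡 r) s₀ (sys.projC q₀ s₀ x) v) = v := by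
  rw [← symm_projC hx, chartD_chartDsymm (projC_mem hx)]

theorem fderiv_projC_apply (hx : x ∈ sys.chartDomain q₀ s₀) (v : Vec n) :
    fderiv ℝ (sys.projC q₀ s₀) x v =
      chartD (𝓡 r) s₀ (sys.proj ((extChartAt (𝓡 n) q₀).symm x))
        (sys.dprojM ((extChartAt (𝓡 n) q₀).symm x) (chartDsymm (𝓡 n) q₀ x v)) := by
  rw [(hasFDerivAt_projC hx).fderiv]; rfl

theorem horC_apply (w : Vec r) : sys.horC q₀ s₀ x w =
    chartD (𝓡 n) q₀ ((extChartAt (𝓡 n) q₀).symm x)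
      (sys.horM ((extChartAt (𝓡 n) q₀).symm x)
        (chartDsymm (𝓡 r) s₀ (sys.projC q₀ s₀ x) w)) := rfl

theorem fderiv_projC_horC (hx : x ∈ sys.chartDomain q₀ s₀) (w : Vec r) :
    fderiv ℝ (sys.projC q₀ s₀) x (sys.horC q₀ s₀ x w) = w := by
  rw [fderiv_projC_apply hx, horC_apply, chartDsymm_chartD hx.1, sys.dprojM_horM,
    chartD_chartDsymm_proj hx]

theorem horC_fderiv_projC (hx : x ∈ sys.chartDomain q₀ s₀) {v : Vec n}
    (hv : v ∈ sys.subD ((extChartAt (𝓡 n) q₀).symm x)) :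
    sys.horC q₀ s₀ x (fderiv ℝ (sys.projC q₀ s₀) x
      (chartD (𝓡 n) q₀ ((extChartAt (𝓡 n) q₀).symm x) v)) =
      chartD (𝓡 n) q₀ ((extChartAt (𝓡 n) q₀).symm x) v := by
  rw [fderiv_projC_apply hx, chartDsymm_chartD hx.1, horC_apply, chartDsymm_chartD_proj hx,
    sys.horM_dprojM _ hv]

/-- The lift inverts T π on D only pointwise. With `eF` a smooth local frame of D and `N` its
projection to S, it equals `eF` composed with the inverse of `N`, and inversion of operators is
smooth. -/
theorem contDiffAt_horC (hx : x ∈ sys.chartDomain q₀ s₀) :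
    ContDiffAt ℝ ∞ (sys.horC q₀ s₀) x := by
  obtain ⟨O, hO, hqO, e, he, hspan⟩ := sys.D_frame ((extChartAt (𝓡 n) q₀).symm x)
  let eF : Vec n → Vec r →L[ℝ] Vec n := fun z =>
    ∑ i, (EuclideanSpace.proj (𝕜 := ℝ) i).smulRight (fieldC (e i) q₀ z)
  have heF : ContDiffAt ℝ ∞ eF x := ContDiffAt.sum fun i _ =>
    (ContinuousLinearMap.smulRightL ℝ (Vec r) (Vec n) (EuclideanSpace.proj i)
      ).contDiff.contDiffAt.comp x
      (contDiffAt_fieldC hx.1 ((he i).contMDiffAt (hO.mem_nhds hqO)))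
  have heF_apply : ∀ z (c : Vec r), eF z c =
      chartD (𝓡 n) q₀ ((extChartAt (𝓡 n) q₀).symm z)
        (∑ i, c i • fieldAt (e i) ((extChartAt (𝓡 n) q₀).symm z)) := by
    intro z c
    simp [eF, fieldC]
  let N : Vec n → Vec r →L[ℝ] Vec r := fun z => (fderiv ℝ (sys.projC q₀ s₀) z).comp (eF z)
  have hN : ContDiffAt ℝ ∞ N x := ((contDiffAt_projC hx).fderiv_right (by simp)).clm_comp heF
  have hgood : ∀ z ∈ sys.chartDomain q₀ s₀, (extChartAt (𝓡 n) q₀).symm z ∈ O →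
      (N z).IsInvertible ∧ sys.horC q₀ s₀ z = (eF z).comp (N z).inverse := by
    intro z hz hzO
    obtain ⟨hli, hsp⟩ := hspan _ hzO
    have h1 : ∀ c, sys.horC q₀ s₀ z (N z c) = eF z c := by
      intro c
      have hmem : (∑ i, c i • fieldAt (e i) ((extChartAt (𝓡 n) q₀).symm z)) ∈
          sys.subD ((extChartAt (𝓡 n) q₀).symm z) := by
        refine Submodule.sum_mem _ fun i _ => Submodule.smul_mem _ _ ?_
        change e i _ ∈ sys.D _
        rw [← hsp]
        exact Submodule.subset_span ⟨i, rfl⟩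
      have := horC_fderiv_projC hz hmem
      rw [← heF_apply] at this
      exact this
    have hinj : Function.Injective (N z).toLinearMap := by
      rw [injective_iff_map_eq_zero]
      intro c hc
      have h2 : eF z c = 0 := by
        rw [← h1, show N z c = 0 from hc, map_zero]
      rw [heF_apply] at h2
      have h3 := congrArg (chartDsymm (𝓡 n) q₀ z) h2
      rw [chartDsymm_chartD hz.1, map_zero] at h3
      ext i
      exact Fintype.linearIndependent_iff.1 hli (fun i => c i) h3 i
    have hinv : (N z).IsInvertible :=
      ⟨(LinearEquiv.ofInjectiveEndo _ hinj).toContinuousLinearEquiv, by ext1 c; rfl⟩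
    refine ⟨hinv, ?_⟩
    have h3 : (sys.horC q₀ s₀ z).comp (N z) = eF z := by ext1 c; exact h1 c
    rw [← h3, ContinuousLinearMap.comp_assoc, hinv.self_comp_inverse,
      ContinuousLinearMap.comp_id]
  have h4 : ContDiffAt ℝ ∞ (fun z => (eF z).comp (N z).inverse) x :=
    heF.clm_comp (contDiffAt_inverse hN (hgood x hx hqO).1)
  refine h4.congr_of_eventuallyEq ?_
  filter_upwards [chartDomain_eventually hx, eventually_symm_mem hx.1 hO hqO] with z hz hzO
  exact (hgood z hz hzO).2

/-- Fields that are constant in the chart are smooth sections near the point, so the bundle metric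
evaluated on them has smooth coefficients. -/
theorem contDiffAt_metricC (hx : x ∈ (extChartAt (𝓡 n) q₀).target) :
    ContDiffAt ℝ ∞ (sys.metricC q₀) x := by
  refine contDiffAt_clm_of_apply fun u => contDiffAt_clm_of_apply fun v => ?_
  have hq : (extChartAt (𝓡 n) q₀).symm x ∈ (chartAt (Vec n) q₀).source := by
    rw [← extChartAt_source (𝓡 n)]; exact (extChartAt (𝓡 n) q₀).map_target hx
  have h1 := ContMDiffAt.clm_bundle_apply₂ (F₃ := ℝ) (E₃ := Bundle.Trivial Q ℝ)
    (sys.metric.contMDiff.contMDiffAt (x := (extChartAt (𝓡 n) q₀).symm x))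
    (contMDiffAt_constField (I := 𝓡 n) hq u) (contMDiffAt_constField (I := 𝓡 n) hq v)
  have h2 : ContMDiffAt (𝓡 n) 𝓘(ℝ, ℝ) ∞ (fun q : Q =>
      sys.metricM q (chartDsymm (𝓡 n) q₀ (extChartAt (𝓡 n) q₀ q) u)
        (chartDsymm (𝓡 n) q₀ (extChartAt (𝓡 n) q₀ q) v)) ((extChartAt (𝓡 n) q₀).symm x) := by
    rw [Bundle.contMDiffAt_totalSpace] at h1
    exact h1.2
  refine (contDiffAt_inChart hx h2).congr_of_eventuallyEq ?_
  filter_upwards [eventually_mem_target hx] with z hz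
  rw [(extChartAt (𝓡 n) q₀).right_inv hz]
  rfl

theorem metricC_chartD (hx : x ∈ (extChartAt (𝓡 n) q₀).target) (u v : Vec n) :
    sys.metricC q₀ x (chartD (𝓡 n) q₀ ((extChartAt (𝓡 n) q₀).symm x) u)
      (chartD (𝓡 n) q₀ ((extChartAt (𝓡 n) q₀).symm x) v) =
        sys.metricM ((extChartAt (𝓡 n) q₀).symm x) u v := by
  change sys.metricM _ (chartDsymm (𝓡 n) q₀ x _) (chartDsymm (𝓡 n) q₀ x _) = _
  rw [chartDsymm_chartD hx, chartDsymm_chartD hx]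

theorem verticalC_apply (hx : x ∈ sys.chartDomain q₀ s₀) (v : Vec n) :
    sys.verticalC q₀ s₀ x v =
      chartD (𝓡 r) s₀ (sys.proj ((extChartAt (𝓡 n) q₀).symm x))
        (sys.dprojM ((extChartAt (𝓡 n) q₀).symm x) (sys.projDM ((extChartAt (𝓡 n) q₀).symm x)
          (chartDsymm (𝓡 n) q₀ x v))) := by
  rw [dprojM_projDM]
  change chartD (𝓡 r) s₀ _ (sys.cometric _ _) = _
  congr 2
  ext w
  change sys.metricM _ (chartDsymm (𝓡 n) q₀ x v) (chartDsymm (𝓡 n) q₀ x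
    (sys.horC q₀ s₀ x (chartD (𝓡 r) s₀ _ w))) = _
  rw [horC_apply, chartDsymm_chartD hx.1, chartDsymm_chartD_proj hx]
  rfl

/-- The metric of the shape space in charts. -/
def shapeMetricC (sys : ChaplyginSystem n r m Q S G) (q₀ : Q) (s₀ : S) (x : Vec n) :
    Vec r →L[ℝ] Vec r →L[ℝ] ℝ :=
  ((ContinuousLinearMap.compL ℝ (Vec r) (Vec n) ℝ).flip (sys.horC q₀ s₀ x)).comp
    ((sys.metricC q₀ x).comp (sys.horC q₀ s₀ x))

theorem shapeMetricC_apply (hx : x ∈ sys.chartDomain q₀ s₀) (u v : Vec r) :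
    sys.shapeMetricC q₀ s₀ x u v = sys.shapeMetric ((extChartAt (𝓡 n) q₀).symm x)
      (chartDsymm (𝓡 r) s₀ (sys.projC q₀ s₀ x) u)
      (chartDsymm (𝓡 r) s₀ (sys.projC q₀ s₀ x) v) := by
  change sys.metricC q₀ x (sys.horC q₀ s₀ x u) (sys.horC q₀ s₀ x v) = _
  rw [horC_apply, horC_apply, metricC_chartD hx.1]
  rfl

theorem shapeMetricC_cometricC (hx : x ∈ sys.chartDomain q₀ s₀) (p : Vec r →L[ℝ] ℝ) :
    sys.shapeMetricC q₀ s₀ x (sys.cometricC q₀ s₀ x p) = p := by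
  ext v
  rw [shapeMetricC_apply hx]
  change sys.shapeMetric _ (chartDsymm (𝓡 r) s₀ (sys.projC q₀ s₀ x)
    (chartD (𝓡 r) s₀ _ (sys.cometric _ (p.comp (chartD (𝓡 r) s₀ _))))) _ = _
  rw [chartDsymm_chartD_proj hx, shapeMetric_cometric, ContinuousLinearMap.comp_apply,
    chartD_chartDsymm_proj hx]

theorem cometricC_shapeMetricC (hx : x ∈ sys.chartDomain q₀ s₀) (v : Vec r) :
    sys.cometricC q₀ s₀ x (sys.shapeMetricC q₀ s₀ x v) = v := by
  change chartD (𝓡 r) s₀ _ (sys.cometric _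
    ((sys.shapeMetricC q₀ s₀ x v).comp (chartD (𝓡 r) s₀ _))) = v
  have h : (sys.shapeMetricC q₀ s₀ x v).comp
      (chartD (𝓡 r) s₀ (sys.proj ((extChartAt (𝓡 n) q₀).symm x))) =
      sys.shapeMetric ((extChartAt (𝓡 n) q₀).symm x)
        (chartDsymm (𝓡 r) s₀ (sys.projC q₀ s₀ x) v) := by
    ext w
    rw [ContinuousLinearMap.comp_apply, shapeMetricC_apply hx, chartDsymm_chartD_proj hx]
  rw [h, cometric_shapeMetric, chartD_chartDsymm_proj hx]

theorem contDiffAt_cometricC (hx : x ∈ sys.chartDomain q₀ s₀) :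
    ContDiffAt ℝ ∞ (sys.cometricC q₀ s₀) x := by
  have hinv : ∀ z ∈ sys.chartDomain q₀ s₀, (sys.shapeMetricC q₀ s₀ z).IsInvertible ∧
      sys.cometricC q₀ s₀ z = (sys.shapeMetricC q₀ s₀ z).inverse := by
    intro z hz
    refine ⟨.of_inverse (g := sys.cometricC q₀ s₀ z) ?_ ?_,
      (ContinuousLinearMap.inverse_eq ?_ ?_).symm⟩
    · ext1 p; exact shapeMetricC_cometricC hz p
    · ext1 v; exact cometricC_shapeMetricC hz v
    · ext1 p; exact shapeMetricC_cometricC hz p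
    · ext1 v; exact cometricC_shapeMetricC hz v
  have h1 : ContDiffAt ℝ ∞ (sys.shapeMetricC q₀ s₀) x :=
    (((ContinuousLinearMap.compL ℝ (Vec r) (Vec n) ℝ).flip.contDiff.contDiffAt.comp x
      (contDiffAt_horC hx))).clm_comp ((contDiffAt_metricC hx.1).clm_comp (contDiffAt_horC hx))
  refine (contDiffAt_inverse h1 (hinv x hx).1).congr_of_eventuallyEq ?_
  filter_upwards [chartDomain_eventually hx] with z hz
  exact (hinv z hz).2

theorem contDiffAt_gyroC (hx : x ∈ sys.chartDomain q₀ s₀) :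
    ContDiffAt ℝ ∞ (sys.gyroC q₀ s₀) x := by
  have h0 := contDiffAt_horC hx
  have h1 : ContDiffAt ℝ ∞ (sys.verticalC q₀ s₀) x :=
    (contDiffAt_cometricC hx).clm_comp
      (((ContinuousLinearMap.compL ℝ (Vec r) (Vec n) ℝ).flip.contDiff.contDiffAt.comp x
        h0).clm_comp (contDiffAt_metricC hx.1))
  have h2 : ContDiffAt ℝ ∞ (fun x => (fderiv ℝ (sys.horC q₀ s₀) x).comp (sys.horC q₀ s₀ x)) x :=
    (h0.fderiv_right (by simp)).clm_comp h0
  have h3 : ContDiffAt ℝ ∞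
      (fun x => ((fderiv ℝ (sys.horC q₀ s₀) x).comp (sys.horC q₀ s₀ x)).flip) x :=
    (ContinuousLinearMap.flipₗᵢ ℝ (Vec r) (Vec r) (Vec n)).contDiff.contDiffAt.comp x h2
  exact ((ContinuousLinearMap.compL ℝ (Vec r) (Vec n) (Vec r)).contDiff.contDiffAt.comp x
    h1).clm_comp (h2.sub h3)

end ChaplyginSystem

/-! ### Differentiability of maps between manifolds, tested in charts. -/

section Maps

variable {E : Type*} [NormedAddCommGroup E] [NormedSpace ℝ E] {H : Type*} [TopologicalSpace H]
  {I : ModelWithCorners ℝ E H} {M : Type*} [TopologicalSpace M] [ChartedSpace H M]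
  [IsManifold I ∞ M] [I.Boundaryless]
  {E' : Type*} [NormedAddCommGroup E'] [NormedSpace ℝ E'] {H' : Type*} [TopologicalSpace H']
  {J : ModelWithCorners ℝ E' H'} [J.Boundaryless]
  {N : Type*} [TopologicalSpace N] [ChartedSpace H' N] [IsManifold J ∞ N]

theorem mdifferentiableAt_of_inChart {f : M → E'} {x : M}
    (hf : DifferentiableAt ℝ (fun y => f ((extChartAt I x).symm y)) (extChartAt I x x)) :
    MDifferentiableAt I 𝓘(ℝ, E') f x := by
  have h1 := hf.mdifferentiableAt.comp x
    (mdifferentiableAt_extChartAt (I := I) (mem_chart_source H x))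
  refine h1.congr_of_eventuallyEq ?_
  filter_upwards [extChartAt_source_mem_nhds (I := I) x] with z hz
  simp only [Function.comp_apply]
  rw [(extChartAt I x).left_inv hz]

theorem mdifferentiableAt_of_inCharts {f : M → N} {x : M} {z₀ : N} {g : E → E'}
    (hg : DifferentiableAt ℝ g (extChartAt I x x))
    (hgz : g (extChartAt I x x) ∈ (extChartAt J z₀).target)
    (hfg : ∀ᶠ y in 𝓝 (extChartAt I x x),
      f ((extChartAt I x).symm y) = (extChartAt J z₀).symm (g y)) :
    MDifferentiableAt I J f x := by
  have h0 : MDifferentiableAt I 𝓘(ℝ, E) (extChartAt I x) x :=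
    mdifferentiableAt_extChartAt (I := I) (mem_chart_source H x)
  have h1 : MDifferentiableAt I 𝓘(ℝ, E') (fun z => g (extChartAt I x z)) x :=
    hg.mdifferentiableAt.comp x h0
  have h2 : MDifferentiableAt 𝓘(ℝ, E') J (extChartAt J z₀).symm (g (extChartAt I x x)) :=
    (contMDiffAt_extChartAt_symm hgz).mdifferentiableAt (by simp)
  refine (MDifferentiableAt.comp x h2 h1).congr_of_eventuallyEq ?_
  filter_upwards [extChartAt_source_mem_nhds (I := I) x,
    (continuousAt_extChartAt (I := I) x).eventually hfg] with z hz hz'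
  rw [(extChartAt I x).left_inv hz] at hz'
  exact hz'

end Maps

namespace ChaplyginSystem

variable {n r m : ℕ} {Q S G : Type*}
    [TopologicalSpace Q] [ChartedSpace (EuclideanSpace ℝ (Fin n)) Q] [IsManifold (𝓡 n) ∞ Q]
    [TopologicalSpace S] [ChartedSpace (EuclideanSpace ℝ (Fin r)) S] [IsManifold (𝓡 r) ∞ S]
    [TopologicalSpace G] [ChartedSpace (EuclideanSpace ℝ (Fin m)) G] [Group G]
    [LieGroup (𝓡 m) ∞ G] [MulAction G Q]

variable {sys : ChaplyginSystem n r m Q S G}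

/-! ### The reduction map in charts -/

variable {γ₀ : CotangentBundle (𝓡 n) Q} {α₀ : CotangentBundle (𝓡 r) S} {x : Vec n}

theorem extChartAt_reduce (hx : x ∈ sys.chartDomain γ₀.proj α₀.proj) (p : Vec n →L[ℝ] ℝ) :
    extChartAt (cotangentModel (𝓡 r)) α₀
        (sys.reduce ((extChartAt (cotangentModel (𝓡 n)) γ₀).symm (x, p))) =
      modelReduce (sys.projC γ₀.proj α₀.proj) (sys.horC γ₀.proj α₀.proj) (x, p) := by
  rw [extChartAt_cotangent_symm γ₀ hx.1, reduce_eq, extChartAt_cotangent_apply]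
  · rfl
  · exact hx.2

theorem reduce_symm (hx : x ∈ sys.chartDomain γ₀.proj α₀.proj) (p : Vec n →L[ℝ] ℝ) :
    sys.reduce ((extChartAt (cotangentModel (𝓡 n)) γ₀).symm (x, p)) =
      (extChartAt (cotangentModel (𝓡 r)) α₀).symm
        (modelReduce (sys.projC γ₀.proj α₀.proj) (sys.horC γ₀.proj α₀.proj) (x, p)) := by
  rw [← extChartAt_reduce hx]
  refine ((extChartAt (cotangentModel (𝓡 r)) α₀).left_inv ((mem_cotangent_source _ _).2 ?_)).symm
  rw [extChartAt_cotangent_symm γ₀ hx.1]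
  exact hx.2

/-- The reduced Hamiltonian in a chart. -/
def hamiltonianC (sys : ChaplyginSystem n r m Q S G) (α₀ : CotangentBundle (𝓡 r) S)
    (w : Vec r × (Vec r →L[ℝ] ℝ)) : ℝ :=
  sys.reducedHamiltonian ((extChartAt (cotangentModel (𝓡 r)) α₀).symm w)

/-- The potential in a chart. -/
def potentialC (sys : ChaplyginSystem n r m Q S G) (q₀ : Q) (x : Vec n) : ℝ :=
  sys.potential ((extChartAt (𝓡 n) q₀).symm x)

theorem hamiltonianC_eq {q₀ : Q} (hx : x ∈ sys.chartDomain q₀ α₀.proj) (p : Vec r →L[ℝ] ℝ) :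
    sys.hamiltonianC α₀ (sys.projC q₀ α₀.proj x, p) =
      (1 / 2 : ℝ) * p (sys.cometricC q₀ α₀.proj x p) + sys.potentialC q₀ x := by
  rw [hamiltonianC, extChartAt_cotangent_symm α₀ (projC_mem hx), symm_projC hx,
    reducedHamiltonian_covector]
  rfl

theorem exists_section {q₀ : Q} {s₀ : S} (hx : x ∈ sys.chartDomain q₀ s₀) :
    ∃ σ : Vec r → Vec n, ContDiffAt ℝ ∞ σ (sys.projC q₀ s₀ x) ∧ σ (sys.projC q₀ s₀ x) = x ∧
      ∀ᶠ y in 𝓝 (sys.projC q₀ s₀ x), σ y ∈ sys.chartDomain q₀ s₀ ∧ sys.projC q₀ s₀ (σ y) = y := by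
  obtain ⟨σ, h1, h2, h3⟩ := exists_local_section (contDiffAt_projC hx)
    (fun w => ⟨_, fderiv_projC_horC hx w⟩)
  refine ⟨σ, h1, h2, Filter.Eventually.and ?_ h3⟩
  refine h1.continuousAt.eventually ?_
  rw [h2]
  exact chartDomain_eventually hx

/-- Composition with a local section of π makes the coefficients functions of the shape variable
alone, so that the Hamiltonian can be differentiated on S. -/
theorem hamiltonianC_eventuallyEq {q₀ : Q} {σ : Vec r → Vec n} {y : Vec r}
    (hσ : ∀ᶠ y in 𝓝 y, σ y ∈ sys.chartDomain q₀ α₀.proj ∧ sys.projC q₀ α₀.proj (σ y) = y)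
    (p : Vec r →L[ℝ] ℝ) :
    sys.hamiltonianC α₀ =ᶠ[𝓝 (y, p)] modelHamiltonian
      (fun y => sys.cometricC q₀ α₀.proj (σ y)) (fun y => sys.potentialC q₀ (σ y)) := by
  have h : ∀ᶠ w in 𝓝 (y, p), σ w.1 ∈ sys.chartDomain q₀ α₀.proj ∧
      sys.projC q₀ α₀.proj (σ w.1) = w.1 := (continuousAt_fst (p := (y, p))).eventually hσ
  filter_upwards [h] with w hw
  have h2 := hamiltonianC_eq hw.1 w.2
  rw [hw.2] at h2
  exact h2

theorem contDiffAt_potentialC {q₀ : Q} (hx : x ∈ (extChartAt (𝓡 n) q₀).target) :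
    ContDiffAt ℝ ∞ (sys.potentialC q₀) x :=
  contDiffAt_inChart hx sys.potential_smooth.contMDiffAt

theorem fderiv_hamiltonianC {q₀ : Q} (hx : x ∈ sys.chartDomain q₀ α₀.proj) (p : Vec r →L[ℝ] ℝ) :
    DifferentiableAt ℝ (sys.hamiltonianC α₀) (sys.projC q₀ α₀.proj x, p) ∧
      ∀ p', fderiv ℝ (sys.hamiltonianC α₀) (sys.projC q₀ α₀.proj x, p) (0, p') =
        p' (sys.cometricC q₀ α₀.proj x p) := by
  obtain ⟨σ, h1, h2, h3⟩ := exists_section hx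
  have hev := hamiltonianC_eventuallyEq h3 p
  have hK : ContDiffAt ℝ ∞ (fun y => sys.cometricC q₀ α₀.proj (σ y)) (sys.projC q₀ α₀.proj x) :=
    ContDiffAt.comp (g := sys.cometricC q₀ α₀.proj) _ (by rw [h2]; exact contDiffAt_cometricC hx) h1
  have hU : ContDiffAt ℝ ∞ (fun y => sys.potentialC q₀ (σ y)) (sys.projC q₀ α₀.proj x) :=
    ContDiffAt.comp (g := sys.potentialC q₀) _ (by rw [h2]; exact contDiffAt_potentialC hx.1) h1
  obtain ⟨h4, h5⟩ := hasFDerivAt_modelHamiltonian (w := (sys.projC q₀ α₀.proj x, p))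
    (hK.differentiableAt (by simp)) (hU.differentiableAt (by simp)) (fun p q => cometricC_symm p q)
  refine ⟨h4.congr_of_eventuallyEq hev, fun p' => ?_⟩
  rw [hev.fderiv_eq, h5]
  simp [h2]

theorem mdifferentiableAt_reducedHamiltonian (sys : ChaplyginSystem n r m Q S G)
    (α : CotangentBundle (𝓡 r) S) :
    MDifferentiableAt (cotangentModel (𝓡 r)) 𝓘(ℝ, ℝ) sys.reducedHamiltonian α := by
  obtain ⟨q, hq⟩ := sys.proj_surjective α.proj
  have hx := sys.self_mem_chartDomain q
  rw [hq] at hx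
  have h := (fderiv_hamiltonianC (α₀ := α) hx (momentum α)).1
  have h2 : (sys.projC q α.proj (extChartAt (𝓡 n) q q), momentum α) =
      extChartAt (cotangentModel (𝓡 r)) α α := by
    rw [extChartAt_cotangent_self, projC, extChartAt_to_inv, hq]
  rw [h2] at h
  exact mdifferentiableAt_of_inChart h

theorem mdifferentiableAt_reduce (sys : ChaplyginSystem n r m Q S G)
    (β : CotangentBundle (𝓡 n) Q) :
    MDifferentiableAt (cotangentModel (𝓡 n)) (cotangentModel (𝓡 r)) sys.reduce β := by
  have hx : extChartAt (𝓡 n) β.proj β.proj ∈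
      sys.chartDomain β.proj (sys.reduce β).proj := sys.self_mem_chartDomain β.proj
  have hev : ∀ᶠ w in 𝓝 (extChartAt (cotangentModel (𝓡 n)) β β),
      w.1 ∈ sys.chartDomain β.proj (sys.reduce β).proj := by
    rw [extChartAt_cotangent_self]
    exact continuousAt_fst.eventually (chartDomain_eventually hx)
  refine mdifferentiableAt_of_inCharts (z₀ := sys.reduce β)
    (g := modelReduce (sys.projC β.proj (sys.reduce β).proj)
      (sys.horC β.proj (sys.reduce β).proj)) ?_ ?_ ?_
  · rw [extChartAt_cotangent_self]
    exact (hasFDerivAt_modelReduce ((contDiffAt_projC hx).differentiableAt (by simp))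
      ((contDiffAt_horC hx).differentiableAt (by simp))).1
  · rw [extChartAt_cotangent_self]
    exact mem_cotangent_target _ (projC_mem hx)
  · filter_upwards [hev] with w hw
    exact reduce_symm hw w.2

theorem horC_verticalC {q₀ : Q} {s₀ : S} (hx : x ∈ sys.chartDomain q₀ s₀) (v : Vec n) :
    sys.horC q₀ s₀ x (sys.verticalC q₀ s₀ x v) =
      chartD (𝓡 n) q₀ ((extChartAt (𝓡 n) q₀).symm x)
        (sys.projDM ((extChartAt (𝓡 n) q₀).symm x) (chartDsymm (𝓡 n) q₀ x v)) := by
  rw [verticalC_apply hx, horC_apply, chartDsymm_chartD_proj hx,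
    sys.horM_dprojM _ (sys.projDM_mem _ _)]

/-- `W` is the value at `β` of the Hamiltonian vector field of the constrained Hamiltonian. -/
def IsHamiltonianVector (sys : ChaplyginSystem n r m Q S G) (β : CotangentBundle (𝓡 n) Q)
    (W : Vec n × (Vec n →L[ℝ] ℝ)) : Prop :=
  ∀ V, formAt (cotangentModel (𝓡 n)) (canonicalForm (𝓡 n) Q) β ![W, V] =
    modelVD (cotangentModel (𝓡 n)) (fun γ => sys.hamiltonian (sys.constrain γ)) β V

/-- The value at `reduce β` of the reduced vector field, in charts. -/
theorem chartD_modelD_reduce {β : CotangentBundle (𝓡 n) Q} (hβ : sys.constrain β = β)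
    (hβγ : β.proj ∈ (chartAt (Vec n) γ₀.proj).source)
    (hβα : sys.proj β.proj ∈ (chartAt (Vec r) α₀.proj).source)
    {W : Vec n × (Vec n →L[ℝ] ℝ)} (hW : sys.IsHamiltonianVector β W)
    (hx : extChartAt (𝓡 n) γ₀.proj β.proj = x)
    {z : Vec r × (Vec r →L[ℝ] ℝ)}
    (hz : extChartAt (cotangentModel (𝓡 r)) α₀ (sys.reduce β) = z) :
    (chartD (cotangentModel (𝓡 r)) α₀ (sys.reduce β)
        (modelD (cotangentModel (𝓡 n)) (cotangentModel (𝓡 r)) sys.reduce β W)).1 =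
      sys.cometricC γ₀.proj α₀.proj x z.2 ∧
    ∀ u, (chartD (cotangentModel (𝓡 r)) α₀ (sys.reduce β)
        (modelD (cotangentModel (𝓡 n)) (cotangentModel (𝓡 r)) sys.reduce β W)).2 u =
      -fderiv ℝ (sys.hamiltonianC α₀) z (u, 0) -
        z.2 (sys.gyroC γ₀.proj α₀.proj x u (sys.cometricC γ₀.proj α₀.proj x z.2)) := by
  have hβs : β ∈ (extChartAt (cotangentModel (𝓡 n)) γ₀).source := (mem_cotangent_source _ _).2 hβγ
  have hsx : (extChartAt (𝓡 n) γ₀.proj).symm x = β.proj := by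
    rw [← hx]; exact (extChartAt (𝓡 n) γ₀.proj).left_inv (by rwa [extChartAt_source])
  have hxd : x ∈ sys.chartDomain γ₀.proj α₀.proj := by
    refine ⟨?_, by rwa [hsx]⟩
    rw [← hx]
    exact (extChartAt (𝓡 n) γ₀.proj).map_source (by rwa [extChartAt_source])
  obtain ⟨w, hw⟩ : ∃ w, w = extChartAt (cotangentModel (𝓡 n)) γ₀ β := ⟨_, rfl⟩
  have hsw : (extChartAt (cotangentModel (𝓡 n)) γ₀).symm w = β := by
    rw [hw]; exact (extChartAt (cotangentModel (𝓡 n)) γ₀).left_inv hβs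
  have hwt : w ∈ (extChartAt (cotangentModel (𝓡 n)) γ₀).target := by
    rw [hw]; exact (extChartAt (cotangentModel (𝓡 n)) γ₀).map_source hβs
  have hw' := hw
  rw [extChartAt_cotangent_apply _ _ hβγ, hx] at hw'
  have hw1 : w.1 = x := by rw [hw']
  have hw2 : w.2 = (momentum β).comp (chartDsymm (𝓡 n) γ₀.proj x) := by rw [hw']
  have hxd' : w.1 ∈ sys.chartDomain γ₀.proj α₀.proj := by rwa [hw1]
  have hwev : ∀ᶠ w in 𝓝 w, w.1 ∈ sys.chartDomain γ₀.proj α₀.proj :=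
    continuousAt_fst.eventually (chartDomain_eventually hxd')
  set f := sys.projC γ₀.proj α₀.proj with hf
  set h := sys.horC γ₀.proj α₀.proj with hh
  have hzw : modelReduce f h w = z := by
    rw [← hz, ← hsw]; exact (extChartAt_reduce hxd' w.2).symm
  have hD : fderiv ℝ (modelReduce f h) w (chartD (cotangentModel (𝓡 n)) γ₀ β W) =
      chartD (cotangentModel (𝓡 r)) α₀ (sys.reduce β)
        (modelD (cotangentModel (𝓡 n)) (cotangentModel (𝓡 r)) sys.reduce β W) := by
    have h1 := hasFDerivAt_inCharts (I := cotangentModel (𝓡 n)) (J := cotangentModel (𝓡 r))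
      (z₀ := α₀) hwt (sys.mdifferentiableAt_reduce _)
      ((by rw [hsw, ← extChartAt_source (cotangentModel (𝓡 r)), mem_cotangent_source]; exact hβα))
    have h2 : modelReduce f h =ᶠ[𝓝 w] fun w => extChartAt (cotangentModel (𝓡 r)) α₀
        (sys.reduce ((extChartAt (cotangentModel (𝓡 n)) γ₀).symm w)) := by
      filter_upwards [hwev] with v hv
      exact (extChartAt_reduce hv v.2).symm
    rw [h2.fderiv_eq, h1.fderiv, hsw, ContinuousLinearMap.comp_apply,
      ContinuousLinearMap.comp_apply]
    have h3 := chartDsymm_chartD hwt W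
    rw [hsw] at h3
    rw [h3]
  have hHam : ∀ b, modelCanonical (Vec n) ![chartD (cotangentModel (𝓡 n)) γ₀ β W, b] =
      fderiv ℝ (fun w => sys.hamiltonianC α₀ (modelReduce f h w)) w b := by
    intro b
    have h1 : MDifferentiableAt (cotangentModel (𝓡 n)) 𝓘(ℝ, ℝ)
        (fun γ => sys.hamiltonian (sys.constrain γ))
        ((extChartAt (cotangentModel (𝓡 n)) γ₀).symm w) := by
      rw [hsw]
      refine ((sys.mdifferentiableAt_reducedHamiltonian (sys.reduce β)).comp β
        (sys.mdifferentiableAt_reduce β)).congr_of_eventuallyEq (Filter.Eventually.of_forall ?_)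
      exact fun γ => (sys.reducedHamiltonian_reduce γ).symm
    have h2 := hasFDerivAt_inChart hwt h1
    have h3 : (fun w => sys.hamiltonianC α₀ (modelReduce f h w)) =ᶠ[𝓝 w] fun w =>
        sys.hamiltonian (sys.constrain ((extChartAt (cotangentModel (𝓡 n)) γ₀).symm w)) := by
      filter_upwards [hwev] with v hv
      rw [← sys.reducedHamiltonian_reduce, hamiltonianC, ← reduce_symm hv v.2]
    rw [h3.fderiv_eq, h2.fderiv, hsw, ContinuousLinearMap.comp_apply, ← hW,
      canonicalForm_apply γ₀ β hβγ]
    have h4 := chartD_chartDsymm hwt b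
    rw [hsw] at h4
    rw [h4]
  obtain ⟨hH1, hH2⟩ := fderiv_hamiltonianC hxd' (w.2.comp (h w.1))
  obtain ⟨hR1, hR2⟩ := fderiv_modelReduce_hamiltonian
    ((contDiffAt_projC hxd').differentiableAt (by simp))
    ((contDiffAt_horC hxd').differentiableAt (by simp)) (fun u => fderiv_projC_horC hxd' u)
    hH1 hH2 hHam
  rw [hD] at hR1 hR2
  have hz2 : z.2 = w.2.comp (h x) := by rw [← hzw, ← hw1]; rfl
  rw [hw1, ← hz2] at hR1
  refine ⟨hR1, fun u => ?_⟩
  -- The extra term is the momentum of `β` on a bracket of lifts. As `β` is constrained, its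
  -- momentum is unchanged by 𝒫, so the bracket may be replaced by its projection to D, which is the
  -- lift of `gyroC`.
  rw [hR2, hzw, hw1, ← hz2, gyroC_apply, hz2, ContinuousLinearMap.comp_apply w.2 (h x),
    horC_verticalC hxd, hw2, ContinuousLinearMap.comp_apply, ContinuousLinearMap.comp_apply,
    chartDsymm_chartD hxd.1, hsx, sys.momentum_projDM hβ]

end ChaplyginSystem

namespace ChaplyginSystem

variable {n r m : ℕ} {Q S G : Type*}
    [TopologicalSpace Q] [ChartedSpace (EuclideanSpace ℝ (Fin n)) Q] [IsManifold (𝓡 n) ∞ Q]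
    [TopologicalSpace S] [ChartedSpace (EuclideanSpace ℝ (Fin r)) S] [IsManifold (𝓡 r) ∞ S]
    [TopologicalSpace G] [ChartedSpace (EuclideanSpace ℝ (Fin m)) G] [Group G]
    [LieGroup (𝓡 m) ∞ G] [MulAction G Q]

variable {sys : ChaplyginSystem n r m Q S G}

/-! ### The gyroscopic tensor in charts -/

/-- The gyroscopic tensor, with values in the model space. -/
def gyroAt (sys : ChaplyginSystem n r m Q S G) (Y Z : VField (𝓡 r) S) (q : Q) : Vec r :=
  sys.gyro Y Z q

theorem gyroAt_eq_bracketAt (Y Z : VField (𝓡 r) S) (q : Q) :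
    sys.gyroAt Y Z q = sys.dprojM q (sys.projDM q (bracketAt (sys.horLift Y) (sys.horLift Z) q))
      - bracketAt Y Z (sys.proj q) := rfl

theorem fieldC_horLift (Y : VField (𝓡 r) S) {q₀ : Q} {s₀ : S} {x : Vec n}
    (hx : x ∈ sys.chartDomain q₀ s₀) :
    fieldC (sys.horLift Y) q₀ x = sys.horC q₀ s₀ x (fieldC Y s₀ (sys.projC q₀ s₀ x)) := by
  rw [fieldC, fieldC, horC_apply, symm_projC hx, chartDsymm_chartD_proj hx]
  rfl

theorem verticalC_horC {q₀ : Q} {s₀ : S} {x : Vec n} (hx : x ∈ sys.chartDomain q₀ s₀)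
    (w : Vec r) : sys.verticalC q₀ s₀ x (sys.horC q₀ s₀ x w) = w := by
  rw [verticalC_apply hx, horC_apply, chartDsymm_chartD hx.1,
    sys.projDM_of_mem _ (sys.horM_mem _ _), sys.dprojM_horM, chartD_chartDsymm_proj hx]

/-- The derivatives of `Y` and `Z` enter the bracket of the lifts only as the lift of [Y, Z], which
cancels the subtracted bracket. What remains is bilinear in the values: the gyroscopic tensor is a
tensor. -/
theorem gyroAt_eq {Y Z : VField (𝓡 r) S} (hY : IsSmoothVField Y) (hZ : IsSmoothVField Z) (q : Q) :
    sys.gyroAt Y Z q = sys.gyroC q (sys.proj q) (extChartAt (𝓡 n) q q)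
      (fieldAt Y (sys.proj q)) (fieldAt Z (sys.proj q)) := by
  have hx := sys.self_mem_chartDomain q
  set s := sys.proj q with hs
  obtain ⟨x, hxq⟩ : ∃ x, x = extChartAt (𝓡 n) q q := ⟨_, rfl⟩
  have hsx : (extChartAt (𝓡 n) q).symm x = q := by rw [hxq, extChartAt_to_inv]
  rw [← hxq] at hx ⊢
  have hy : sys.projC q s x = extChartAt (𝓡 r) s s := by rw [projC, hsx]
  have hdiff : ∀ {Y : VField (𝓡 r) S}, IsSmoothVField Y →
      DifferentiableAt ℝ (fieldC Y s) (extChartAt (𝓡 r) s s) := fun hY =>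
    (contDiffAt_fieldC (mem_extChartAt_target s) hY.contMDiffAt).differentiableAt (by simp)
  have hval : ∀ Y : VField (𝓡 r) S,
      fieldC (sys.horLift Y) q x = sys.horC q s x (fieldAt Y s) := fun Y => by
    rw [fieldC_horLift Y hx, hy, fieldC_self]
  have hder : ∀ {Y : VField (𝓡 r) S}, IsSmoothVField Y → ∀ u,
      fderiv ℝ (fieldC (sys.horLift Y) q) x (sys.horC q s x u) =
        fderiv ℝ (sys.horC q s) x (sys.horC q s x u) (fieldAt Y s) +
          sys.horC q s x (fderiv ℝ (fieldC Y s) (extChartAt (𝓡 r) s s) u) := by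
    intro Y hY u
    have h1 : fieldC (sys.horLift Y) q =ᶠ[𝓝 x] fun z =>
        sys.horC q s z (fieldC Y s (sys.projC q s z)) := by
      filter_upwards [chartDomain_eventually hx] with z hz
      exact fieldC_horLift Y hz
    have h2 : HasFDerivAt (sys.horC q s) _ x :=
      ((contDiffAt_horC hx).differentiableAt (by simp)).hasFDerivAt
    have h3 : HasFDerivAt (sys.projC q s) _ x :=
      ((contDiffAt_projC hx).differentiableAt (by simp)).hasFDerivAt
    have h4 : HasFDerivAt (fieldC Y s) (fderiv ℝ (fieldC Y s) (extChartAt (𝓡 r) s s))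
        (sys.projC q s x) := by rw [hy]; exact (hdiff hY).hasFDerivAt
    have h6 : HasFDerivAt (fun z => sys.horC q s z (fieldC Y s (sys.projC q s z))) _ x :=
      h2.clm_apply (h4.comp x h3)
    rw [h1.fderiv_eq, h6.fderiv, hy, fieldC_self]
    simp [fderiv_projC_horC hx, add_comm]
  have hvert : ∀ v, sys.dprojM q (sys.projDM q v) = sys.verticalC q s x v := by
    intro v
    rw [verticalC_apply hx, hsx, hxq, chartDsymm_self, ← hs, chartD_self]
    rfl
  rw [gyroAt_eq_bracketAt, bracketAt_eq, bracketAt_eq, ← hxq, hval, hval, hder hZ, hder hY,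
    ← hs, fieldC_self, fieldC_self, hvert, gyroC_apply]
  have h5 : ∀ a b c d : Vec n, a + b - (c + d) = (a - c) + (b - d) := fun a b c d => by abel
  rw [h5, map_add, ← map_sub (sys.horC q s x), verticalC_horC hx, add_sub_cancel_right]

/-! ### Equivariance in charts -/

section Equivariance

variable {q₀ q₁ : Q} {s₀ : S} {x : Vec n} {g : G}

theorem mem_chartDomain_smul (hx : x ∈ sys.chartDomain q₀ s₀)
    (hg : g • (extChartAt (𝓡 n) q₀).symm x ∈ (chartAt (Vec n) q₁).source) :
    extChartAt (𝓡 n) q₁ (g • (extChartAt (𝓡 n) q₀).symm x) ∈ sys.chartDomain q₁ s₀ ∧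
      (extChartAt (𝓡 n) q₁).symm (extChartAt (𝓡 n) q₁ (g • (extChartAt (𝓡 n) q₀).symm x)) =
        g • (extChartAt (𝓡 n) q₀).symm x := by
  rw [← extChartAt_source (𝓡 n)] at hg
  have h := (extChartAt (𝓡 n) q₁).left_inv hg
  refine ⟨⟨(extChartAt (𝓡 n) q₁).map_source hg, ?_⟩, h⟩
  rw [h, sys.proj_smul]
  exact hx.2

theorem cometricC_smul (hx : x ∈ sys.chartDomain q₀ s₀)
    (hg : g • (extChartAt (𝓡 n) q₀).symm x ∈ (chartAt (Vec n) q₁).source) :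
    sys.cometricC q₁ s₀ (extChartAt (𝓡 n) q₁ (g • (extChartAt (𝓡 n) q₀).symm x)) =
      sys.cometricC q₀ s₀ x := by
  rw [cometricC, cometricC, (mem_chartDomain_smul hx hg).2, sys.proj_smul, sys.cometric_smul]

/-- The lift at the translated point is the image of the lift under the derivative of `f`, the
action of `g` in charts. Differentiating it produces a second derivative of `f`, which is symmetric
and disappears on antisymmetrisation. -/
theorem gyroC_smul (hx : x ∈ sys.chartDomain q₀ s₀)
    (hg : g • (extChartAt (𝓡 n) q₀).symm x ∈ (chartAt (Vec n) q₁).source) :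
    sys.gyroC q₁ s₀ (extChartAt (𝓡 n) q₁ (g • (extChartAt (𝓡 n) q₀).symm x)) =
      sys.gyroC q₀ s₀ x := by
  let f : Vec n → Vec n := fun z => extChartAt (𝓡 n) q₁ (g • (extChartAt (𝓡 n) q₀).symm z)
  have hmem : ∀ᶠ z in 𝓝 x, z ∈ sys.chartDomain q₀ s₀ ∧
      g • (extChartAt (𝓡 n) q₀).symm z ∈ (chartAt (Vec n) q₁).source :=
    (chartDomain_eventually hx).and (eventually_symm_mem hx.1
      ((chartAt (Vec n) q₁).open_source.preimage (sys.contMDiff_smul g).continuous) hg)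
  have hfd : ∀ z ∈ sys.chartDomain q₀ s₀,
      g • (extChartAt (𝓡 n) q₀).symm z ∈ (chartAt (Vec n) q₁).source → ∀ v, fderiv ℝ f z v =
        chartD (𝓡 n) q₁ (g • (extChartAt (𝓡 n) q₀).symm z)
          (sys.actM g ((extChartAt (𝓡 n) q₀).symm z) (chartDsymm (𝓡 n) q₀ z v)) := by
    intro z hz hzg v
    have h1 := hasFDerivAt_inCharts hz.1 ((sys.contMDiff_smul g).mdifferentiable (by simp) _) hzg
    rw [h1.fderiv]
    rfl
  have hfs : ContDiffAt ℝ ∞ f x := contDiffAt_inCharts hx.1 (sys.contMDiff_smul g).contMDiffAt hg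
  obtain ⟨hfx, hfx'⟩ := mem_chartDomain_smul hx hg
  have hproj : ∀ z, sys.chartDomain q₀ s₀ z → g • (extChartAt (𝓡 n) q₀).symm z ∈
      (chartAt (Vec n) q₁).source → sys.projC q₁ s₀ (f z) = sys.projC q₀ s₀ z := by
    intro z hz hzg
    rw [projC, (mem_chartDomain_smul hz hzg).2, sys.proj_smul, projC]
  have hhor : ∀ z, z ∈ sys.chartDomain q₀ s₀ → g • (extChartAt (𝓡 n) q₀).symm z ∈
      (chartAt (Vec n) q₁).source → ∀ w, sys.horC q₁ s₀ (f z) w =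
        fderiv ℝ f z (sys.horC q₀ s₀ z w) := by
    intro z hz hzg w
    rw [horC_apply, (mem_chartDomain_smul hz hzg).2, hproj z hz hzg, hfd z hz hzg, horC_apply,
      chartDsymm_chartD hz.1, sys.actM_horM]
  have hvert : ∀ v, sys.verticalC q₁ s₀ (f x) (fderiv ℝ f x v) = sys.verticalC q₀ s₀ x v := by
    intro v
    rw [verticalC_apply hfx, hfx', hfd x hx hg]
    have h1 := chartDsymm_chartD hfx.1
      (sys.actM g ((extChartAt (𝓡 n) q₀).symm x) (chartDsymm (𝓡 n) q₀ x v))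
    rw [hfx'] at h1
    rw [h1, sys.dprojM_projDM_actM, sys.proj_smul, verticalC_apply hx]
  have hsymm := hfs.isSymmSndFDerivAt (n := ∞) (by simpa using two_le_infty)
  have hder : ∀ u v, fderiv ℝ (sys.horC q₁ s₀) (f x) (sys.horC q₁ s₀ (f x) u) v =
      fderiv ℝ (fderiv ℝ f) x (sys.horC q₀ s₀ x u) (sys.horC q₀ s₀ x v) +
        fderiv ℝ f x (fderiv ℝ (sys.horC q₀ s₀) x (sys.horC q₀ s₀ x u) v) := by
    intro u v
    have h1 : (fun z => sys.horC q₁ s₀ (f z) v) =ᶠ[𝓝 x] fun z =>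
        fderiv ℝ f z (sys.horC q₀ s₀ z v) := by
      filter_upwards [hmem] with z hz
      exact hhor z hz.1 hz.2 v
    have h2 : HasFDerivAt (sys.horC q₀ s₀) _ x :=
      ((contDiffAt_horC hx).differentiableAt (by simp)).hasFDerivAt
    have h3 : HasFDerivAt (sys.horC q₁ s₀) _ (f x) :=
      ((contDiffAt_horC hfx).differentiableAt (by simp)).hasFDerivAt
    have h4 : HasFDerivAt f _ x := (hfs.differentiableAt (by simp)).hasFDerivAt
    have h5 : HasFDerivAt (fderiv ℝ f) _ x :=
      ((hfs.fderiv_right (m := ∞) (by simp)).differentiableAt (by simp)).hasFDerivAt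
    have h6 := ((h3.comp x h4).clm_apply (hasFDerivAt_const v x)).congr_of_eventuallyEq h1.symm
    have h7 := h5.clm_apply (h2.clm_apply (hasFDerivAt_const v x))
    have h8 := DFunLike.congr_fun (h6.unique h7) (sys.horC q₀ s₀ x u)
    simp [← hhor x hx hg] at h8
    exact h8.trans (add_comm _ _)
  change sys.gyroC q₁ s₀ (f x) = _
  ext1 u
  ext1 v
  rw [gyroC_apply, gyroC_apply, hder, hder, hsymm.eq (sys.horC q₀ s₀ x u) (sys.horC q₀ s₀ x v),
    add_sub_add_left_eq_sub, ← map_sub, hvert]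

end Equivariance

/-! ### The reduced vector field -/

/-- The witness is (∂h/∂p, -∂h/∂x), the functional ∂h/∂p on the dual space being represented by a
vector through the standard basis. -/
theorem exists_isHamiltonianVector (sys : ChaplyginSystem n r m Q S G)
    (β : CotangentBundle (𝓡 n) Q) : ∃ W, sys.IsHamiltonianVector β W := by
  let L : Vec n × (Vec n →L[ℝ] ℝ) →L[ℝ] ℝ :=
    modelVD (cotangentModel (𝓡 n)) (fun γ => sys.hamiltonian (sys.constrain γ)) β
  refine ⟨(∑ i, L (0, EuclideanSpace.proj i) • EuclideanSpace.single i (1 : ℝ),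
    -L.comp (ContinuousLinearMap.inl ℝ (Vec n) (Vec n →L[ℝ] ℝ))), fun V => ?_⟩
  rw [canonicalForm_apply_self]
  change _ = L V
  have h1 : V.2 = ∑ i, V.2 (EuclideanSpace.single i (1 : ℝ)) • EuclideanSpace.proj (𝕜 := ℝ) i := by
    ext v
    conv_lhs => rw [← (EuclideanSpace.basisFun (Fin n) ℝ).sum_repr v]
    simp [mul_comm]
  have h2 : L (0, V.2) = ∑ i, L (0, EuclideanSpace.proj i) * V.2 (EuclideanSpace.single i 1) := by
    have h3 := congrArg (fun q => L.comp (ContinuousLinearMap.inr ℝ (Vec n) (Vec n →L[ℝ] ℝ)) q) h1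
    simp only [map_sum, map_smul] at h3
    refine h3.trans (Finset.sum_congr rfl fun i _ => ?_)
    rw [smul_eq_mul, mul_comm]
    rfl
  have h4 : L V = L (V.1, 0) + L (0, V.2) := by rw [← map_add]; simp
  rw [h4, h2, map_sum, add_comm]
  simp

/-- The two base points lie in one orbit. In the chart at the common reduced point, the push-forward
involves only the reduced Hamiltonian, the cometric and the gyroscopic tensor, and the latter two
are G-invariant. -/
theorem modelD_reduce_unique {β β' : CotangentBundle (𝓡 n) Q} (hβ : sys.constrain β = β)
    (hβ' : sys.constrain β' = β') (h : sys.reduce β = sys.reduce β')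
    {W W' : Vec n × (Vec n →L[ℝ] ℝ)} (hW : sys.IsHamiltonianVector β W)
    (hW' : sys.IsHamiltonianVector β' W') :
    modelD (cotangentModel (𝓡 n)) (cotangentModel (𝓡 r)) sys.reduce β W =
      modelD (cotangentModel (𝓡 n)) (cotangentModel (𝓡 r)) sys.reduce β' W' := by
  have hproj : sys.proj β.proj = sys.proj β'.proj := congrArg Bundle.TotalSpace.proj h
  obtain ⟨g, hg⟩ := (sys.proj_fibre _ _).1 hproj
  obtain ⟨α₀, hα⟩ : ∃ α₀, α₀ = sys.reduce β := ⟨_, rfl⟩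
  have hα' : α₀ = sys.reduce β' := hα.trans h
  have hs : sys.proj β.proj = α₀.proj := by rw [hα]; rfl
  have h1 := chartD_modelD_reduce (γ₀ := β) (α₀ := α₀) hβ (mem_chart_source _ _)
    (by rw [hs]; exact mem_chart_source _ _) hW rfl rfl
  have h2 := chartD_modelD_reduce (γ₀ := β') (α₀ := α₀) hβ' (mem_chart_source _ _)
    (by rw [← hproj, hs]; exact mem_chart_source _ _) hW' rfl rfl
  rw [← hα', chartD_self] at h2
  rw [← hα, chartD_self] at h1
  have hx : extChartAt (𝓡 n) β.proj β.proj ∈ sys.chartDomain β.proj α₀.proj := by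
    rw [← hs]; exact sys.self_mem_chartDomain β.proj
  have hgs : g • (extChartAt (𝓡 n) β.proj).symm (extChartAt (𝓡 n) β.proj β.proj) ∈
      (chartAt (Vec n) β'.proj).source := by
    rw [extChartAt_to_inv, hg]; exact mem_chart_source _ _
  have h3 := cometricC_smul hx hgs
  have h4 := gyroC_smul hx hgs
  rw [extChartAt_to_inv, hg] at h3 h4
  rw [h3, h4] at h2
  refine Prod.ext (h1.1.trans h2.1.symm) ?_
  ext u
  exact (h1.2 u).trans (h2.2 u).symm

/-- `reducedField` is an `epsilon`, meaningful only once a solution exists. One is built from a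
chosen constrained covector over each point of T*S; independence of the choice validates it at all
the others. -/
theorem isReducedField_reducedField (sys : ChaplyginSystem n r m Q S G) :
    sys.IsReducedField sys.reducedField := by
  refine Classical.epsilon_spec (p := sys.IsReducedField) ?_
  have hq : ∀ α : CotangentBundle (𝓡 r) S, ∃ β W, sys.constrain β = β ∧ sys.reduce β = α ∧
      sys.IsHamiltonianVector β W := by
    intro α
    obtain ⟨q, hq⟩ := sys.proj_surjective α.proj
    obtain ⟨W, hW⟩ := sys.exists_isHamiltonianVector (sys.lift q (momentum α))
    refine ⟨sys.lift q (momentum α), W, sys.constrain_lift _ _, ?_, hW⟩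
    rw [reduce_lift, hq]
    rfl
  choose b W hb hbα hW using hq
  refine ⟨fun α => modelD (cotangentModel (𝓡 n)) (cotangentModel (𝓡 r)) sys.reduce (b α) (W α),
    fun β hβ => ?_⟩
  obtain ⟨W', hW'⟩ := sys.exists_isHamiltonianVector β
  exact ⟨W', hW', modelD_reduce_unique (hb _) hβ (hbα _) (hW _) hW'⟩

theorem fieldC_reducedField {q₀ : Q} {α₀ : CotangentBundle (𝓡 r) S} {x : Vec n}
    (hx : x ∈ sys.chartDomain q₀ α₀.proj) (p : Vec r →L[ℝ] ℝ) :
    (fieldC sys.reducedField α₀ (sys.projC q₀ α₀.proj x, p)).1 =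
      sys.cometricC q₀ α₀.proj x p ∧
    ∀ u, (fieldC sys.reducedField α₀ (sys.projC q₀ α₀.proj x, p)).2 u =
      -fderiv ℝ (sys.hamiltonianC α₀) (sys.projC q₀ α₀.proj x, p) (u, 0) -
        p (sys.gyroC q₀ α₀.proj x u (sys.cometricC q₀ α₀.proj x p)) := by
  obtain ⟨q, hq⟩ : ∃ q, q = (extChartAt (𝓡 n) q₀).symm x := ⟨_, rfl⟩
  let β := sys.lift q (p.comp (chartD (𝓡 r) α₀.proj (sys.proj q)))
  have hβ : sys.constrain β = β := sys.constrain_lift _ _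
  have hred : sys.reduce β =
      (extChartAt (cotangentModel (𝓡 r)) α₀).symm (sys.projC q₀ α₀.proj x, p) := by
    rw [reduce_lift, extChartAt_cotangent_symm α₀ (projC_mem hx), symm_projC hx, hq]
  have hqs : q ∈ (extChartAt (𝓡 n) q₀).source := by
    rw [hq]; exact (extChartAt (𝓡 n) q₀).map_target hx.1
  obtain ⟨W, hW, hXW⟩ := sys.isReducedField_reducedField β hβ
  -- `γ₀` only selects a chart, which depends on its base point alone; the zero momentum is
  -- arbitrary.
  have h := chartD_modelD_reduce (γ₀ := covector (𝓡 n) q₀ 0) (α₀ := α₀) (x := x)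
    (z := (sys.projC q₀ α₀.proj x, p)) hβ
    (show q ∈ (chartAt (Vec n) q₀).source by rwa [← extChartAt_source (𝓡 n)])
    (show sys.proj q ∈ _ by rw [hq]; exact hx.2) hW
    (show extChartAt (𝓡 n) q₀ q = x by rw [hq]; exact (extChartAt (𝓡 n) q₀).right_inv hx.1)
    (by rw [hred]; exact (extChartAt (cotangentModel (𝓡 r)) α₀).right_inv
          (mem_cotangent_target α₀ (projC_mem hx)))
  have h2 : fieldC sys.reducedField α₀ (sys.projC q₀ α₀.proj x, p) =
      chartD (cotangentModel (𝓡 r)) α₀ (sys.reduce β)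
        (modelD (cotangentModel (𝓡 n)) (cotangentModel (𝓡 r)) sys.reduce β W) := by
    rw [fieldC, ← hred]
    exact congrArg _ hXW
  rw [h2]
  exact h

end ChaplyginSystem

/-! ### The Lie derivative of exp(σ) ν in a cotangent chart. -/

section Volume

variable {E : Type*} [NormedAddCommGroup E] [NormedSpace ℝ E] {H : Type*} [TopologicalSpace H]
  {I : ModelWithCorners ℝ E H} {M : Type*} [TopologicalSpace M] [ChartedSpace H M]
  [IsManifold I ∞ M] [I.Boundaryless]

theorem hasFDerivAt_inChart_self {E' : Type*} [NormedAddCommGroup E'] [NormedSpace ℝ E']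
    {f : M → E'} {x : M} (hf : MDifferentiableAt I 𝓘(ℝ, E') f x) :
    HasFDerivAt (fun y => f ((extChartAt I x).symm y)) (modelVD I f x) (extChartAt I x x) := by
  have h := hasFDerivAt_inChart (I := I) (f := f) (mem_extChartAt_target x)
    (by rwa [extChartAt_to_inv])
  rwa [extChartAt_to_inv, chartDsymm_self, ContinuousLinearMap.comp_id] at h

/-- The Lie derivative of the volume form `exp(σ) ν`, in a chart. -/
theorem lieD_exp_smul_liouvilleVolume [FiniteDimensional ℝ E] {k : ℕ}
    (hk : Module.finrank ℝ (E × (E →L[ℝ] ℝ)) = k * 2)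
    (X : VField (cotangentModel I) (CotangentBundle I M)) {σ : CotangentBundle I M → ℝ}
    (α : CotangentBundle I M) (hσ : MDifferentiableAt (cotangentModel I) 𝓘(ℝ, ℝ) σ α)
    (v : Fin (k * 2) → E × (E →L[ℝ] ℝ)) :
    lieD X (fun γ => Real.exp (σ γ) • liouvilleVolume I M k γ) α v =
      Real.exp (σ α) * (modelVD (cotangentModel I) σ α (fieldAt X α) +
        LinearMap.trace ℝ _ (fderiv ℝ (fieldC X α)
          (extChartAt (cotangentModel I) α α)).toLinearMap) * wedgePow (modelCanonical E) k v := by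
  obtain ⟨w, hw⟩ : ∃ w, w = extChartAt (cotangentModel I) α α := ⟨_, rfl⟩
  have hwt : w ∈ (extChartAt (cotangentModel I) α).target := by
    rw [hw]; exact mem_extChartAt_target α
  have hsw : (extChartAt (cotangentModel I) α).symm w = α := by rw [hw, extChartAt_to_inv]
  let X' : E × (E →L[ℝ] ℝ) → E × (E →L[ℝ] ℝ) := VectorField.mpullbackWithin
    𝓘(ℝ, E × (E →L[ℝ] ℝ)) (cotangentModel I) (extChartAt (cotangentModel I) α).symm X
    (Set.range (cotangentModel I))
  let η : DiffForm (cotangentModel I) (CotangentBundle I M) (k * 2) :=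
    fun γ => Real.exp (σ γ) • liouvilleVolume I M k γ
  have hX' : X' =ᶠ[𝓝 w] fieldC X α := by
    filter_upwards [eventually_mem_target hwt] with z hz
    exact fieldC_eq_mpullbackWithin X hz
  have hη : inChart η α =ᶠ[𝓝 w] fun z => Real.exp (σ ((extChartAt (cotangentModel I) α).symm z)) •
      wedgePow (modelCanonical E) k := by
    filter_upwards [eventually_mem_target hwt] with z hz
    rw [extChartAt_cotangent_target] at hz
    rw [← inChart_canonicalForm α hz.1, inChart_eq (canonicalForm I M),
      ← wedgePow_compContinuousLinearMap]
    rfl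
  have hdef : lieD X η α v = fderivWithin ℝ (inChart η α) (Set.range (cotangentModel I))
        (extChartAt (cotangentModel I) α α) (X' (extChartAt (cotangentModel I) α α))
        (fun i => chartD (cotangentModel I) α α (v i)) +
      ∑ i, inChart η α (extChartAt (cotangentModel I) α α)
        (Function.update (fun i => chartD (cotangentModel I) α α (v i)) i
          (fderivWithin ℝ X' (Set.range (cotangentModel I)) (extChartAt (cotangentModel I) α α)
            (chartD (cotangentModel I) α α (v i)))) := rfl
  change lieD X η α v = _
  have hσ' := (hasFDerivAt_inChart_self hσ).exp.smul_const (wedgePow (modelCanonical E) k)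
  rw [extChartAt_to_inv, ← hw] at hσ'
  rw [hdef, chartD_self, (cotangentModel I).range_eq_univ, fderivWithin_univ, fderivWithin_univ,
    ← hw, hη.fderiv_eq, hX'.fderiv_eq, hX'.eq_of_nhds, hη.eq_of_nhds, hσ'.fderiv]
  have htr := sum_update_eq_trace_mul hk (wedgePow (modelCanonical E) k)
    (fderiv ℝ (fieldC X α) w).toLinearMap v
  have hfs : fieldC X α w = fieldAt X α := by rw [hw, fieldC_self]
  rw [hfs, hsw]
  simp only [ContinuousLinearMap.id_apply, ContinuousAlternatingMap.smul_apply, smul_eq_mul,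
    ← Finset.mul_sum]
  have htr' : ∑ i, wedgePow (modelCanonical E) k
      (Function.update v i (fderiv ℝ (fieldC X α) w (v i))) = LinearMap.trace ℝ _
        (fderiv ℝ (fieldC X α) w).toLinearMap * wedgePow (modelCanonical E) k v := htr
  rw [htr']
  simp only [ContinuousLinearMap.smulRight_apply, _root_.smul_apply,
    ContinuousAlternatingMap.smul_apply, smul_eq_mul]
  ring

end Volume

namespace ChaplyginSystem

variable {n r m : ℕ} {Q S G : Type*}
    [TopologicalSpace Q] [ChartedSpace (EuclideanSpace ℝ (Fin n)) Q] [IsManifold (𝓡 n) ∞ Q]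
    [TopologicalSpace S] [ChartedSpace (EuclideanSpace ℝ (Fin r)) S] [IsManifold (𝓡 r) ∞ S]
    [TopologicalSpace G] [ChartedSpace (EuclideanSpace ℝ (Fin m)) G] [Group G]
    [LieGroup (𝓡 m) ∞ G] [MulAction G Q]

variable {sys : ChaplyginSystem n r m Q S G}

/-! ### The reduced vector field near a point -/

theorem fieldC_reducedField_eventuallyEq {q₀ : Q} {α₀ : CotangentBundle (𝓡 r) S}
    {σ : Vec r → Vec n} {y : Vec r} (hσs : ContDiffAt ℝ ∞ σ y)
    (hσ : ∀ᶠ y in 𝓝 y, σ y ∈ sys.chartDomain q₀ α₀.proj ∧ sys.projC q₀ α₀.proj (σ y) = y)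
    (p : Vec r →L[ℝ] ℝ) :
    fieldC sys.reducedField α₀ =ᶠ[𝓝 (y, p)] modelField
      (fun y => sys.cometricC q₀ α₀.proj (σ y)) (fun y => sys.potentialC q₀ (σ y))
      (fun y => sys.gyroC q₀ α₀.proj (σ y)) := by
  -- In contrast to order ∞, finite order of smoothness at a point passes to nearby points; order 1
  -- is enough here.
  have h1 : ∀ᶠ y in 𝓝 y, ContDiffAt ℝ 1 σ y :=
    (hσs.of_le (by simp)).eventually (by simp)
  have h2 : ∀ᶠ w in 𝓝 (y, p), (∀ᶠ z in 𝓝 w.1, σ z ∈ sys.chartDomain q₀ α₀.proj ∧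
      sys.projC q₀ α₀.proj (σ z) = z) ∧ ContDiffAt ℝ 1 σ w.1 :=
    (continuousAt_fst (p := (y, p))).eventually (hσ.eventually_nhds.and h1)
  filter_upwards [h2] with w hw
  obtain ⟨hw1, hw2⟩ := hw
  obtain ⟨hw3, hw4⟩ := hw1.self_of_nhds
  have h3 := fieldC_reducedField hw3 w.2
  have hσd : DifferentiableAt ℝ σ w.1 := hw2.differentiableAt (by simp)
  have hK : DifferentiableAt ℝ (fun y => sys.cometricC q₀ α₀.proj (σ y)) w.1 :=
    DifferentiableAt.comp (g := sys.cometricC q₀ α₀.proj) _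
      ((contDiffAt_cometricC hw3).differentiableAt (by simp)) hσd
  have hU : DifferentiableAt ℝ (fun y => sys.potentialC q₀ (σ y)) w.1 :=
    DifferentiableAt.comp (g := sys.potentialC q₀) _
      ((contDiffAt_potentialC hw3.1).differentiableAt (by simp)) hσd
  have hH : sys.hamiltonianC α₀ =ᶠ[𝓝 w] _ := hamiltonianC_eventuallyEq hw1 w.2
  obtain ⟨-, h5⟩ := hasFDerivAt_modelHamiltonian (w := w) hK hU (fun p q => cometricC_symm p q)
  rw [hw4] at h3
  change (fieldC sys.reducedField α₀ w).1 = _ ∧ ∀ u, (fieldC sys.reducedField α₀ w).2 u =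
    -fderiv ℝ (sys.hamiltonianC α₀) w (u, 0) - _ at h3
  refine Prod.ext h3.1 ?_
  ext u
  rw [h3.2, hH.fderiv_eq, h5]
  simp [modelField]
  ring

theorem contDiffAt_section_comp {q₀ : Q} {s₀ : S} {x : Vec n} {σ : Vec r → Vec n} {y : Vec r}
    (hx : x ∈ sys.chartDomain q₀ s₀) (hσs : ContDiffAt ℝ ∞ σ y) (hσx : σ y = x) :
    ContDiffAt ℝ ∞ (fun y => sys.cometricC q₀ s₀ (σ y)) y ∧
      ContDiffAt ℝ ∞ (fun y => sys.potentialC q₀ (σ y)) y ∧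
      ContDiffAt ℝ ∞ (fun y => sys.gyroC q₀ s₀ (σ y)) y := by
  subst hσx
  exact ⟨ContDiffAt.comp (g := sys.cometricC q₀ s₀) _ (contDiffAt_cometricC hx) hσs,
    ContDiffAt.comp (g := sys.potentialC q₀) _ (contDiffAt_potentialC hx.1) hσs,
    ContDiffAt.comp (g := sys.gyroC q₀ s₀) _ (contDiffAt_gyroC hx) hσs⟩

/-- The gyroscopic tensor at `q`, as a bilinear map on the model space. -/
def gyroM (sys : ChaplyginSystem n r m Q S G) (q : Q) : Vec r →L[ℝ] Vec r →L[ℝ] Vec r :=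
  sys.gyroC q (sys.proj q) (extChartAt (𝓡 n) q q)

theorem gyroM_skew (q : Q) (u v : Vec r) : sys.gyroM q u v = -sys.gyroM q v u := gyroC_skew u v

theorem cometric_surjective (sys : ChaplyginSystem n r m Q S G) (q : Q) :
    Function.Surjective (sys.cometric q) := fun w => ⟨_, sys.cometric_shapeMetric q w⟩

section Centre

variable {q : Q} {s : S}

theorem extChartAt_mem_chartDomain (hs : s = sys.proj q) :
    extChartAt (𝓡 n) q q ∈ sys.chartDomain q s := by
  subst hs; exact sys.self_mem_chartDomain q

theorem cometricC_self (hs : s = sys.proj q) :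
    sys.cometricC q s (extChartAt (𝓡 n) q q) = sys.cometric q := by
  subst hs
  rw [cometricC, extChartAt_to_inv, chartD_self]
  rfl

theorem gyroC_self (hs : s = sys.proj q) :
    sys.gyroC q s (extChartAt (𝓡 n) q q) = sys.gyroM q := by
  subst hs; rfl

theorem projC_self (hs : s = sys.proj q) :
    sys.projC q s (extChartAt (𝓡 n) q q) = extChartAt (𝓡 r) s s := by
  subst hs; rw [projC, extChartAt_to_inv]

variable {α : CotangentBundle (𝓡 r) S}

theorem hamiltonianC_fderiv_self (α : CotangentBundle (𝓡 r) S) :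
    fderiv ℝ (sys.hamiltonianC α) (extChartAt (𝓡 r) α.proj α.proj, momentum α) =
      modelVD (cotangentModel (𝓡 r)) sys.reducedHamiltonian α := by
  rw [← extChartAt_cotangent_self]
  exact (hasFDerivAt_inChart_self (sys.mdifferentiableAt_reducedHamiltonian α)).fderiv

/-- The reduced vector field at a point. -/
theorem fieldAt_reducedField (hα : α.proj = sys.proj q) :
    (fieldAt sys.reducedField α).1 = sys.cometric q (momentum α) ∧
      ∀ u, (fieldAt sys.reducedField α).2 u =
        -modelVD (cotangentModel (𝓡 r)) sys.reducedHamiltonian α (u, 0)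
          - momentum α (sys.gyroM q u (sys.cometric q (momentum α))) := by
  have h := fieldC_reducedField (extChartAt_mem_chartDomain hα) (momentum α)
  rw [projC_self hα, hamiltonianC_fderiv_self, ← extChartAt_cotangent_self, fieldC_self,
    cometricC_self hα, gyroC_self hα] at h
  exact h

theorem modelVD_reducedHamiltonian (hα : α.proj = sys.proj q) (p' : Vec r →L[ℝ] ℝ) :
    modelVD (cotangentModel (𝓡 r)) sys.reducedHamiltonian α (0, p') =
      p' (sys.cometric q (momentum α)) := by
  have h := (fderiv_hamiltonianC (extChartAt_mem_chartDomain hα) (momentum α)).2 p'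
  rwa [projC_self hα, hamiltonianC_fderiv_self, cometricC_self hα] at h

/-- The divergence of the reduced vector field. -/
theorem trace_fderiv_fieldC_reducedField (hα : α.proj = sys.proj q) :
    LinearMap.trace ℝ _ (fderiv ℝ (fieldC sys.reducedField α)
      (extChartAt (cotangentModel (𝓡 r)) α α)).toLinearMap =
      -∑ j, (sys.gyroM q (EuclideanSpace.single j 1) (sys.cometric q (momentum α))) j := by
  have hx := extChartAt_mem_chartDomain hα
  obtain ⟨σ, h1, h2, h3⟩ := exists_section hx
  rw [projC_self hα] at h1 h2 h3
  obtain ⟨hK, hU, hT⟩ := contDiffAt_section_comp hx h1 h2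
  have hev := fieldC_reducedField_eventuallyEq h1 h3 (momentum α)
  rw [extChartAt_cotangent_self, hev.fderiv_eq]
  have h4 := trace_fderiv_modelField (w := (extChartAt (𝓡 r) α.proj α.proj, momentum α))
    (hK.differentiableAt (by simp))
    ((contDiffAt_modelField (w := (extChartAt (𝓡 r) α.proj α.proj, momentum α))
      hK hU hT).differentiableAt (by simp))
    (Filter.Eventually.of_forall fun z p q => cometricC_symm p q) (fun u v => gyroC_skew u v)
  refine h4.trans ?_
  simp only [h2, cometricC_self hα, gyroC_self hα]

end Centre

end ChaplyginSystem

namespace ChaplyginSystem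

section AnyDegrees

variable {n r m : ℕ} {Q S G : Type*}
    [TopologicalSpace Q] [ChartedSpace (EuclideanSpace ℝ (Fin n)) Q] [IsManifold (𝓡 n) ∞ Q]
    [TopologicalSpace S] [ChartedSpace (EuclideanSpace ℝ (Fin r)) S] [IsManifold (𝓡 r) ∞ S]
    [TopologicalSpace G] [ChartedSpace (EuclideanSpace ℝ (Fin m)) G] [Group G]
    [LieGroup (𝓡 m) ∞ G] [MulAction G Q]

variable {sys : ChaplyginSystem n r m Q S G}

/-! ### Simple systems are Hamiltonisable -/

theorem isPhiSimple_of_gyroM {φ : S → ℝ} (hφ : ContMDiff (𝓡 r) 𝓘(ℝ, ℝ) ∞ φ)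
    (h : ∀ q u v, sys.gyroM q u v = modelVD (𝓡 r) φ (sys.proj q) v • u
      - modelVD (𝓡 r) φ (sys.proj q) u • v) : sys.IsPhiSimple φ :=
  ⟨hφ, fun _ _ hY hZ q => (gyroAt_eq hY hZ q).trans (h q _ _)⟩

/-- Simplicity is stated for global smooth fields; extending two vectors to such fields by bump
functions gives the pointwise identity. -/
theorem IsPhiSimple.gyroM_eq [T2Space S] {φ : S → ℝ} (h : sys.IsPhiSimple φ) (q : Q)
    (u v : Vec r) : sys.gyroM q u v = modelVD (𝓡 r) φ (sys.proj q) v • u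
      - modelVD (𝓡 r) φ (sys.proj q) u • v := by
  obtain ⟨Y, hY, rfl⟩ := exists_smooth_field (I := 𝓡 r) (sys.proj q) u
  obtain ⟨Z, hZ, rfl⟩ := exists_smooth_field (I := 𝓡 r) (sys.proj q) v
  exact (gyroAt_eq hY hZ q).symm.trans (h.2 Y Z hY hZ q)

theorem modelVD_exp {φ : S → ℝ} (hφ : ContMDiff (𝓡 r) 𝓘(ℝ, ℝ) ∞ φ) (s : S) (v : Vec r) :
    modelVD (𝓡 r) (fun s => Real.exp (φ s)) s v = Real.exp (φ s) * modelVD (𝓡 r) φ s v := by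
  have h1 := hasFDerivAt_inChart_self ((Real.contDiff_exp.contMDiff.comp hφ).mdifferentiable
    (by simp) s)
  have h2 := (hasFDerivAt_inChart_self (hφ.mdifferentiable (by simp) s)).exp
  have h3 := DFunLike.congr_fun (h1.unique h2) v
  rw [extChartAt_to_inv] at h3
  exact h3

/-- Contracting X with Ω_can gives dH + p(T(·, K p)). Contracting it with dφ ∧ λ gives dφ(K p) p -
p(K p) dφ, which for a φ-simple tensor is the same gyroscopic term. So X contracted with e^φ (Ω_can
- dφ ∧ λ) is e^φ dH, and the time change removes the factor. -/
theorem IsPhiSimple.isHamiltonisableWith [T2Space S] {φ : S → ℝ} (h : sys.IsPhiSimple φ) :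
    sys.IsHamiltonisableWith (fun s => Real.exp (-φ s)) := by
  have hexp : ContMDiff (𝓡 r) 𝓘(ℝ, ℝ) ∞ (fun s => Real.exp (φ s)) :=
    Real.contDiff_exp.contMDiff.comp h.1
  refine ⟨Real.contDiff_exp.contMDiff.comp h.1.neg, fun s => Real.exp_pos _,
    -extD (scaledLiouville (𝓡 r) fun s => Real.exp (φ s)),
    isSymplecticForm_neg_extD_scaledLiouville hexp fun s => Real.exp_pos _, fun α V => ?_⟩
  obtain ⟨q, hq⟩ := sys.proj_surjective α.proj
  obtain ⟨h1, h2⟩ := fieldAt_reducedField hq.symm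
  have h3 := modelVD_reducedHamiltonian hq.symm
  have hT := h.gyroM_eq q
  rw [hq] at hT
  obtain ⟨b, hb⟩ : ∃ b : Vec r × (Vec r →L[ℝ] ℝ), b = V := ⟨V, rfl⟩
  have hexp0 : Real.exp (φ α.proj) * Real.exp (-φ α.proj) = 1 := by
    rw [← Real.exp_add, add_neg_cancel, Real.exp_zero]
  change -(formAt (cotangentModel (𝓡 r)) (extD (scaledLiouville (𝓡 r) fun s => Real.exp (φ s))) α
    ![Real.exp (-φ α.proj) • fieldAt sys.reducedField α, V]) =
      modelVD (cotangentModel (𝓡 r)) sys.reducedHamiltonian α V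
  rw [← hb, extD_scaledLiouville_apply hexp, modelVD_exp h.1, modelVD_exp h.1]
  have hsplit : modelVD (cotangentModel (𝓡 r)) sys.reducedHamiltonian α b =
      modelVD (cotangentModel (𝓡 r)) sys.reducedHamiltonian α (b.1, 0) +
        b.2 (sys.cometric q (momentum α)) := by
    rw [← h3, ← map_add]
    simp
  have h2b := h2 b.1
  rw [hT, map_sub, map_smul, map_smul, smul_eq_mul, smul_eq_mul] at h2b
  rw [hsplit, Prod.smul_fst, Prod.smul_snd, h1, map_smul, map_smul, map_smul,
    _root_.smul_apply, h2b]
  simp only [smul_eq_mul]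
  -- The gyroscopic terms have cancelled; what remains is dH multiplied by exp(φ) exp(-φ).
  linear_combination
    (modelVD (cotangentModel (𝓡 r)) sys.reducedHamiltonian α (b.1, 0) +
      b.2 (sys.cometric q (momentum α))) * hexp0

/-! ### Invariant measures -/

theorem finrank_phaseSpace (r : ℕ) : Module.finrank ℝ (Vec r × (Vec r →L[ℝ] ℝ)) = r * 2 := by
  rw [Module.finrank_prod, ← finrank_continuousDual, finrank_euclideanSpace_fin, mul_two]

theorem lieD_reducedField {σ : CotangentBundle (𝓡 r) S → ℝ}
    (hσ : MDifferentiable (cotangentModel (𝓡 r)) 𝓘(ℝ, ℝ) σ) {q : Q}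
    {α : CotangentBundle (𝓡 r) S} (hα : α.proj = sys.proj q)
    (v : Fin (r * 2) → Vec r × (Vec r →L[ℝ] ℝ)) :
    lieD sys.reducedField (fun γ => Real.exp (σ γ) • liouvilleVolume (𝓡 r) S r γ) α v =
      Real.exp (σ α) * (modelVD (cotangentModel (𝓡 r)) σ α (fieldAt sys.reducedField α) -
        ∑ j, (sys.gyroM q (EuclideanSpace.single j 1) (sys.cometric q (momentum α))) j) *
          wedgePow (modelCanonical (Vec r)) r v := by
  rw [lieD_exp_smul_liouvilleVolume (finrank_phaseSpace r) _ _ (hσ α),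
    trace_fderiv_fieldC_reducedField hα, ← sub_eq_add_neg]

theorem preservesMeasure_of_modelVD {σ : CotangentBundle (𝓡 r) S → ℝ}
    (hσ : MDifferentiable (cotangentModel (𝓡 r)) 𝓘(ℝ, ℝ) σ)
    (h : ∀ (α : CotangentBundle (𝓡 r) S) (q : Q), α.proj = sys.proj q →
      modelVD (cotangentModel (𝓡 r)) σ α (fieldAt sys.reducedField α) =
        ∑ j, (sys.gyroM q (EuclideanSpace.single j 1) (sys.cometric q (momentum α))) j) :
    sys.PreservesMeasure σ := by
  intro α v
  obtain ⟨q, hq⟩ := sys.proj_surjective α.proj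
  refine (lieD_reducedField hσ hq.symm v).trans ?_
  rw [h α q hq.symm, sub_self, mul_zero, zero_mul]

theorem modelVD_comp_proj {φ : S → ℝ} (hφ : ContMDiff (𝓡 r) 𝓘(ℝ, ℝ) ∞ φ)
    (α : CotangentBundle (𝓡 r) S) (a : Vec r × (Vec r →L[ℝ] ℝ)) :
    MDifferentiableAt (cotangentModel (𝓡 r)) 𝓘(ℝ, ℝ)
      (fun α : CotangentBundle (𝓡 r) S => φ α.proj) α ∧
    modelVD (cotangentModel (𝓡 r)) (fun α => φ α.proj) α a = modelVD (𝓡 r) φ α.proj a.1 := by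
  have hd : MDifferentiableAt (cotangentModel (𝓡 r)) 𝓘(ℝ, ℝ)
      (fun α : CotangentBundle (𝓡 r) S => φ α.proj) α :=
    (hφ.mdifferentiable (by simp) α.proj).comp α
      (Bundle.contMDiffAt_proj _ |>.mdifferentiableAt (n := ∞) (by simp))
  refine ⟨hd, ?_⟩
  have h1 := hasFDerivAt_inChart_self hd
  rw [extChartAt_cotangent_self] at h1
  have h2 : HasFDerivAt (fun w : Vec r × (Vec r →L[ℝ] ℝ) =>
      φ ((extChartAt (𝓡 r) α.proj).symm w.1)) _ (extChartAt (𝓡 r) α.proj α.proj, momentum α) :=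
    HasFDerivAt.comp (g := fun y => φ ((extChartAt (𝓡 r) α.proj).symm y))
      (extChartAt (𝓡 r) α.proj α.proj, momentum α)
      (hasFDerivAt_inChart_self (hφ.mdifferentiable (by simp) α.proj)) hasFDerivAt_fst
  have h3 : ∀ᶠ w in 𝓝 (extChartAt (𝓡 r) α.proj α.proj, momentum α),
      w.1 ∈ (extChartAt (𝓡 r) α.proj).target :=
    continuousAt_fst.eventually (eventually_mem_target (mem_extChartAt_target α.proj))
  have h4 := h2.congr_of_eventuallyEq (f₁ := fun w =>
    φ ((extChartAt (cotangentModel (𝓡 r)) α).symm w).proj) (by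
      filter_upwards [h3] with w hw
      have h5 := extChartAt_cotangent_symm α hw w.2
      change φ ((extChartAt (cotangentModel (𝓡 r)) α).symm (w.1, w.2)).proj = _
      rw [h5]
      rfl)
  exact DFunLike.congr_fun (h1.unique h4) a

/-- All covectors over one point share a chart, which allows the momentum to vary with the chart
held fixed. -/
theorem extChartAt_cotangent_congr {α β : CotangentBundle (𝓡 r) S} (h : α.proj = β.proj) :
    extChartAt (cotangentModel (𝓡 r)) α = extChartAt (cotangentModel (𝓡 r)) β := by
  rw [FiberBundle.extChartAt, FiberBundle.extChartAt, h]

theorem fieldC_cotangent_congr (X : VField (cotangentModel (𝓡 r)) (CotangentBundle (𝓡 r) S))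
    {α β : CotangentBundle (𝓡 r) S} (h : α.proj = β.proj) : fieldC X α = fieldC X β := by
  unfold fieldC chartD
  rw [extChartAt_cotangent_congr h]

theorem contMDiff_covector_zero :
    ContMDiff (𝓡 r) (cotangentModel (𝓡 r)) ∞ (fun s : S => covector (𝓡 r) s 0) :=
  Bundle.contMDiff_zeroSection ℝ (fun s : S => TangentSpace (𝓡 r) s →L[ℝ] ℝ)

theorem modelVD_zeroSection {σ : CotangentBundle (𝓡 r) S → ℝ}
    (hσ : ContMDiff (cotangentModel (𝓡 r)) 𝓘(ℝ, ℝ) ∞ σ) (s : S) (v : Vec r) :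
    modelVD (𝓡 r) (fun s => σ (covector (𝓡 r) s 0)) s v =
      modelVD (cotangentModel (𝓡 r)) σ (covector (𝓡 r) s 0) (v, 0) := by
  have h1 := hasFDerivAt_inChart_self
    ((hσ.comp contMDiff_covector_zero).mdifferentiable (by simp) s)
  have h2 := hasFDerivAt_inChart_self (hσ.mdifferentiable (by simp) (covector (𝓡 r) s 0))
  rw [extChartAt_cotangent_self] at h2
  have h3 := HasFDerivAt.comp (extChartAt (𝓡 r) s s) h2
    (hasFDerivAt_prodMk_left (𝕜 := ℝ) (extChartAt (𝓡 r) s s) (0 : Vec r →L[ℝ] ℝ))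
  have h4 := h3.congr_of_eventuallyEq (f₁ := fun y =>
    σ (covector (𝓡 r) ((extChartAt (𝓡 r) s).symm y) 0)) (by
      filter_upwards [eventually_mem_target (mem_extChartAt_target s)] with y hy
      have h5 := extChartAt_cotangent_symm (covector (𝓡 r) s 0) hy 0
      rw [ContinuousLinearMap.zero_comp] at h5
      exact congrArg σ h5.symm)
  exact DFunLike.congr_fun (h1.unique h4) v

end AnyDegrees

section TwoDegrees

variable {n m : ℕ} {Q S G : Type*}
    [TopologicalSpace Q] [ChartedSpace (EuclideanSpace ℝ (Fin n)) Q] [IsManifold (𝓡 n) ∞ Q]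
    [TopologicalSpace S] [ChartedSpace (EuclideanSpace ℝ (Fin 2)) S] [IsManifold (𝓡 2) ∞ S]
    [TopologicalSpace G] [ChartedSpace (EuclideanSpace ℝ (Fin m)) G] [Group G]
    [LieGroup (𝓡 m) ∞ G] [MulAction G Q]
    {sys : ChaplyginSystem n 2 m Q S G}

/-! ### Two degrees of freedom -/

theorem PreservesMeasure.modelVD_eq
    {σ : CotangentBundle (𝓡 2) S → ℝ} (h : sys.PreservesMeasure σ)
    (hσ : MDifferentiable (cotangentModel (𝓡 2)) 𝓘(ℝ, ℝ) σ) {q : Q}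
    {α : CotangentBundle (𝓡 2) S} (hα : α.proj = sys.proj q) :
    modelVD (cotangentModel (𝓡 2)) σ α (fieldAt sys.reducedField α) =
      ∑ j, (sys.gyroM q (EuclideanSpace.single j 1) (sys.cometric q (momentum α))) j := by
  obtain ⟨v, hv⟩ : ∃ v, wedgePow (modelCanonical (Vec 2)) 2 v ≠ 0 := by
    by_contra hv
    push Not at hv
    exact wedgePow_two_modelCanonical_ne_zero (ContinuousAlternatingMap.ext hv)
  have h1 := (lieD_reducedField hσ hα v).symm.trans (h α v)
  have h2 := (mul_eq_zero.1 h1).resolve_right hv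
  exact sub_eq_zero.1 ((mul_eq_zero.1 h2).resolve_left (Real.exp_pos _).ne')

/-- The cometric is onto, so the hypothesis says that dφ is the trace form of the gyroscopic tensor,
and in dimension two this form determines the tensor. -/
theorem isPhiSimple_of_modelVD_cometric {φ : S → ℝ}
    (hφ : ContMDiff (𝓡 2) 𝓘(ℝ, ℝ) ∞ φ)
    (h : ∀ q p, modelVD (𝓡 2) φ (sys.proj q) (sys.cometric q p) =
      ∑ j, (sys.gyroM q (EuclideanSpace.single j 1) (sys.cometric q p)) j) :
    sys.IsPhiSimple φ := by
  refine isPhiSimple_of_gyroM hφ fun q u v => ?_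
  obtain ⟨p, rfl⟩ := sys.cometric_surjective q u
  obtain ⟨p', rfl⟩ := sys.cometric_surjective q v
  rw [h, h]
  exact skew_eq_of_two (sys.gyroM_skew q) _ _

/-- The derivative along X of a function pulled back from S sees only the base component K p. The
momentum equation, and with it the potential, plays no part. -/
theorem PreservesMeasure.isPhiSimple {φ : S → ℝ}
    (hφ : ContMDiff (𝓡 2) 𝓘(ℝ, ℝ) ∞ φ) (h : sys.PreservesMeasure (fun α => φ α.proj)) :
    sys.IsPhiSimple φ := by
  refine isPhiSimple_of_modelVD_cometric hφ fun q p => ?_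
  have h1 := h.modelVD_eq (fun α => (modelVD_comp_proj hφ α 0).1) (q := q)
    (α := covector (𝓡 2) (sys.proj q) p) rfl
  rw [(modelVD_comp_proj hφ _ _).2, (fieldAt_reducedField (q := q) rfl).1] at h1
  exact h1

theorem IsPhiSimple.preservesMeasure [T2Space S] {φ : S → ℝ}
    (h : sys.IsPhiSimple φ) : sys.PreservesMeasure (fun α => φ α.proj) := by
  refine preservesMeasure_of_modelVD (fun α => (modelVD_comp_proj h.1 α 0).1) fun α q hα => ?_
  rw [(modelVD_comp_proj h.1 _ _).2, (fieldAt_reducedField hα).1,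
    sum_trace_of_simple (h.gyroM_eq q), hα]

/-- Invariance reads dσ(X) = θ(K p), with right side linear in p. Since X vanishes at p = 0,
differentiating there in the direction ρ leaves dσ applied to the linearisation of X, which is (K ρ,
0). So the restriction of σ to the zero section has differential θ, even if σ itself depends on the
momenta. -/
theorem PreservesMeasure.isPhiSimple_of_potential_eq_zero
    {σ : CotangentBundle (𝓡 2) S → ℝ} (hU : ∀ q, sys.potential q = 0)
    (hσ : ContMDiff (cotangentModel (𝓡 2)) 𝓘(ℝ, ℝ) ∞ σ) (h : sys.PreservesMeasure σ) :
    sys.IsPhiSimple (fun s => σ (covector (𝓡 2) s 0)) := by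
  refine isPhiSimple_of_modelVD_cometric (hσ.comp contMDiff_covector_zero) fun q ρ => ?_
  obtain ⟨s, hs⟩ : ∃ s, s = sys.proj q := ⟨_, rfl⟩
  rw [← hs]
  set α := covector (𝓡 2) s 0 with hα
  set y := extChartAt (𝓡 2) s s with hy
  have hx := extChartAt_mem_chartDomain hs
  obtain ⟨τ, h1, h2, h3⟩ := exists_section hx
  rw [projC_self hs, ← hy] at h1 h2 h3
  have hτ : sys.cometricC q s (τ y) = sys.cometric q := by rw [h2, cometricC_self hs]
  obtain ⟨hK, hU', hT⟩ := contDiffAt_section_comp hx h1 h2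
  set X := modelField (fun y => sys.cometricC q s (τ y)) (fun y => sys.potentialC q (τ y))
      (fun y => sys.gyroC q s (τ y)) with hX
  let σC : Vec 2 × (Vec 2 →L[ℝ] ℝ) → ℝ := fun w =>
    σ ((extChartAt (cotangentModel (𝓡 2)) α).symm w)
  have hσC : ContDiffAt ℝ ∞ σC (y, 0) := contDiffAt_inChart
    (mem_cotangent_target α (mem_extChartAt_target s)) hσ.contMDiffAt
  have hXs : DifferentiableAt ℝ X (y, 0) :=
    (contDiffAt_modelField (w := (y, 0)) hK hU' hT).differentiableAt (by simp)
  have hself : ∀ p, (y, p) = extChartAt (cotangentModel (𝓡 2)) (covector (𝓡 2) s p)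
      (covector (𝓡 2) s p) := fun p => (extChartAt_cotangent_self (covector (𝓡 2) s p)).symm
  have hG : ∀ p, fderiv ℝ σC (y, p) (X (y, p)) =
      ∑ j, (sys.gyroM q (EuclideanSpace.single j 1) (sys.cometric q p)) j := by
    intro p
    have hev := (fieldC_reducedField_eventuallyEq (α₀ := α) h1 h3 p).eq_of_nhds
    have h4 := h.modelVD_eq (hσ.mdifferentiable (by simp)) (q := q)
      (α := covector (𝓡 2) s p) hs
    have h5 := (hasFDerivAt_inChart_self
      (hσ.mdifferentiable (by simp) (covector (𝓡 2) s p))).fderiv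
    rw [extChartAt_cotangent_congr (show (covector (𝓡 2) s p).proj = α.proj from rfl)] at h5
    rw [← h5, ← fieldC_self, fieldC_cotangent_congr _
      (show (covector (𝓡 2) s p).proj = α.proj from rfl), ← hself, hev] at h4
    rw [extChartAt_cotangent_congr (show α.proj = (covector (𝓡 2) s p).proj from rfl),
      ← hself] at h4
    exact h4
  -- Without potential every term of the field contains the momentum, so the zero section consists
  -- of equilibria.
  have hX0 : X (y, 0) = 0 := by
    have hU0 : (fun y => sys.potentialC q (τ y)) = fun _ => (0 : ℝ) := funext fun y => hU _
    rw [hX, hU0]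
    simp [modelField]
  -- In this product rule the second derivative of σ is paired with X(y, 0) = 0 and drops out.
  have hD : HasFDerivAt (fun p => fderiv ℝ σC (y, p) (X (y, p))) _ (0 : Vec 2 →L[ℝ] ℝ) :=
    (HasFDerivAt.comp (g := fderiv ℝ σC) (0 : Vec 2 →L[ℝ] ℝ)
      ((hσC.fderiv_right (m := ∞) (by simp)).differentiableAt (by simp)).hasFDerivAt
      (hasFDerivAt_prodMk_right y 0)).clm_apply
    (HasFDerivAt.comp (g := X) (0 : Vec 2 →L[ℝ] ℝ) hXs.hasFDerivAt (hasFDerivAt_prodMk_right y 0))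
  let L : (Vec 2 →L[ℝ] ℝ) →L[ℝ] ℝ := ∑ j, (EuclideanSpace.proj (𝕜 := ℝ) j).comp
    ((sys.gyroM q (EuclideanSpace.single j 1)).comp (sys.cometric q))
  have hL : (fun p => fderiv ℝ σC (y, p) (X (y, p))) = L := by
    funext p
    rw [hG]
    simp [L]
  rw [hL] at hD
  have h6 := DFunLike.congr_fun (hD.unique L.hasFDerivAt) ρ
  -- The momentum component of X is quadratic in p, so it has no linear part at p = 0.
  have h7 : fderiv ℝ X (y, 0) (0, ρ) = (sys.cometric q ρ, 0) := by
    refine Prod.ext ?_ ?_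
    · rw [fderiv_modelField_fst (hK.differentiableAt (by simp)) hXs]
      simp [hτ]
    · ext u
      rw [fderiv_modelField_snd hXs]
      simp
  have h8 : fderiv ℝ σC (y, 0) = modelVD (cotangentModel (𝓡 2)) σ α := by
    rw [hself 0]
    exact (hasFDerivAt_inChart_self (hσ.mdifferentiable (by simp) α)).fderiv
  rw [modelVD_zeroSection hσ]
  have h9 : L ρ = ∑ j, (sys.gyroM q (EuclideanSpace.single j 1) (sys.cometric q ρ)) j := by
    simp [L]
  rw [← h9, ← h6, ← h8, ← h7]
  simp [hX0]

end TwoDegrees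

end ChaplyginSystem

end Chaplygin

end

theorem corollaryC {n r m : ℕ} {Q S G : Type*}
    [TopologicalSpace Q] [T2Space Q] [SecondCountableTopology Q]
    [ChartedSpace (EuclideanSpace ℝ (Fin n)) Q] [IsManifold (𝓡 n) ∞ Q]
    [TopologicalSpace S] [T2Space S] [SecondCountableTopology S]
    [ChartedSpace (EuclideanSpace ℝ (Fin r)) S] [IsManifold (𝓡 r) ∞ S]
    [TopologicalSpace G] [T2Space G] [SecondCountableTopology G]
    [ChartedSpace (EuclideanSpace ℝ (Fin m)) G] [Group G] [LieGroup (𝓡 m) ∞ G]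
    [MulAction G Q]
    (sys : Chaplygin.ChaplyginSystem n r m Q S G) :
    -- (i) two degrees of freedom, no potential: invariant measure iff `φ`-simple for some `φ`
    (r = 2 → (∀ q, sys.potential q = 0) →
      (sys.HasInvariantMeasure ↔ ∃ φ : S → ℝ, sys.IsPhiSimple φ)) ∧
    -- (ii) Chaplygin's reducing multiplier theorem
    (r = 2 → ∀ σ : S → ℝ, ContMDiff (𝓡 r) 𝓘(ℝ, ℝ) ∞ σ →
      sys.PreservesMeasure (fun α => σ α.proj) →
      sys.IsHamiltonisableWith (fun s => Real.exp (-σ s))) ∧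
    -- (iii) persistence under an invariant potential `W`, for any number of degrees of freedom
    (∀ φ : S → ℝ, sys.IsPhiSimple φ →
      ∀ (W : Q → ℝ) (hW : ContMDiff (𝓡 n) 𝓘(ℝ, ℝ) ∞ W)
        (hinv : ∀ (g : G) (q : Q), W (g • q) = W q),
        (sys.addPotential W hW hinv).IsHamiltonisableWith (fun s => Real.exp (-φ s))) ∧
    -- (iii) persistence of the Hamiltonisation in (ii), with the same time reparametrisation
    (r = 2 → ∀ σ : S → ℝ, ContMDiff (𝓡 r) 𝓘(ℝ, ℝ) ∞ σ →
      sys.PreservesMeasure (fun α => σ α.proj) →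
      ∀ (W : Q → ℝ) (hW : ContMDiff (𝓡 n) 𝓘(ℝ, ℝ) ∞ W)
        (hinv : ∀ (g : G) (q : Q), W (g • q) = W q),
        (sys.addPotential W hW hinv).IsHamiltonisableWith (fun s => Real.exp (-σ s))) := by
  refine ⟨?_, ?_, ?_, ?_⟩
  · rintro rfl hU
    constructor
    · rintro ⟨σ, hσ, h⟩
      exact ⟨_, h.isPhiSimple_of_potential_eq_zero hU hσ⟩
    · rintro ⟨φ, hφ⟩
      exact ⟨fun α => φ α.proj, hφ.1.comp (Bundle.contMDiff_proj _), hφ.preservesMeasure⟩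
  · rintro rfl σ hσ h
    exact (h.isPhiSimple hσ).isHamiltonisableWith
  · intro φ hφ W hW hinv
    -- The gyroscopic tensor is built from the metric, D and π alone, so simplicity of the two
    -- systems is the same proposition by unfolding.
    have h : (sys.addPotential W hW hinv).IsPhiSimple φ := hφ
    exact h.isHamiltonisableWith
  · rintro rfl σ hσ h W hW hinv
    have h₀ := h.isPhiSimple hσ
    have h' : (sys.addPotential W hW hinv).IsPhiSimple σ := h₀
    exact h'.isHamiltonisableWith
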